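/- Let $\mathbb F\in\{\mathbb R,\mathbb C\}$ and let $M$ be a Hausdorff smooth manifold. **Functions.** For a (not necessarily Hausdorff) smooth manifold $X$, $C_c^\infty(X)$ denotes the space of sums $\sum_i f_i|_{U_i}^X$, where $U_i\subset X$ is open and Hausdorff, $f_i$ is a smooth $\mathbb F$-valued function with compact support on $U_i$, and $f_i|_{U_i}^X$ is its extension by zero, regarded as a (not necessarily continuous) section $x\mapsto u_x$ of the sheaf of germs of functions on $X$. For a local diffeomorphism $\varphi:X\to Y$ put $\varphi_+(u)_y=\sum_{x\in\varphi^{-1}(y)}(\varphi_x^*)^{-1}(u_x)$, where $\varphi_x^*$ is composition of germs with $\varphi$. For two local diffeomorphisms $\pi:X\to M$, $\xi:Y\to M$ put $\Omega_{\pi,\xi}(u\otimes v)_{(x,y)}=\mathrm{pr}_1^*(u_x)\,\mathrm{pr}_2^*(v_y)$ on $X\times_M Y$. The space $R=C_c^\infty(M)$ is a commutative algebra under pointwise multiplication. **Hopf algebroids.** Let $R$ be a commutative $\mathbb F$-algebra, perhaps without identity. A Hopf algebroid over $R$ is an associative $\mathbb F$-algebra $A$ (perhaps without identity) which contains $R$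 as a subalgebra and has local identities in $R$ (for any $a_1,\dots,a_k\in A$ there is $r\in R$ with $ra_i=a_ir=a_i$), with $\mathbb F$-linear maps $\Delta:A\to A\otimes_R^{ll}A$ (tensor product for the left $R$-actions on both factors), $\epsilon:A\to R$ and $S:A\to A$ such that: (i) $\Delta,\epsilon$ are left $R$-linear, $(\mathrm{id}\otimes\epsilon)\Delta=\mathrm{id}=(\epsilon\otimes\mathrm{id})\Delta$; (ii) $\epsilon|_R=\mathrm{id}$, $\Delta|_R$ is the canonical map $R\cong R\otimes_RR\to A\otimes_R^{ll}A$, and the two right $R$-actions on $A\otimes_R^{ll}A$ coincide on $\Delta A$; (iii) $\Delta(ab)=\Delta(a)\Delta(b)$; (iv) $S|_R=\mathrm{id}$, $S\circ S=\mathrm{id}$; (v) $S(ab)=S(b)S(a)$; (vi) $\mu\circ(S\otimes\mathrm{id})\circ\Delta=\epsilon\circ S$, where $\mu$ is the multiplication. It is coassociative if $(\Delta\otimes\mathrm{id})\Delta=(\mathrm{id}\otimes\Delta)\Delta$ and cocommutative if $\Delta$ is invariant under the flip. A homomorphism of Hopf algebroids over $R$ is a homomorphism $\alpha$ of algebras with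 $\alpha|_R=\mathrm{id}$, $\epsilon\alpha=\epsilon$, $(\alpha\otimes\alpha)\Delta=\Delta\alpha$, $S\alpha=\alpha S$. **Statement.** Let $G$ be an étale Lie groupoid over $M$, i.e. a groupoid with object manifold $M$ whose arrows form a (not necessarily Hausdorff) smooth manifold $G$ and whose source $s$, target $t$, unit $\mathrm{uni}$, inverse $\mathrm{inv}$ and multiplication $\mathrm{mlt}:G\times_M^{st}G\to G$ are local diffeomorphisms. Then the vector space $C_c^\infty(G)$, with the convolution product $uv=\mathrm{mlt}_+(\Omega_{s,t}(u\otimes v))$, the inclusion $\mathrm{uni}_+:C_c^\infty(M)\to C_c^\infty(G)$, the comultiplication $\Delta=\Omega_{t,t}^{-1}\circ\mathrm{diag}_+$ (i.e. $\Delta u$ is the unique element of $C_c^\infty(G)\otimes^{ll}_{C_c^\infty(M)}C_c^\infty(G)$ mapped by $\Omega_{t,t}$ to $\mathrm{diag}_+(u)$, for the diagonal $\mathrm{diag}:G\to G\times_M^{tt}G$), the counit $\epsilon=t_+$ and the antipode $S=\mathrm{inv}_+$, is a cocommutative coassociative Hopf algebroid over $C_c^\infty(M)$. Moreover, $G\mapsto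 C_c^\infty(G)$, $\varphi\mapsto\varphi_+$ is a functor from the category of étale Lie groupoids over $M$ (with the smooth groupoid morphisms over $M$ that are the identity on $M$) to the category of Hopf algebroids over $C_c^\infty(M)$. -/

import Mathlib

open scoped Manifold ContDiff Topology TensorProduct
open Filter CategoryTheory

universe u v w z

set_option linter.unusedSectionVars false

noncomputable section

namespace GroupoidHopf

/-! ### Hopf algebroids over a commutative algebra without identity -/

section Algebra

variable (𝕜 : Type u) [Field 𝕜]
variable (R : Type v) [NonUnitalCommRing R] [Module 𝕜 R] [IsScalarTower 𝕜 R R]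
  [SMulCommClass 𝕜 R R]

/-- An associative `𝕜`-algebra structure (perhaps without identity) on the vector space `A`,
which has the commutative algebra `R` for a subalgebra (through the injective homomorphism
`incl`) and has local identities in `R`. -/
structure AlgebraOver (A : Type w) [AddCommGroup A] [Module 𝕜 A] where
  mul : A →ₗ[𝕜] A →ₗ[𝕜] A
  mul_assoc : ∀ a b c, mul (mul a b) c = mul a (mul b c)
  incl : R →ₗ[𝕜] A
  incl_mul : ∀ r s, incl (r * s) = mul (incl r) (incl s)
  incl_injective : Function.Injective incl
  local_identities : ∀ s : Finset A, ∃ r : R, ∀ a ∈ s,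
    mul a (incl r) = a ∧ mul (incl r) a = a

namespace AlgebraOver

variable {𝕜 R}
variable {A : Type w} [AddCommGroup A] [Module 𝕜 A] (X : AlgebraOver 𝕜 R A)

/-- The left action of `R` on `A`. -/
def lact : R →ₗ[𝕜] A →ₗ[𝕜] A := X.mul ∘ₗ X.incl

/-- The right action of `R` on `A`: `X.ract r a` is `a r`. -/
def ract : R →ₗ[𝕜] A →ₗ[𝕜] A := X.mul.flip ∘ₗ X.incl

theorem lact_apply (r : R) (a : A) : X.lact r a = X.mul (X.incl r) a := rfl

theorem ract_apply (r : R) (a : A) : X.ract r a = X.mul a (X.incl r) := rfl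

theorem lact_mul (r s : R) (a : A) : X.lact (r * s) a = X.lact r (X.lact s a) := by
  simp [lact_apply, X.incl_mul, X.mul_assoc]

theorem lact_comm (r s : R) (a : A) : X.lact r (X.lact s a) = X.lact s (X.lact r a) := by
  rw [← lact_mul, ← lact_mul, mul_comm]

theorem lact_ract (r s : R) (a : A) : X.lact r (X.ract s a) = X.ract s (X.lact r a) := by
  simp [lact_apply, ract_apply, X.mul_assoc]

/-- The subspace of `A ⊗ A` generated by the elements `ra ⊗ b - a ⊗ rb`. -/
def relLL : Submodule 𝕜 (A ⊗[𝕜] A) :=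
  Submodule.span 𝕜 {x | ∃ (r : R) (a b : A), x = X.lact r a ⊗ₜ[𝕜] b - a ⊗ₜ[𝕜] X.lact r b}

/-- The tensor product `A ⊗_R^{ll} A` with respect to the left actions on both factors. -/
abbrev LL := (A ⊗[𝕜] A) ⧸ X.relLL

/-- The quotient projection `A ⊗ A → A ⊗_R^{ll} A`. -/
def mkLL : A ⊗[𝕜] A →ₗ[𝕜] X.LL := X.relLL.mkQ

/-- The subspace of `A ⊗ A` generated by the elements `ar ⊗ b - a ⊗ rb`. -/
def relRL : Submodule 𝕜 (A ⊗[𝕜] A) :=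
  Submodule.span 𝕜 {x | ∃ (r : R) (a b : A), x = X.ract r a ⊗ₜ[𝕜] b - a ⊗ₜ[𝕜] X.lact r b}

/-- The tensor product `A ⊗_R^{rl} A` with respect to the right action on the first factor and
the left action on the second one. -/
abbrev RL := (A ⊗[𝕜] A) ⧸ X.relRL

/-- The quotient projection `A ⊗ A → A ⊗_R^{rl} A`. -/
def mkRL : A ⊗[𝕜] A →ₗ[𝕜] X.RL := X.relRL.mkQ

/-- The relations of the triple tensor product over `R` (left actions on all factors). -/
def relLLL : Submodule 𝕜 (A ⊗[𝕜] (A ⊗[𝕜] A)) :=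
  Submodule.span 𝕜 ({x | ∃ (r : R) (a b c : A),
      x = X.lact r a ⊗ₜ[𝕜] (b ⊗ₜ[𝕜] c) - a ⊗ₜ[𝕜] (X.lact r b ⊗ₜ[𝕜] c)} ∪
    {x | ∃ (r : R) (a b c : A),
      x = a ⊗ₜ[𝕜] (X.lact r b ⊗ₜ[𝕜] c) - a ⊗ₜ[𝕜] (b ⊗ₜ[𝕜] X.lact r c)})

/-- The triple tensor product of `A` over `R` with respect to the left actions. -/
abbrev LLL := (A ⊗[𝕜] (A ⊗[𝕜] A)) ⧸ X.relLLL

section lift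

variable {P : Type z} [AddCommGroup P] [Module 𝕜 P]

/-- The linear map on `A ⊗_R^{ll} A` induced by a balanced bilinear map. -/
def liftLL (f : A →ₗ[𝕜] A →ₗ[𝕜] P)
    (hf : ∀ r a b, f (X.lact r a) b = f a (X.lact r b)) : X.LL →ₗ[𝕜] P :=
  X.relLL.liftQ (TensorProduct.lift f) (by
    rw [relLL, Submodule.span_le]
    rintro _ ⟨r, a, b, rfl⟩
    simp [hf])

@[simp] theorem liftLL_mk (f : A →ₗ[𝕜] A →ₗ[𝕜] P)
    (hf : ∀ r a b, f (X.lact r a) b = f a (X.lact r b)) (a b : A) :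
    X.liftLL f hf (X.mkLL (a ⊗ₜ[𝕜] b)) = f a b := by
  simp [liftLL, mkLL]

/-- The linear map on `A ⊗_R^{rl} A` induced by a balanced bilinear map. -/
def liftRL (f : A →ₗ[𝕜] A →ₗ[𝕜] P)
    (hf : ∀ r a b, f (X.ract r a) b = f a (X.lact r b)) : X.RL →ₗ[𝕜] P :=
  X.relRL.liftQ (TensorProduct.lift f) (by
    rw [relRL, Submodule.span_le]
    rintro _ ⟨r, a, b, rfl⟩
    simp [hf])

variable {X}

theorem hom_ext_LL {f g : X.LL →ₗ[𝕜] P}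
    (h : ∀ a b, f (X.mkLL (a ⊗ₜ[𝕜] b)) = g (X.mkLL (a ⊗ₜ[𝕜] b))) : f = g := by
  apply Submodule.linearMap_qext
  apply TensorProduct.ext'
  exact h

end lift

theorem mkLL_lact (r : R) (a b : A) :
    X.mkLL (X.lact r a ⊗ₜ[𝕜] b) = X.mkLL (a ⊗ₜ[𝕜] X.lact r b) := by
  rw [← sub_eq_zero, ← map_sub, mkLL, Submodule.mkQ_apply, Submodule.Quotient.mk_eq_zero]
  exact Submodule.subset_span ⟨r, a, b, rfl⟩

theorem mkRL_lact (r : R) (a b : A) :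
    X.mkRL (X.ract r a ⊗ₜ[𝕜] b) = X.mkRL (a ⊗ₜ[𝕜] X.lact r b) := by
  rw [← sub_eq_zero, ← map_sub, mkRL, Submodule.mkQ_apply, Submodule.Quotient.mk_eq_zero]
  exact Submodule.subset_span ⟨r, a, b, rfl⟩

/-- `f ⊗ g` on `A ⊗_R^{ll} A`, for left `R`-linear maps `f` and `g`. -/
def mapLL {B : Type z} [AddCommGroup B] [Module 𝕜 B] (Y : AlgebraOver 𝕜 R B)
    (f g : A →ₗ[𝕜] B) (hf : ∀ r a, f (X.lact r a) = Y.lact r (f a))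
    (hg : ∀ r a, g (X.lact r a) = Y.lact r (g a)) : X.LL →ₗ[𝕜] Y.LL :=
  X.liftLL ((TensorProduct.mk 𝕜 B B).compl₁₂ f g |>.compr₂ Y.mkLL) (by
    intro r a b
    simp [hf, hg, Y.mkLL_lact])

@[simp] theorem mapLL_mk {B : Type z} [AddCommGroup B] [Module 𝕜 B] (Y : AlgebraOver 𝕜 R B)
    (f g : A →ₗ[𝕜] B) (hf : ∀ r a, f (X.lact r a) = Y.lact r (f a))
    (hg : ∀ r a, g (X.lact r a) = Y.lact r (g a)) (a b : A) :
    X.mapLL Y f g hf hg (X.mkLL (a ⊗ₜ[𝕜] b)) = Y.mkLL (f a ⊗ₜ[𝕜] g b) := by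
  simp [mapLL]

/-- The left action of `R` on `A ⊗_R^{ll} A`. -/
def lactLL (r : R) : X.LL →ₗ[𝕜] X.LL :=
  X.mapLL X (X.lact r) LinearMap.id (fun s a => X.lact_comm r s a) (fun _ _ => rfl)

/-- The first right action of `R` on `A ⊗_R^{ll} A`: `a ⊗ b ↦ ar ⊗ b`. -/
def ractFst (r : R) : X.LL →ₗ[𝕜] X.LL :=
  X.mapLL X (X.ract r) LinearMap.id (fun s a => (X.lact_ract s r a).symm) (fun _ _ => rfl)

/-- The second right action of `R` on `A ⊗_R^{ll} A`: `a ⊗ b ↦ a ⊗ br`. -/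
def ractSnd (r : R) : X.LL →ₗ[𝕜] X.LL :=
  X.mapLL X LinearMap.id (X.ract r) (fun _ _ => rfl) (fun s a => (X.lact_ract s r a).symm)

/-- The flip `a ⊗ b ↦ b ⊗ a` of `A ⊗_R^{ll} A`. -/
def flipLL : X.LL →ₗ[𝕜] X.LL :=
  X.liftLL ((TensorProduct.mk 𝕜 A A).flip.compr₂ X.mkLL) (by
    intro r a b
    simp [X.mkLL_lact])

/-- The componentwise product of `A ⊗ A`. -/
def mulTensor : A ⊗[𝕜] A →ₗ[𝕜] A ⊗[𝕜] A →ₗ[𝕜] A ⊗[𝕜] A :=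
  TensorProduct.map₂ X.mul X.mul

/-- The multiplication `μ : A ⊗_R^{rl} A → A`. -/
def mulRL : X.RL →ₗ[𝕜] A :=
  X.liftRL X.mul (by intro r a b; simp [lact_apply, ract_apply, X.mul_assoc])

/-- `S ⊗ id : A ⊗_R^{ll} A → A ⊗_R^{rl} A`, for a map `S` which turns the left action of `R` into
the right one. -/
def antipodeId (S : A →ₗ[𝕜] A) (hS : ∀ r a, S (X.lact r a) = X.ract r (S a)) :
    X.LL →ₗ[𝕜] X.RL :=
  X.liftLL ((TensorProduct.mk 𝕜 A A).compl₁₂ S LinearMap.id |>.compr₂ X.mkRL) (by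
    intro r a b
    simp [hS, X.mkRL_lact])

/-- `id ⊗ ε : A ⊗_R^{ll} A → A ⊗_R R = A`. -/
def idCounit (ε : A →ₗ[𝕜] R) (hε : ∀ r a, ε (X.lact r a) = r * ε a) : X.LL →ₗ[𝕜] A :=
  X.liftLL (X.lact ∘ₗ ε).flip (by
    intro r a b
    simp [hε, mul_comm r, X.lact_mul])

/-- `ε ⊗ id : A ⊗_R^{ll} A → R ⊗_R A = A`. -/
def counitId (ε : A →ₗ[𝕜] R) (hε : ∀ r a, ε (X.lact r a) = r * ε a) : X.LL →ₗ[𝕜] A :=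
  X.liftLL (X.lact ∘ₗ ε) (by
    intro r a b
    simp [hε, mul_comm r, X.lact_mul])

/-- The trilinear map `(a, b, c) ↦ a ⊗ b ⊗ c`. -/
def mk₃ : A →ₗ[𝕜] A →ₗ[𝕜] A →ₗ[𝕜] X.LLL where
  toFun a := (TensorProduct.mk 𝕜 A A).compr₂ (TensorProduct.curry X.relLLL.mkQ a)
  map_add' a b := by ext; simp only [map_add]; rfl
  map_smul' c a := by ext; simp only [map_smul]; rfl

theorem mk₃_apply (a b c : A) :
    X.mk₃ a b c = X.relLLL.mkQ (a ⊗ₜ[𝕜] (b ⊗ₜ[𝕜] c)) := rfl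

theorem mk₃_left (r : R) (a b c : A) : X.mk₃ (X.lact r a) b c = X.mk₃ a (X.lact r b) c := by
  rw [← sub_eq_zero, mk₃_apply, mk₃_apply, ← map_sub, Submodule.mkQ_apply,
    Submodule.Quotient.mk_eq_zero]
  exact Submodule.subset_span (Or.inl ⟨r, a, b, c, rfl⟩)

theorem mk₃_right (r : R) (a b c : A) : X.mk₃ a (X.lact r b) c = X.mk₃ a b (X.lact r c) := by
  rw [← sub_eq_zero, mk₃_apply, mk₃_apply, ← map_sub, Submodule.mkQ_apply,
    Submodule.Quotient.mk_eq_zero]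
  exact Submodule.subset_span (Or.inr ⟨r, a, b, c, rfl⟩)

/-- `(x, c) ↦ x ⊗ c` for `x` in `A ⊗_R^{ll} A` and `c` in `A`. -/
def tmulRight : X.LL →ₗ[𝕜] A →ₗ[𝕜] X.LLL :=
  X.liftLL X.mk₃ (by intro r a b; ext c; exact X.mk₃_left r a b c)

/-- `(a, x) ↦ a ⊗ x` for `a` in `A` and `x` in `A ⊗_R^{ll} A`. -/
def tmulLeft : A →ₗ[𝕜] X.LL →ₗ[𝕜] X.LLL where
  toFun a := X.liftLL (X.mk₃ a) (X.mk₃_right · a)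
  map_add' a b := hom_ext_LL (by intros; simp)
  map_smul' c a := hom_ext_LL (by intros; simp)

theorem tmulRight_lact (r : R) (x : X.LL) (c : A) :
    X.tmulRight (X.lactLL r x) c = X.tmulRight x (X.lact r c) := by
  have h : (X.tmulRight.flip c) ∘ₗ X.lactLL r = X.tmulRight.flip (X.lact r c) := by
    apply hom_ext_LL
    intro a b
    simp [tmulRight, lactLL, mk₃_left, mk₃_right]
  exact LinearMap.congr_fun h x

theorem tmulLeft_lact (r : R) (a : A) (x : X.LL) :
    X.tmulLeft (X.lact r a) x = X.tmulLeft a (X.lactLL r x) := by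
  have h : X.tmulLeft (X.lact r a) = X.tmulLeft a ∘ₗ X.lactLL r := by
    apply hom_ext_LL
    intro b c
    simp [tmulLeft, lactLL, mk₃_left]
  exact LinearMap.congr_fun h x

/-- `Δ ⊗ id : A ⊗_R A → A ⊗_R A ⊗_R A`. -/
def comulId (Δ : A →ₗ[𝕜] X.LL) (hΔ : ∀ r a, Δ (X.lact r a) = X.lactLL r (Δ a)) :
    X.LL →ₗ[𝕜] X.LLL :=
  X.liftLL (X.tmulRight ∘ₗ Δ) (by
    intro r a b
    simp [hΔ, X.tmulRight_lact])

/-- `id ⊗ Δ : A ⊗_R A → A ⊗_R A ⊗_R A`. -/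
def idComul (Δ : A →ₗ[𝕜] X.LL) (hΔ : ∀ r a, Δ (X.lact r a) = X.lactLL r (Δ a)) :
    X.LL →ₗ[𝕜] X.LLL :=
  X.liftLL (X.tmulLeft.compl₂ Δ) (by
    intro r a b
    simp [hΔ, X.tmulLeft_lact])

end AlgebraOver

/-- A Hopf algebroid over `R` with underlying vector space `A`. -/
structure HopfAlgebroidStr (A : Type w) [AddCommGroup A] [Module 𝕜 A]
    extends AlgebraOver 𝕜 R A where
  comul : A →ₗ[𝕜] toAlgebraOver.LL
  counit : A →ₗ[𝕜] R
  antipode : A →ₗ[𝕜] A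
  comul_lact : ∀ r a, comul (toAlgebraOver.lact r a) = toAlgebraOver.lactLL r (comul a)
  counit_lact : ∀ r a, counit (toAlgebraOver.lact r a) = r * counit a
  id_counit : ∀ a, toAlgebraOver.idCounit counit counit_lact (comul a) = a
  counit_id : ∀ a, toAlgebraOver.counitId counit counit_lact (comul a) = a
  counit_incl : ∀ r, counit (incl r) = r
  /-- `Δ|_R` is the canonical embedding of `R ≅ R ⊗_R R` (where `r s` corresponds to `r ⊗ s`). -/
  comul_incl : ∀ r s, comul (incl (r * s)) = toAlgebraOver.mkLL (incl r ⊗ₜ[𝕜] incl s)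
  ract_comul : ∀ r a,
    toAlgebraOver.ractFst r (comul a) = toAlgebraOver.ractSnd r (comul a)
  /-- `Δ(ab) = Δ(a)Δ(b)`: the product on the right is computed on arbitrary representatives
  in `A ⊗ A`. -/
  comul_mul : ∀ (a b : A) (x y : A ⊗[𝕜] A),
    toAlgebraOver.mkLL x = comul a → toAlgebraOver.mkLL y = comul b →
      comul (mul a b) = toAlgebraOver.mkLL (toAlgebraOver.mulTensor x y)
  antipode_incl : ∀ r, antipode (incl r) = incl r
  antipode_antipode : ∀ a, antipode (antipode a) = a
  antipode_mul : ∀ a b, antipode (mul a b) = mul (antipode b) (antipode a)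
  mul_antipode_id : ∀ a,
    toAlgebraOver.mulRL (toAlgebraOver.antipodeId antipode
      (fun r a => by
        rw [AlgebraOver.lact_apply, antipode_mul, antipode_incl, AlgebraOver.ract_apply])
      (comul a)) = incl (counit (antipode a))

namespace HopfAlgebroidStr

variable {𝕜 R}
variable {A : Type w} [AddCommGroup A] [Module 𝕜 A] (X : HopfAlgebroidStr 𝕜 R A)

/-- `(Δ ⊗ id) ∘ Δ = (id ⊗ Δ) ∘ Δ`. -/
def IsCoassociative : Prop :=
  ∀ a, X.comulId X.comul X.comul_lact (X.comul a) = X.idComul X.comul X.comul_lact (X.comul a)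

/-- `σ ∘ Δ = Δ` for the flip `σ`. -/
def IsCocommutative : Prop :=
  ∀ a, X.flipLL (X.comul a) = X.comul a

end HopfAlgebroidStr

/-- The objects of the category of Hopf algebroids over `R`. -/
structure HoAlgd where
  carrier : Type w
  [addCommGroup : AddCommGroup carrier]
  [module : Module 𝕜 carrier]
  str : HopfAlgebroidStr 𝕜 R carrier

attribute [instance] HoAlgd.addCommGroup HoAlgd.module

namespace HoAlgd

variable {𝕜 R}

/-- Homomorphisms of Hopf algebroids over `R`. -/
@[ext]
structure Hom (A B : HoAlgd.{u, v, w} 𝕜 R) where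
  toLin : A.carrier →ₗ[𝕜] B.carrier
  map_mul : ∀ a b, toLin (A.str.mul a b) = B.str.mul (toLin a) (toLin b)
  map_incl : ∀ r, toLin (A.str.incl r) = B.str.incl r
  map_counit : ∀ a, B.str.counit (toLin a) = A.str.counit a
  map_comul : ∀ a,
    A.str.mapLL B.str.toAlgebraOver toLin toLin
      (fun r a => by rw [AlgebraOver.lact_apply, map_mul, map_incl, AlgebraOver.lact_apply])
      (fun r a => by rw [AlgebraOver.lact_apply, map_mul, map_incl, AlgebraOver.lact_apply])
      (A.str.comul a) = B.str.comul (toLin a)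
  map_antipode : ∀ a, B.str.antipode (toLin a) = toLin (A.str.antipode a)

/-- The identity homomorphism. -/
def Hom.id (A : HoAlgd.{u, v, w} 𝕜 R) : Hom A A where
  toLin := LinearMap.id
  map_mul _ _ := rfl
  map_incl _ := rfl
  map_counit _ := rfl
  map_comul a := by
    have h : A.str.mapLL A.str.toAlgebraOver LinearMap.id LinearMap.id
        (fun _ _ => rfl) (fun _ _ => rfl) = (LinearMap.id : A.str.LL →ₗ[𝕜] A.str.LL) :=
      AlgebraOver.hom_ext_LL (fun a b => by rw [AlgebraOver.mapLL_mk]; rfl)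
    exact LinearMap.congr_fun h _
  map_antipode _ := rfl

/-- The composition of homomorphisms. -/
def Hom.comp {A B C : HoAlgd.{u, v, w} 𝕜 R} (f : Hom A B) (g : Hom B C) : Hom A C where
  toLin := g.toLin ∘ₗ f.toLin
  map_mul a b := by simp [f.map_mul, g.map_mul]
  map_incl r := by simp [f.map_incl, g.map_incl]
  map_counit a := by simp [f.map_counit, g.map_counit]
  map_comul a := by
    have hA : ∀ r a, f.toLin (A.str.lact r a) = B.str.lact r (f.toLin a) := fun r a => by
      rw [AlgebraOver.lact_apply, f.map_mul, f.map_incl, AlgebraOver.lact_apply]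
    have hB : ∀ r a, g.toLin (B.str.lact r a) = C.str.lact r (g.toLin a) := fun r a => by
      rw [AlgebraOver.lact_apply, g.map_mul, g.map_incl, AlgebraOver.lact_apply]
    have hC : ∀ r a, (g.toLin ∘ₗ f.toLin) (A.str.lact r a) =
        C.str.lact r ((g.toLin ∘ₗ f.toLin) a) := fun r a => by
      rw [LinearMap.comp_apply, hA, hB, LinearMap.comp_apply]
    have h : A.str.mapLL C.str.toAlgebraOver (g.toLin ∘ₗ f.toLin) (g.toLin ∘ₗ f.toLin) hC hC =
        B.str.mapLL C.str.toAlgebraOver g.toLin g.toLin hB hB ∘ₗ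
          A.str.mapLL B.str.toAlgebraOver f.toLin f.toLin hA hA :=
      AlgebraOver.hom_ext_LL (fun a b => by simp)
    rw [LinearMap.comp_apply, ← g.map_comul, ← f.map_comul]
    exact LinearMap.congr_fun h _
  map_antipode a := by simp [f.map_antipode, g.map_antipode]

instance : Category (HoAlgd.{u, v, w} 𝕜 R) where
  Hom := Hom
  id := Hom.id
  comp := Hom.comp

end HoAlgd

end Algebra

/-! ### Smooth functions with compact support on non-Hausdorff manifolds -/

section Sections

variable (𝕜 : Type u) [RCLike 𝕜]

/-- Not necessarily continuous sections of the sheaf of germs of `𝕜`-valued functions on `X`. -/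
abbrev GermSection (X : Type v) [TopologicalSpace X] := (x : X) → Germ (𝓝 x) 𝕜

instance {α : Type v} (l : Filter α) : IsScalarTower 𝕜 (Germ l 𝕜) (Germ l 𝕜) where
  smul_assoc c f g := by
    induction f using Germ.inductionOn with | _ f
    induction g using Germ.inductionOn with | _ g
    simp only [smul_eq_mul]
    rw [← Germ.coe_smul, ← Germ.coe_mul, ← Germ.coe_mul, ← Germ.coe_smul, smul_mul_assoc]

instance {α : Type v} (l : Filter α) : SMulCommClass 𝕜 (Germ l 𝕜) (Germ l 𝕜) where
  smul_comm c f g := by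
    induction f using Germ.inductionOn with | _ f
    induction g using Germ.inductionOn with | _ g
    simp only [smul_eq_mul]
    rw [← Germ.coe_smul, ← Germ.coe_mul, ← Germ.coe_mul, ← Germ.coe_smul, mul_smul_comm]

variable {𝕜}

open scoped Classical in
/-- The extension by zero, as a section of germs, of a function `f` defined on `U`: its value is
the germ of `f` at the points of `U`, and the zero germ elsewhere. -/
def zeroExt {X : Type v} [TopologicalSpace X] (U : Set X) (f : X → 𝕜) : GermSection 𝕜 X :=
  fun x => if x ∈ U then (f : Germ (𝓝 x) 𝕜) else 0

/-- The restriction of `f` to `U` is a smooth function with compact support in `U`. -/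
def SmoothCompactlySupportedOn (E : Type w) [NormedAddCommGroup E] [NormedSpace ℝ E]
    {X : Type v} [TopologicalSpace X] [ChartedSpace E X] (U : Set X) (f : X → 𝕜) : Prop :=
  ContMDiffOn 𝓘(ℝ, E) 𝓘(ℝ, 𝕜) ∞ f U ∧ ∃ K ⊆ U, IsCompact K ∧ ∀ x ∈ U, x ∉ K → f x = 0

variable (𝕜)

/-- The space `C_c^∞(X)` of smooth functions with compact support on a (not necessarily
Hausdorff) manifold `X` modelled on `E`: the sums of extensions by zero of smooth functions with
compact support in Hausdorff open subsets of `X`. -/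
def Cc (E : Type w) [NormedAddCommGroup E] [NormedSpace ℝ E]
    (X : Type v) [TopologicalSpace X] [ChartedSpace E X] : Submodule 𝕜 (GermSection 𝕜 X) :=
  Submodule.span 𝕜 {u | ∃ (U : Set X) (f : X → 𝕜), IsOpen U ∧ T2Space U ∧
    SmoothCompactlySupportedOn E U f ∧ u = zeroExt U f}

theorem Cc_mul_mem {E : Type w} [NormedAddCommGroup E] [NormedSpace ℝ E]
    {X : Type v} [TopologicalSpace X] [ChartedSpace E X] [T2Space X] {a b : GermSection 𝕜 X}
    (ha : a ∈ Cc 𝕜 E X) (hb : b ∈ Cc 𝕜 E X) : a * b ∈ Cc 𝕜 E X := by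
  induction ha using Submodule.span_induction with
  | zero => rw [zero_mul]; exact zero_mem _
  | add x y _ _ hx hy => rw [add_mul]; exact add_mem hx hy
  | smul c x _ hx =>
    rw [smul_mul_assoc]
    exact Submodule.smul_mem _ _ hx
  | mem x hx =>
    obtain ⟨U, f, hU, hU2, ⟨hf, K, hKU, hK, hfK⟩, rfl⟩ := hx
    induction hb using Submodule.span_induction with
    | zero => rw [mul_zero]; exact zero_mem _
    | add x y _ _ hx hy => rw [mul_add]; exact add_mem hx hy
    | smul c x _ hx =>
      rw [mul_smul_comm]
      exact Submodule.smul_mem _ _ hx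
    | mem y hy =>
      obtain ⟨V, g, hV, hV2, ⟨hg, L, hLV, hL, hgL⟩, rfl⟩ := hy
      refine Submodule.subset_span ⟨U ∩ V, f * g, hU.inter hV, inferInstance, ⟨?_, K ∩ L,
        Set.inter_subset_inter hKU hLV, hK.inter hL, ?_⟩, ?_⟩
      · have h1 := hf.mono (Set.inter_subset_left (t := V))
        have h2 := hg.mono (Set.inter_subset_right (s := U))
        intro x hx
        exact (contDiff_mul (𝕜 := ℝ) (𝔸 := 𝕜)).contDiffAt.contMDiffAt.comp_contMDiffWithinAt x
          ((h1 x hx).prodMk_space (h2 x hx))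
      · intro x hx hxK
        by_cases h : x ∈ K
        · simp [hgL x hx.2 fun h' => hxK ⟨h, h'⟩]
        · simp [hfK x hx.1 h]
      · funext x
        by_cases h : x ∈ U <;> by_cases h' : x ∈ V <;> simp [zeroExt, h, h']

/-- For a Hausdorff manifold, `C_c^∞(X)` is a commutative algebra under pointwise
multiplication. -/
def CcAlg (E : Type w) [NormedAddCommGroup E] [NormedSpace ℝ E]
    (X : Type v) [TopologicalSpace X] [T2Space X] [ChartedSpace E X] :
    NonUnitalSubalgebra 𝕜 (GermSection 𝕜 X) :=
  { Cc 𝕜 E X with mul_mem' := Cc_mul_mem 𝕜 }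

variable {X : Type v} [TopologicalSpace X] {Y : Type w} [TopologicalSpace Y]
  {Z : Type z} [TopologicalSpace Z]

/-- The homomorphism `φ_x^*` of germs induced by composition with `φ`, for `φ x = y`. -/
def germPullback (φ : X → Y) {x : X} {y : Y} (h : Tendsto φ (𝓝 x) (𝓝 y)) :
    Germ (𝓝 y) 𝕜 →ₗ[𝕜] Germ (𝓝 x) 𝕜 where
  toFun g := g.compTendsto φ h
  map_add' f g := by
    induction f using Germ.inductionOn
    induction g using Germ.inductionOn
    rfl
  map_smul' c f := by
    induction f using Germ.inductionOn
    rfl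

variable {𝕜}

theorem tendsto_of_isLocalHomeomorph {φ : X → Y} (hφ : IsLocalHomeomorph φ) {x : X} {y : Y}
    (h : φ x = y) : Tendsto φ (𝓝 x) (𝓝 y) :=
  h ▸ hφ.continuous.continuousAt

variable (𝕜) in
theorem germPullback_bijective {φ : X → Y} (hφ : IsLocalHomeomorph φ) {x : X} {y : Y}
    (h : φ x = y) :
    Function.Bijective (germPullback 𝕜 φ (tendsto_of_isLocalHomeomorph hφ h)) := by
  subst h
  constructor
  · intro f g hfg
    induction f using Germ.inductionOn with | _ f
    induction g using Germ.inductionOn with | _ g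
    have : ((f ∘ φ : X → 𝕜) : Germ (𝓝 x) 𝕜) = ((g ∘ φ : X → 𝕜) : Germ (𝓝 x) 𝕜) := hfg
    rw [Germ.coe_eq] at this ⊢
    rw [← hφ.map_nhds_eq x]
    exact this
  · intro g
    induction g using Germ.inductionOn with | _ g
    obtain ⟨e, hx, rfl⟩ := hφ x
    refine ⟨((g ∘ e.symm : Y → 𝕜) : Germ (𝓝 (e x)) 𝕜), ?_⟩
    change ((g ∘ e.symm ∘ e : X → 𝕜) : Germ (𝓝 x) 𝕜) = _
    rw [Germ.coe_eq]
    filter_upwards [e.open_source.mem_nhds hx] with y hy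
    simp [e.left_inv hy]

variable (𝕜) in
/-- The isomorphism `φ_{*x}` of germs inverse to `φ_x^*`, for a local homeomorphism `φ` with
`φ x = y`. -/
def germPushforward {φ : X → Y} (hφ : IsLocalHomeomorph φ) {x : X} {y : Y} (h : φ x = y) :
    Germ (𝓝 x) 𝕜 ≃ₗ[𝕜] Germ (𝓝 y) 𝕜 :=
  (LinearEquiv.ofBijective _ (germPullback_bijective 𝕜 hφ h)).symm

/-- The push-forward `φ_+` along a local homeomorphism: the value at `y` is the sum of the germs
`φ_{*x}(u_x)` over all `x` in the fibre of `y`. -/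
def pushforward {φ : X → Y} (hφ : IsLocalHomeomorph φ) (u : GermSection 𝕜 X) :
    GermSection 𝕜 Y :=
  fun y => ∑ᶠ x : {x : X // φ x = y}, germPushforward 𝕜 hφ x.2 (u x.1)

theorem tendsto_pullback_fst {π : X → Z} {ξ : Y → Z} (p : π.Pullback ξ) :
    Tendsto (fun q : π.Pullback ξ => q.1.1) (𝓝 p) (𝓝 p.1.1) :=
  (continuous_fst.comp continuous_subtype_val).tendsto p

theorem tendsto_pullback_snd {π : X → Z} {ξ : Y → Z} (p : π.Pullback ξ) :
    Tendsto (fun q : π.Pullback ξ => q.1.2) (𝓝 p) (𝓝 p.1.2) :=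
  (continuous_snd.comp continuous_subtype_val).tendsto p

variable (𝕜) in
/-- The bilinear map `Ω_{π,ξ}` which sends `(u, v)` to the section of germs on the fibred product
with the value `pr₁^*(u_x) pr₂^*(v_y)` at `(x, y)`. -/
def extProd (π : X → Z) (ξ : Y → Z) :
    GermSection 𝕜 X →ₗ[𝕜] GermSection 𝕜 Y →ₗ[𝕜] GermSection 𝕜 (π.Pullback ξ) :=
  LinearMap.mk₂ 𝕜
    (fun u v p => germPullback 𝕜 _ (tendsto_pullback_fst p) (u p.1.1) *
      germPullback 𝕜 _ (tendsto_pullback_snd p) (v p.1.2))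
    (by intros; funext p; simp [add_mul])
    (by
      intro c u v
      funext p
      simp only [Pi.smul_apply, map_smul]
      exact smul_mul_assoc c _ _)
    (by intros; funext p; simp [mul_add])
    (by
      intro c u v
      funext p
      simp only [Pi.smul_apply, map_smul]
      exact mul_smul_comm c _ _)

variable (𝕜) in
/-- The linear map `Ω_{π,ξ}` on the tensor product over the base field. -/
def extProdTensor (E : Type*) [NormedAddCommGroup E] [NormedSpace ℝ E] [ChartedSpace E X]
    [ChartedSpace E Y] (π : X → Z) (ξ : Y → Z) :
    Cc 𝕜 E X ⊗[𝕜] Cc 𝕜 E Y →ₗ[𝕜] GermSection 𝕜 (π.Pullback ξ) :=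
  TensorProduct.lift ((extProd 𝕜 π ξ).domRestrict₁₂ (Cc 𝕜 E X) (Cc 𝕜 E Y))

/-- The projection of a fibred product along a local homeomorphism is a local homeomorphism. -/
theorem isLocalHomeomorph_pullback_fst {π : X → Z} {ξ : Y → Z} (hπ : Continuous π)
    (hξ : IsLocalHomeomorph ξ) :
    IsLocalHomeomorph (fun q : π.Pullback ξ => q.1.1) := by
  classical
  refine IsLocalHomeomorph.mk _ fun p => ?_
  obtain ⟨e, he, rfl⟩ := hξ p.1.2
  have hc2 : Continuous (fun q : π.Pullback e => q.1.2) :=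
    continuous_snd.comp continuous_subtype_val
  refine ⟨{ toFun := fun q => q.1.1
            invFun := fun x => if h : π x = e (e.symm (π x)) then ⟨(x, e.symm (π x)), h⟩ else p
            source := {q | q.1.2 ∈ e.source}
            target := {x | π x ∈ e.target}
            map_source' := ?_
            map_target' := ?_
            left_inv' := ?_
            right_inv' := ?_
            open_source := e.open_source.preimage hc2
            open_target := e.open_target.preimage hπ
            continuousOn_toFun := (continuous_fst.comp continuous_subtype_val).continuousOn
            continuousOn_invFun := ?_ }, he, fun _ _ => rfl⟩
  · intro q hq
    change π q.1.1 ∈ e.target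
    rw [q.2]
    exact e.map_source hq
  · intro x hx
    have h : π x = e (e.symm (π x)) := (e.right_inv hx).symm
    rw [dif_pos h]
    exact e.map_target hx
  · intro q hq
    have h : e.symm (π q.1.1) = q.1.2 := by rw [q.2]; exact e.left_inv hq
    have h' : π q.1.1 = e (e.symm (π q.1.1)) := by rw [h]; exact q.2
    rw [dif_pos h']
    exact Subtype.ext (Prod.ext rfl h)
  · intro x hx
    have h : π x = e (e.symm (π x)) := (e.right_inv hx).symm
    rw [dif_pos h]
  · refine (Topology.IsInducing.continuousOn_iff (Topology.IsInducing.subtypeVal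
      (t := {q : X × Y | π q.1 = e q.2}))).2 ?_
    have : ContinuousOn (fun x => (x, e.symm (π x))) {x | π x ∈ e.target} :=
      continuousOn_id.prodMk (e.continuousOn_symm.comp hπ.continuousOn fun x hx => hx)
    refine this.congr fun x hx => ?_
    have h : π x = e (e.symm (π x)) := (e.right_inv hx).symm
    simp only [Function.comp_apply]
    rw [dif_pos h]

/-- The diagonal `Y → Y ×_Z Y` of a local homeomorphism is a local homeomorphism. -/
theorem isLocalHomeomorph_diag {ξ : Y → Z} (hξ : IsLocalHomeomorph ξ) :
    IsLocalHomeomorph (fun y => (⟨(y, y), rfl⟩ : ξ.Pullback ξ)) :=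
  IsLocalHomeomorph.of_comp (g := fun q : ξ.Pullback ξ => q.1.1)
    (Homeomorph.refl Y).isLocalHomeomorph
    (isLocalHomeomorph_pullback_fst hξ.continuous hξ)
    ((continuous_id.prodMk continuous_id).subtype_mk _)

/-- The charts on `X` obtained from those on `Y` by composition with local inverses of a local
homeomorphism `X → Y`. -/
@[reducible] def chartedSpaceOfLocalHomeomorph (E : Type*) [TopologicalSpace E]
    [ChartedSpace E Y] {φ : X → Y} (hφ : IsLocalHomeomorph φ) : ChartedSpace E X where
  atlas := Set.range fun x => (hφ x).choose.trans (chartAt E (φ x))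
  chartAt x := (hφ x).choose.trans (chartAt E (φ x))
  mem_chart_source x := by
    have h := (hφ x).choose_spec
    rw [OpenPartialHomeomorph.trans_source]
    refine ⟨h.1, ?_⟩
    rw [Set.mem_preimage, ← congrFun h.2 x]
    exact mem_chart_source E (φ x)
  chart_mem_atlas x := ⟨x, rfl⟩

/-- A map `m` from the fibred product of `π` and the sheaf `ξ` is a local diffeomorphism, for the
smooth structure on the fibred product which makes the first projection a local
diffeomorphism. -/
def IsLocalDiffeomorphOnPullback (E : Type*) [NormedAddCommGroup E] [NormedSpace ℝ E]
    [ChartedSpace E X] {W : Type*} [TopologicalSpace W] [ChartedSpace E W]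
    {π : X → Z} {ξ : Y → Z} (hπ : Continuous π) (hξ : IsLocalHomeomorph ξ)
    (m : π.Pullback ξ → W) : Prop :=
  letI : ChartedSpace E (π.Pullback ξ) :=
    chartedSpaceOfLocalHomeomorph E (isLocalHomeomorph_pullback_fst hπ hξ)
  IsLocalDiffeomorph 𝓘(ℝ, E) 𝓘(ℝ, E) ∞ m

end Sections

/-! ### Étale Lie groupoids -/

/-- An étale Lie groupoid over the manifold `M`; the manifold of arrows need not be Hausdorff. -/
structure EtGrpd (E : Type v) [NormedAddCommGroup E] [NormedSpace ℝ E]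
    (M : Type w) [TopologicalSpace M] [ChartedSpace E M] where
  Arrow : Type u
  [topologicalSpace : TopologicalSpace Arrow]
  [chartedSpace : ChartedSpace E Arrow]
  [isManifold : IsManifold 𝓘(ℝ, E) ∞ Arrow]
  src : Arrow → M
  tgt : Arrow → M
  unit : M → Arrow
  inv : Arrow → Arrow
  mul : src.Pullback tgt → Arrow
  src_isLocalDiffeomorph : IsLocalDiffeomorph 𝓘(ℝ, E) 𝓘(ℝ, E) ∞ src
  tgt_isLocalDiffeomorph : IsLocalDiffeomorph 𝓘(ℝ, E) 𝓘(ℝ, E) ∞ tgt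
  unit_isLocalDiffeomorph : IsLocalDiffeomorph 𝓘(ℝ, E) 𝓘(ℝ, E) ∞ unit
  inv_isLocalDiffeomorph : IsLocalDiffeomorph 𝓘(ℝ, E) 𝓘(ℝ, E) ∞ inv
  mul_isLocalDiffeomorph : IsLocalDiffeomorphOnPullback E
    src_isLocalDiffeomorph.isLocalHomeomorph.continuous
    tgt_isLocalDiffeomorph.isLocalHomeomorph mul
  src_unit : ∀ x, src (unit x) = x
  tgt_unit : ∀ x, tgt (unit x) = x
  src_inv : ∀ g, src (inv g) = tgt g
  tgt_inv : ∀ g, tgt (inv g) = src g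
  src_mul : ∀ p, src (mul p) = src p.1.2
  tgt_mul : ∀ p, tgt (mul p) = tgt p.1.1
  unit_mul : ∀ g, mul ⟨(unit (tgt g), g), src_unit _⟩ = g
  mul_unit : ∀ g, mul ⟨(g, unit (src g)), (tgt_unit _).symm⟩ = g
  inv_mul : ∀ g, mul ⟨(inv g, g), src_inv g⟩ = unit (src g)
  mul_inv : ∀ g, mul ⟨(g, inv g), (tgt_inv g).symm⟩ = unit (tgt g)
  mul_assoc : ∀ (g h k : Arrow) (hgh : src g = tgt h) (hhk : src h = tgt k),
    mul ⟨(mul ⟨(g, h), hgh⟩, k), (src_mul _).trans hhk⟩ =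
      mul ⟨(g, mul ⟨(h, k), hhk⟩), hgh.trans (tgt_mul ⟨(h, k), hhk⟩).symm⟩

namespace EtGrpd

attribute [instance] EtGrpd.topologicalSpace EtGrpd.chartedSpace EtGrpd.isManifold

variable {E : Type v} [NormedAddCommGroup E] [NormedSpace ℝ E]
  {M : Type w} [TopologicalSpace M] [ChartedSpace E M]

section structureMaps

variable (G : EtGrpd.{u} E M)

theorem src_isLocalHomeomorph : IsLocalHomeomorph G.src :=
  G.src_isLocalDiffeomorph.isLocalHomeomorph

theorem tgt_isLocalHomeomorph : IsLocalHomeomorph G.tgt :=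
  G.tgt_isLocalDiffeomorph.isLocalHomeomorph

theorem unit_isLocalHomeomorph : IsLocalHomeomorph G.unit :=
  G.unit_isLocalDiffeomorph.isLocalHomeomorph

theorem inv_isLocalHomeomorph : IsLocalHomeomorph G.inv :=
  G.inv_isLocalDiffeomorph.isLocalHomeomorph

theorem mul_isLocalHomeomorph : IsLocalHomeomorph G.mul :=
  letI : ChartedSpace E (G.src.Pullback G.tgt) :=
    chartedSpaceOfLocalHomeomorph E (isLocalHomeomorph_pullback_fst
      G.src_isLocalHomeomorph.continuous G.tgt_isLocalHomeomorph)
  IsLocalDiffeomorph.isLocalHomeomorph G.mul_isLocalDiffeomorph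

end structureMaps

/-- Morphisms of étale Lie groupoids over `M`. -/
@[ext]
structure Hom (G H : EtGrpd.{u} E M) where
  toFun : G.Arrow → H.Arrow
  contMDiff : ContMDiff 𝓘(ℝ, E) 𝓘(ℝ, E) ∞ toFun
  map_unit : ∀ x, toFun (G.unit x) = H.unit x
  src_map : ∀ g, H.src (toFun g) = G.src g
  tgt_map : ∀ g, H.tgt (toFun g) = G.tgt g
  map_mul : ∀ p : G.src.Pullback G.tgt, toFun (G.mul p) =
    H.mul ⟨(toFun p.1.1, toFun p.1.2), by
      rw [src_map, tgt_map]
      exact p.2⟩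

instance : Category (EtGrpd.{u} E M) where
  Hom := Hom
  id G :=
    { toFun := id
      contMDiff := contMDiff_id
      map_unit := fun _ => rfl
      src_map := fun _ => rfl
      tgt_map := fun _ => rfl
      map_mul := fun _ => rfl }
  comp f g :=
    { toFun := g.toFun ∘ f.toFun
      contMDiff := g.contMDiff.comp f.contMDiff
      map_unit := fun x => by simp [f.map_unit, g.map_unit]
      src_map := fun x => by simp [f.src_map, g.src_map]
      tgt_map := fun x => by simp [f.tgt_map, g.tgt_map]
      map_mul := fun p => by simp [f.map_mul, g.map_mul] }

theorem Hom.isLocalHomeomorph {G H : EtGrpd.{u} E M} (φ : G ⟶ H) :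
    IsLocalHomeomorph (Hom.toFun φ) :=
  IsLocalHomeomorph.of_comp (g := H.tgt)
    (by
      have : H.tgt ∘ Hom.toFun φ = G.tgt := funext (Hom.tgt_map φ)
      rw [this]
      exact G.tgt_isLocalHomeomorph)
    H.tgt_isLocalHomeomorph (Hom.contMDiff φ).continuous

end EtGrpd

/-- The structure maps of the Hopf algebroid structure `X` on `C_c^∞(G)` over `C_c^∞(M)` are the
canonical ones. -/
structure IsGroupoidHopfAlgebroid {𝕜 : Type z} [RCLike 𝕜]
    {E : Type v} [NormedAddCommGroup E] [NormedSpace ℝ E]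
    {M : Type w} [TopologicalSpace M] [T2Space M] [ChartedSpace E M] (G : EtGrpd.{u} E M)
    (X : HopfAlgebroidStr 𝕜 (CcAlg 𝕜 E M) (Cc 𝕜 E G.Arrow)) : Prop where
  /-- The convolution product `mlt_+ ∘ Ω_{s,t}`. -/
  mul_eq : ∀ u v, (X.mul u v : GermSection 𝕜 G.Arrow) =
    pushforward G.mul_isLocalHomeomorph (extProd 𝕜 G.src G.tgt u v)
  /-- `C_c^∞(M)` is embedded in `C_c^∞(G)` through the unit map. -/
  incl_eq : ∀ p, (X.incl p : GermSection 𝕜 G.Arrow) =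
    pushforward G.unit_isLocalHomeomorph (p : GermSection 𝕜 M)
  /-- The comultiplication `Ω_{t,t}⁻¹ ∘ diag_+` of the target sheaf: `Δ u` is the unique element
  of `C_c^∞(G) ⊗_{C_c^∞(M)}^{ll} C_c^∞(G)` which `Ω_{t,t}` maps to `diag_+ u`. -/
  comul_eq : ∀ u x, X.comul u = X.mkLL x ↔
    extProdTensor 𝕜 E G.tgt G.tgt x =
      pushforward (isLocalHomeomorph_diag G.tgt_isLocalHomeomorph) (u : GermSection 𝕜 G.Arrow)
  /-- The counit `t_+`. -/
  counit_eq : ∀ u, (X.counit u : GermSection 𝕜 M) =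
    pushforward G.tgt_isLocalHomeomorph (u : GermSection 𝕜 G.Arrow)
  /-- The antipode `inv_+`. -/
  antipode_eq : ∀ u, (X.antipode u : GermSection 𝕜 G.Arrow) =
    pushforward G.inv_isLocalHomeomorph (u : GermSection 𝕜 G.Arrow)

end GroupoidHopf

end

noncomputable section

namespace GroupoidHopf

/-! ### Germs: extension by zero, push-forward, exterior product -/

section Germs

variable {𝕜 : Type z} [RCLike 𝕜] {X : Type u} [TopologicalSpace X] {Y : Type v}
  [TopologicalSpace Y] {Z : Type w} [TopologicalSpace Z]

/-! All computations take place on open bisections, that is, open sets of arrows on which source and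
target are both injective. A partition argument (`Cc_induction`, specialised in `sheet_induction`)
writes every element of `C_c^∞(G)` as a finite sum of sheets: smooth compactly supported functions
on open bisections, which are Hausdorff because they inject into `M`. The structure maps are
(multi)linear, so identities need only be checked on sheets. There a push-forward along an injective
map merely relabels points (`pushforward_zeroExt`), and every operation is explicit. The product of
sheets on `U` and `V` lives on the set of products `UV`, with value `a(x)b(y)` at `xy`; a function
`p` on `M` acts on the left as `p ∘ t` and on the right as `p ∘ s`; the antipode reindexes by
inversion; the counit descends a function along `t`; and `Δ a = a ⊗ e`, where `e` is a sheet on the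
domain of `a` equal to `1` on its support. The axioms become pointwise identities.

The substantial point is that `Δ` is well defined, i.e. that `Ω_{t,t}` is injective on the tensor
product over `C_c^∞(M)` (`omega_injective`). Its surjectivity is never needed, since `diag_+ a = Ω(a
⊗ e)` is visibly in the range. Injectivity is proved by localising over `M`. An element killed, for
each `y`, by a function equal to `1` near `y` is zero by compactness of supports. Near a fixed `y`
every tensor is a finite combination of `s b_g ⊗ b_h`, where `g, h` run over the target fibre of
`y`, `b_g` is a bump at `g`, and `s` is a function on `M`. The germ of its image at `(g, h)` sees
only the summand indexed by `(g, h)`, and determines that summand near `y`.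

More generally `Δ a = b ⊗ c` for any factorisation `a = bc` on one bisection (`comulCc_toCc`);
comparing factorisations yields most of the identities for `Δ`. The product `Δ(a)Δ(b)` is computed
on representatives, and its independence of them rests on the equality of the two right actions on
the image of `Δ`. For functoriality, a morphism commutes with targets, hence is a local
homeomorphism with smooth local inverses, is injective on bisections and carries sheets to sheets.
-/

theorem zeroExt_of_mem {U : Set X} {x : X} (h : x ∈ U) (f : X → 𝕜) :
    zeroExt U f x = (f : Germ (𝓝 x) 𝕜) := if_pos h

theorem zeroExt_of_notMem {U : Set X} {x : X} (h : x ∉ U) (f : X → 𝕜) :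
    zeroExt U f x = 0 := if_neg h

theorem zeroExt_congr {U V : Set X} (hU : IsOpen U) (h : U = V) {f g : X → 𝕜}
    (hfg : ∀ x ∈ U, f x = g x) : zeroExt U f = zeroExt V g := by
  subst h
  funext x
  by_cases hx : x ∈ U
  · rw [zeroExt_of_mem hx, zeroExt_of_mem hx, Germ.coe_eq]
    filter_upwards [hU.mem_nhds hx] with y hy using hfg y hy
  · rw [zeroExt_of_notMem hx, zeroExt_of_notMem hx]

theorem zeroExt_eq_zero {U : Set X} (hU : IsOpen U) {f : X → 𝕜} (hf : ∀ x ∈ U, f x = 0) :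
    zeroExt U f = 0 := by
  funext x
  by_cases hx : x ∈ U
  · rw [zeroExt_of_mem hx, Pi.zero_apply, ← Germ.coe_zero, Germ.coe_eq]
    filter_upwards [hU.mem_nhds hx] with y hy using hf y hy
  · rw [zeroExt_of_notMem hx, Pi.zero_apply]

theorem zeroExt_add (U : Set X) (f g : X → 𝕜) :
    zeroExt U (f + g) = zeroExt U f + zeroExt U g := by
  funext x
  by_cases hx : x ∈ U <;> simp [zeroExt, hx]

theorem zeroExt_sub (U : Set X) (f g : X → 𝕜) :
    zeroExt U (f - g) = zeroExt U f - zeroExt U g := by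
  funext x
  by_cases hx : x ∈ U <;> simp [zeroExt, hx]

theorem zeroExt_smul (U : Set X) (c : 𝕜) (f : X → 𝕜) :
    zeroExt U (c • f) = c • zeroExt U f := by
  funext x
  by_cases hx : x ∈ U <;> simp [zeroExt, hx]

theorem zeroExt_mul_zeroExt (U V : Set X) (f g : X → 𝕜) :
    zeroExt U f * zeroExt V g = zeroExt (U ∩ V) (f * g) := by
  funext x
  by_cases h : x ∈ U <;> by_cases h' : x ∈ V <;> simp [zeroExt, h, h']

/-- A compact subset of a Hausdorff open set is relatively closed. -/
theorem isOpen_diff_of_isCompact {U K : Set X} (hU : IsOpen U) [T2Space U] (hK : IsCompact K)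
    (hKU : K ⊆ U) : IsOpen (U \ K) := by
  have h1 : IsCompact ((↑) ⁻¹' K : Set U) := by
    rw [Topology.IsInducing.subtypeVal.isCompact_iff, Subtype.image_preimage_coe,
      Set.inter_eq_right.2 hKU]
    exact hK
  have h2 := hU.isOpenMap_subtype_val _ h1.isClosed.isOpen_compl
  convert h2 using 1
  ext x
  simp

/-- The extension by zero does not change when the domain shrinks around the support. -/
theorem zeroExt_eq_of_subset {U V K : Set X} (hU : IsOpen U) [T2Space U] (hVU : V ⊆ U)
    (hK : IsCompact K) (hKV : K ⊆ V) {f : X → 𝕜} (hf : ∀ x ∈ U, x ∉ K → f x = 0) :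
    zeroExt U f = zeroExt V f := by
  funext x
  by_cases hV : x ∈ V
  · rw [zeroExt_of_mem hV, zeroExt_of_mem (hVU hV)]
  · rw [zeroExt_of_notMem hV]
    by_cases hx : x ∈ U
    · rw [zeroExt_of_mem hx, ← Germ.coe_zero, Germ.coe_eq]
      filter_upwards [(isOpen_diff_of_isCompact hU hK (hKV.trans hVU)).mem_nhds
        ⟨hx, fun h => hV (hKV h)⟩] with y hy using hf y hy.1 hy.2
    · rw [zeroExt_of_notMem hx]

theorem germPullback_coe (φ : X → Y) {x : X} {y : Y} (h : Tendsto φ (𝓝 x) (𝓝 y)) (f : Y → 𝕜) :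
    germPullback 𝕜 φ h (f : Germ (𝓝 y) 𝕜) = ((fun x => f (φ x) : X → 𝕜) : Germ (𝓝 x) 𝕜) := rfl

theorem germPushforward_coe {φ : X → Y} (hφ : IsLocalHomeomorph φ) {x : X} {y : Y} (h : φ x = y)
    {f : X → 𝕜} {F : Y → 𝕜} (hF : ∀ᶠ x' in 𝓝 x, F (φ x') = f x') :
    germPushforward 𝕜 hφ h (f : Germ (𝓝 x) 𝕜) = (F : Germ (𝓝 y) 𝕜) := by
  rw [germPushforward, LinearEquiv.symm_apply_eq, LinearEquiv.ofBijective_apply,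
    germPullback_coe, Germ.coe_eq]
  filter_upwards [hF] with x' hx' using hx'.symm

/-- The push-forward of an extension by zero from an open set on which the map is injective. -/
theorem pushforward_zeroExt {φ : X → Y} (hφ : IsLocalHomeomorph φ) {V : Set X} (hV : IsOpen V)
    (hinj : Set.InjOn φ V) {f : X → 𝕜} {F : Y → 𝕜} (hF : ∀ x ∈ V, F (φ x) = f x) :
    pushforward hφ (zeroExt V f) = zeroExt (φ '' V) F := by
  funext y
  rw [pushforward]
  by_cases hy : y ∈ φ '' V
  · obtain ⟨x, hx, rfl⟩ := hy
    -- By injectivity on `V`, the fibre over `φ x` contains no other point with a nonzero germ.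
    rw [finsum_eq_single _ (⟨x, rfl⟩ : {x' // φ x' = φ x}), zeroExt_of_mem hx,
      zeroExt_of_mem (Set.mem_image_of_mem φ hx), germPushforward_coe]
    · filter_upwards [hV.mem_nhds hx] with x' hx' using hF x' hx'
    · rintro ⟨x', hx'⟩ hne
      have : x' ∉ V := fun h => hne (Subtype.ext (hinj h hx hx'))
      rw [zeroExt_of_notMem this, map_zero]
  · rw [zeroExt_of_notMem hy]
    refine finsum_eq_zero_of_forall_eq_zero ?_
    rintro ⟨x', rfl⟩
    have : x' ∉ V := fun h => hy ⟨x', h, rfl⟩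
    rw [zeroExt_of_notMem this, map_zero]

variable (𝕜) in
/-- The sections of germs with finite support on every fibre of `φ`. -/
def fiberFinite (φ : X → Y) : Submodule 𝕜 (GermSection 𝕜 X) where
  carrier := {u | ∀ y, {x : {x // φ x = y} | u x.1 ≠ 0}.Finite}
  zero_mem' y := by simp
  add_mem' {a b} ha hb y := by
    refine ((ha y).union (hb y)).subset fun x hx => ?_
    by_contra h
    simp only [Set.mem_union, Set.mem_ofPred_eq, not_or, not_not] at h
    exact hx (by rw [Pi.add_apply, h.1, h.2, add_zero])
  smul_mem' c a ha y := by
    refine (ha y).subset fun x hx h => hx ?_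
    rw [Pi.smul_apply, h, smul_zero]

/-- A fibre meets `V` in at most one point. -/
theorem zeroExt_mem_fiberFinite {φ : X → Y} {V : Set X} (hinj : Set.InjOn φ V) (f : X → 𝕜) :
    zeroExt V f ∈ fiberFinite 𝕜 φ := by
  intro y
  refine Set.Subsingleton.finite ?_
  rintro ⟨x, hx⟩ h ⟨x', hx'⟩ h'
  have h1 : x ∈ V := by_contra fun hn => h (zeroExt_of_notMem hn f)
  have h2 : x' ∈ V := by_contra fun hn => h' (zeroExt_of_notMem hn f)
  exact Subtype.ext (hinj h1 h2 (hx.trans hx'.symm))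

/-- The push-forward as a linear map on the sections with finite support on the fibres. -/
def pushforwardFiberFinite {φ : X → Y} (hφ : IsLocalHomeomorph φ) :
    fiberFinite 𝕜 φ →ₗ[𝕜] GermSection 𝕜 Y where
  toFun u := pushforward hφ (u : GermSection 𝕜 X)
  map_add' a b := by
    funext y
    simp only [pushforward, Submodule.coe_add, Pi.add_apply, map_add]
    exact finsum_add_distrib ((a.2 y).subset fun x hx h => hx (by simp [h]))
      ((b.2 y).subset fun x hx h => hx (by simp [h]))
  map_smul' c a := by
    funext y
    simp only [pushforward, Submodule.coe_smul, Pi.smul_apply, map_smul, RingHom.id_apply]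
    exact (smul_finsum' c ((a.2 y).subset fun x hx h => hx (by simp [h]))).symm

theorem pushforward_add {φ : X → Y} (hφ : IsLocalHomeomorph φ) {a b : GermSection 𝕜 X}
    (ha : a ∈ fiberFinite 𝕜 φ) (hb : b ∈ fiberFinite 𝕜 φ) :
    pushforward hφ (a + b) = pushforward hφ a + pushforward hφ b :=
  (pushforwardFiberFinite hφ).map_add ⟨a, ha⟩ ⟨b, hb⟩

theorem pushforward_smul {φ : X → Y} (hφ : IsLocalHomeomorph φ) (c : 𝕜) {a : GermSection 𝕜 X}
    (ha : a ∈ fiberFinite 𝕜 φ) : pushforward hφ (c • a) = c • pushforward hφ a :=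
  (pushforwardFiberFinite hφ).map_smul c ⟨a, ha⟩

theorem pushforward_zero {φ : X → Y} (hφ : IsLocalHomeomorph φ) :
    pushforward hφ (0 : GermSection 𝕜 X) = 0 :=
  (pushforwardFiberFinite hφ).map_zero

theorem extProd_zeroExt (π : X → Z) (ξ : Y → Z) (U : Set X) (V : Set Y) (f : X → 𝕜)
    (g : Y → 𝕜) : extProd 𝕜 π ξ (zeroExt U f) (zeroExt V g) =
      zeroExt {q : π.Pullback ξ | q.1.1 ∈ U ∧ q.1.2 ∈ V} (fun q => f q.1.1 * g q.1.2) := by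
  funext q
  rw [extProd, LinearMap.mk₂_apply]
  by_cases h : q.1.1 ∈ U
  · by_cases h' : q.1.2 ∈ V
    · rw [zeroExt_of_mem h, zeroExt_of_mem h', zeroExt_of_mem (by exact ⟨h, h'⟩)]
      rfl
    · rw [zeroExt_of_notMem h', map_zero, mul_zero, zeroExt_of_notMem fun h => h' h.2]
  · rw [zeroExt_of_notMem h, map_zero, zero_mul, zeroExt_of_notMem fun h' => h h'.1]

theorem isOpen_pullback_prod (π : X → Z) (ξ : Y → Z) {U : Set X} {V : Set Y} (hU : IsOpen U)
    (hV : IsOpen V) : IsOpen {q : π.Pullback ξ | q.1.1 ∈ U ∧ q.1.2 ∈ V} :=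
  (hU.preimage (continuous_fst.comp continuous_subtype_val)).inter
    (hV.preimage (continuous_snd.comp continuous_subtype_val))

end Germs

/-! ### Compactly supported smooth functions and bump functions -/

section Smooth

variable {𝕜 : Type z} [RCLike 𝕜] {E : Type w} [NormedAddCommGroup E] [NormedSpace ℝ E]
  {X : Type u} [TopologicalSpace X] [ChartedSpace E X]
  {Y : Type v} [TopologicalSpace Y] [ChartedSpace E Y]

theorem _root_.ContMDiffOn.rclike_mul {U : Set X} {f g : X → 𝕜}
    (hf : ContMDiffOn 𝓘(ℝ, E) 𝓘(ℝ, 𝕜) ∞ f U) (hg : ContMDiffOn 𝓘(ℝ, E) 𝓘(ℝ, 𝕜) ∞ g U) :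
    ContMDiffOn 𝓘(ℝ, E) 𝓘(ℝ, 𝕜) ∞ (f * g) U := fun x hx =>
  (contDiff_mul (𝕜 := ℝ) (𝔸 := 𝕜)).contDiffAt.contMDiffAt.comp_contMDiffWithinAt x
    ((hf x hx).prodMk_space (hg x hx))

namespace SmoothCompactlySupportedOn

variable {U V : Set X} {f g : X → 𝕜}

theorem mul_left (hg : SmoothCompactlySupportedOn E U g)
    (hf : ContMDiffOn 𝓘(ℝ, E) 𝓘(ℝ, 𝕜) ∞ f U) : SmoothCompactlySupportedOn E U (f * g) := by
  obtain ⟨hg, K, hKU, hK, h⟩ := hg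
  exact ⟨hf.rclike_mul hg, K, hKU, hK, fun x hx hxK => by simp [h x hx hxK]⟩

theorem add (hf : SmoothCompactlySupportedOn E U f) (hg : SmoothCompactlySupportedOn E U g) :
    SmoothCompactlySupportedOn E U (f + g) := by
  obtain ⟨hf, K, hKU, hK, h⟩ := hf
  obtain ⟨hg, L, hLU, hL, h'⟩ := hg
  refine ⟨hf.add hg, K ∪ L, Set.union_subset hKU hLU, hK.union hL, fun x hx hxK => ?_⟩
  rw [Set.mem_union, not_or] at hxK
  simp [h x hx hxK.1, h' x hx hxK.2]

theorem smul (c : 𝕜) (hf : SmoothCompactlySupportedOn E U f) :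
    SmoothCompactlySupportedOn E U (c • f) :=
  hf.mul_left (f := fun _ => c) contMDiffOn_const

theorem sub (hf : SmoothCompactlySupportedOn E U f) (hg : SmoothCompactlySupportedOn E U g) :
    SmoothCompactlySupportedOn E U (f - g) := by
  have := hf.add (hg.smul (-1))
  rwa [neg_one_smul, ← sub_eq_add_neg] at this

end SmoothCompactlySupportedOn

theorem zeroExt_mem_Cc {U : Set X} (hU : IsOpen U) (hU2 : T2Space U) {f : X → 𝕜}
    (hf : SmoothCompactlySupportedOn E U f) : zeroExt U f ∈ Cc 𝕜 E X :=
  Submodule.subset_span ⟨U, f, hU, hU2, hf, rfl⟩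

section Bump

variable [FiniteDimensional ℝ E] [IsManifold 𝓘(ℝ, E) ∞ X]

variable (𝕜) in
-- Smooth bump functions have compact topological support only on a Hausdorff manifold, so the bump
-- is built on `U` itself. Outside `U` the function is `0` by convention, and nothing is claimed
-- about its smoothness there.
theorem exists_bump {U V : Set X} (hU : IsOpen U) (hU2 : T2Space U) (hV : IsOpen V)
    (hVU : V ⊆ U) {x : X} (hx : x ∈ V) :
    ∃ g : X → 𝕜, ContMDiffOn 𝓘(ℝ, E) 𝓘(ℝ, 𝕜) ∞ g U ∧
      (∃ K ⊆ V, IsCompact K ∧ ∀ y ∈ U, y ∉ K → g y = 0) ∧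
      ∃ W ⊆ V, IsOpen W ∧ x ∈ W ∧ ∀ y ∈ W, g y = 1 := by
  classical
  let U' : TopologicalSpace.Opens X := ⟨U, hU⟩
  have : T2Space U' := hU2
  let c : U' := ⟨x, hVU hx⟩
  have hV' : ((↑) ⁻¹' V : Set U') ∈ 𝓝 c :=
    (hV.preimage continuous_subtype_val).mem_nhds hx
  obtain ⟨f, -, hf⟩ := (SmoothBumpFunction.nhds_basis_tsupport (I := 𝓘(ℝ, E)) c).mem_iff.1 hV'
  have hext : ∀ y : U', (if h : (y : X) ∈ U then (f ⟨y, h⟩ : 𝕜) else 0) = (f y : 𝕜) :=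
    fun y => dif_pos y.2
  refine ⟨fun y => if h : y ∈ U then (f ⟨y, h⟩ : 𝕜) else 0, ?_,
    ⟨(↑) '' tsupport f, ?_, ?_, ?_⟩, ?_⟩
  · intro y hy
    refine ContMDiffAt.contMDiffWithinAt ?_
    rw [← contMDiffAt_subtype_iff (U := U') (x := ⟨y, hy⟩)]
    simp only [hext]
    exact (RCLike.ofRealCLM (K := 𝕜)).contDiff.contDiffAt.contMDiffAt.comp _ f.contMDiffAt
  · rintro _ ⟨y, hy, rfl⟩
    exact hf hy
  · exact f.hasCompactSupport.isCompact.image continuous_subtype_val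
  · intro y hy hyK
    dsimp only
    rw [dif_pos hy, image_eq_zero_of_notMem_tsupport fun h => hyK ⟨_, h, rfl⟩]
    simp
  · obtain ⟨W, hW1, hW, hcW⟩ := mem_nhds_iff.1 (f.eventuallyEq_one.and hV')
    refine ⟨(↑) '' W, ?_, hU.isOpenMap_subtype_val _ hW, ⟨c, hcW, rfl⟩, ?_⟩
    · rintro _ ⟨y, hy, rfl⟩
      exact (hW1 hy).2
    · rintro _ ⟨y, hy, rfl⟩
      dsimp only
      rw [hext, (hW1 hy).1]
      simp

variable (𝕜) in
theorem exists_smooth_eq_one_of_isCompact {U K : Set X} (hU : IsOpen U) (hU2 : T2Space U)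
    (hK : IsCompact K) (hKU : K ⊆ U) :
    ∃ χ : X → 𝕜, SmoothCompactlySupportedOn E U χ ∧
      ∃ W ⊆ U, IsOpen W ∧ K ⊆ W ∧ ∀ y ∈ W, χ y = 1 := by
  refine hK.induction_on (p := fun s => ∃ χ : X → 𝕜, SmoothCompactlySupportedOn E U χ ∧
      ∃ W ⊆ U, IsOpen W ∧ s ⊆ W ∧ ∀ y ∈ W, χ y = 1) ?_ ?_ ?_ ?_
  · exact ⟨0, ⟨contMDiffOn_const, ∅, Set.empty_subset _, isCompact_empty, fun _ _ _ => rfl⟩,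
      ∅, Set.empty_subset _, isOpen_empty, subset_rfl, fun _ h => h.elim⟩
  · rintro s t hst ⟨χ, hχ, W, hWU, hW, htW, h⟩
    exact ⟨χ, hχ, W, hWU, hW, hst.trans htW, h⟩
  · rintro s t ⟨χ, hχ, W, hWU, hW, hsW, h⟩ ⟨χ', hχ', W', hWU', hW', htW, h'⟩
    -- This is `1 - (1 - χ)(1 - χ')`, which equals `1` wherever one of the two factors does.
    refine ⟨χ + χ' - χ * χ', (hχ.add hχ').sub (hχ'.mul_left hχ.1), W ∪ W',
      Set.union_subset hWU hWU', hW.union hW', Set.union_subset_union hsW htW, ?_⟩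
    rintro y (hy | hy)
    · simp [h y hy]
    · simp [h' y hy]
  · intro x hx
    obtain ⟨g, hg, ⟨L, hLU, hL, hgL⟩, W, hWU, hW, hxW, h⟩ :=
      exists_bump (E := E) 𝕜 hU hU2 hU subset_rfl (hKU hx)
    exact ⟨W, mem_nhdsWithin_of_mem_nhds (hW.mem_nhds hxW), g, ⟨hg, L, hLU, hL, hgL⟩, W, hWU, hW,
      subset_rfl, h⟩

end Bump

/-! ### Reduction to functions with small support, and descent -/

/-- A property of subsets which is inherited by subsets and holds for small open sets. -/
structure IsLocalProperty (P : Set X → Prop) : Prop where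
  exists_isOpen : ∀ x, ∃ V, IsOpen V ∧ x ∈ V ∧ P V
  mono : ∀ V W, W ⊆ V → P V → P W

theorem isLocalProperty_injOn {X : Type*} [TopologicalSpace X] {Y : Type*} [TopologicalSpace Y]
    {φ : X → Y} (hφ : IsLocalHomeomorph φ) : IsLocalProperty (fun V => Set.InjOn φ V) where
  exists_isOpen x := by
    obtain ⟨e, hx, rfl⟩ := hφ x
    exact ⟨e.source, e.open_source, hx, e.injOn⟩
  mono _ _ h h' := h'.mono h

theorem IsLocalProperty.and {X : Type*} [TopologicalSpace X] {P Q : Set X → Prop}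
    (hP : IsLocalProperty P) (hQ : IsLocalProperty Q) : IsLocalProperty (fun V => P V ∧ Q V) where
  exists_isOpen x := by
    obtain ⟨V, hV, hx, h⟩ := hP.exists_isOpen x
    obtain ⟨W, hW, hx', h'⟩ := hQ.exists_isOpen x
    exact ⟨V ∩ W, hV.inter hW, ⟨hx, hx'⟩, hP.mono _ _ Set.inter_subset_left h,
      hQ.mono _ _ Set.inter_subset_right h'⟩
  mono _ _ h h' := ⟨hP.mono _ _ h h'.1, hQ.mono _ _ h h'.2⟩

/-- Induction on elements of `C_c^∞(X)`: these are sums of functions with supports in small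
open sets. -/
theorem Cc_induction [FiniteDimensional ℝ E] [IsManifold 𝓘(ℝ, E) ∞ X] {P : Set X → Prop}
    (hP : IsLocalProperty P) {motive : GermSection 𝕜 X → Prop}
    (basic : ∀ (V : Set X) (f : X → 𝕜), IsOpen V → T2Space V → P V →
      SmoothCompactlySupportedOn E V f → motive (zeroExt V f))
    (zero : motive 0)
    (add : ∀ a ∈ Cc 𝕜 E X, ∀ b ∈ Cc 𝕜 E X, motive a → motive b → motive (a + b))
    {u : GermSection 𝕜 X} (hu : u ∈ Cc 𝕜 E X) : motive u := by
  -- The motive is only assumed additive; carrying all scalar multiples along disposes of the scalar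
  -- step of the span induction.
  suffices h : ∀ c : 𝕜, motive (c • u) by simpa using h 1
  induction hu using Submodule.span_induction with
  | zero => simpa using fun _ : 𝕜 => zero
  | add x y hx hy h h' =>
    intro c
    rw [smul_add]
    exact add _ (Submodule.smul_mem _ _ hx) _ (Submodule.smul_mem _ _ hy) (h c) (h' c)
  | smul a x _ h =>
    intro c
    rw [smul_smul]
    exact h _
  | mem x hx =>
    intro c
    obtain ⟨U, f, hU, hU2, hf, rfl⟩ := hx
    rw [← zeroExt_smul]
    replace hf := hf.smul c
    generalize c • f = f at hf
    obtain ⟨K, hKU, hK, hfK⟩ := hf.2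
    -- A finite partition of unity in disguise: compactness induction on `K` builds a cut-off `χ`
    -- with the motive known for every `χ f`. Since `χ = 1` on `K`, the given `f` equals `χ f`.
    obtain ⟨χ, -, W, hKW, h1, h2⟩ : ∃ χ : X → 𝕜, ContMDiffOn 𝓘(ℝ, E) 𝓘(ℝ, 𝕜) ∞ χ U ∧
        ∃ W, K ⊆ W ∧ (∀ x ∈ W, χ x = 1) ∧
          ∀ f, SmoothCompactlySupportedOn E U f → motive (zeroExt U (χ * f)) := by
      refine hK.induction_on (p := fun s => ∃ χ : X → 𝕜, ContMDiffOn 𝓘(ℝ, E) 𝓘(ℝ, 𝕜) ∞ χ U ∧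
        ∃ W, s ⊆ W ∧ (∀ x ∈ W, χ x = 1) ∧
          ∀ f, SmoothCompactlySupportedOn E U f → motive (zeroExt U (χ * f))) ?_ ?_ ?_ ?_
      · refine ⟨0, contMDiffOn_const, ∅, subset_rfl, fun _ h => h.elim, fun f hf => ?_⟩
        rw [zero_mul, zeroExt_eq_zero (f := 0) hU fun _ _ => rfl]
        exact zero
      · rintro s t hst ⟨χ, hχ, W, htW, h⟩
        exact ⟨χ, hχ, W, hst.trans htW, h⟩
      · rintro s t ⟨χ, hχ, W, hsW, h1, h2⟩ ⟨χ', hχ', W', htW, h1', h2'⟩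
        refine ⟨χ + χ' - χ * χ', (hχ.add hχ').sub (hχ.rclike_mul hχ'), W ∪ W',
          Set.union_subset_union hsW htW, ?_, fun f hf => ?_⟩
        · rintro y (hy | hy)
          · simp [h1 y hy]
          · simp [h1' y hy]
        · have hf' := (hf.smul (-1)).mul_left hχ'
          -- The minus sign is absorbed into the test function, because the motive is not known to
          -- be stable under subtraction.
          have e : (χ + χ' - χ * χ') * f = χ * f + (χ' * f + χ * (χ' * ((-1 : 𝕜) • f))) := by
            rw [neg_one_smul]
            ring
          rw [e, zeroExt_add, zeroExt_add]
          have m1 := zeroExt_mem_Cc hU hU2 (hf.mul_left hχ)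
          have m2 := zeroExt_mem_Cc hU hU2 (hf.mul_left hχ')
          have m3 := zeroExt_mem_Cc hU hU2 (hf'.mul_left hχ)
          exact add _ m1 _ (add_mem m2 m3) (h2 _ hf) (add _ m2 _ m3 (h2' _ hf) (h2 _ hf'))
      · intro x hx
        obtain ⟨V, hV, hxV, hPV⟩ := hP.exists_isOpen x
        obtain ⟨g, hg, ⟨L, hLV, hL, hgL⟩, W, hWV, hW, hxW, h⟩ :=
          exists_bump (E := E) 𝕜 hU hU2 (hU.inter hV) Set.inter_subset_left ⟨hKU hx, hxV⟩
        refine ⟨W, mem_nhdsWithin_of_mem_nhds (hW.mem_nhds hxW), g, hg, W, subset_rfl, h,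
          fun f hf => ?_⟩
        have h0 : ∀ y ∈ U, y ∉ L → (g * f) y = 0 := fun y hy hyL => by simp [hgL y hy hyL]
        rw [zeroExt_eq_of_subset hU Set.inter_subset_left hL hLV h0]
        exact basic _ _ (hU.inter hV)
          (Topology.IsEmbedding.inclusion (Set.inter_subset_left (s := U) (t := V))).t2Space
          (hP.mono _ _ Set.inter_subset_right hPV)
          ⟨(hg.rclike_mul hf.1).mono Set.inter_subset_left, L, hLV, hL,
            fun y hy hyL => h0 y hy.1 hyL⟩
    rw [zeroExt_congr (g := χ * f) hU rfl]
    · exact h2 f hf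
    · intro x hx
      by_cases hxK : x ∈ K
      · simp [h1 x (hKW hxK)]
      · simp [hfK x hx hxK]

/-- A map whose local inverses are smooth. -/
def HasSmoothLocalInverses (E : Type w) [NormedAddCommGroup E] [NormedSpace ℝ E]
    [ChartedSpace E X] [ChartedSpace E Y] (φ : X → Y) : Prop :=
  ∀ x, ∃ ψ : Y → X, ContMDiffAt 𝓘(ℝ, E) 𝓘(ℝ, E) ∞ ψ (φ x) ∧ ∀ᶠ x' in 𝓝 x, ψ (φ x') = x'

theorem _root_.IsLocalDiffeomorph.hasSmoothLocalInverses {φ : X → Y}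
    (hφ : IsLocalDiffeomorph 𝓘(ℝ, E) 𝓘(ℝ, E) ∞ φ) : HasSmoothLocalInverses E φ := fun x =>
  ⟨(hφ x).localInverse, (hφ x).localInverse_contMDiffAt, (hφ x).localInverse_eventuallyEq_left⟩

theorem exists_comp_eq {X Y β : Type*} [Zero β] {φ : X → Y} {V : Set X} (hinj : Set.InjOn φ V)
    (f : X → β) : ∃ F : Y → β, ∀ x ∈ V, F (φ x) = f x := by
  classical
  refine ⟨fun y => if h : ∃ x ∈ V, φ x = y then f h.choose else 0, fun x hx => ?_⟩
  have h : ∃ x' ∈ V, φ x' = φ x := ⟨x, hx, rfl⟩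
  dsimp only
  rw [dif_pos h, hinj h.choose_spec.1 hx h.choose_spec.2]

/-- A smooth function with compact support on an open set on which `φ` is injective descends
along `φ`. -/
theorem exists_descent {φ : X → Y} (hφ : IsLocalHomeomorph φ) (hφ' : HasSmoothLocalInverses E φ)
    {V : Set X} (hV : IsOpen V) (hinj : Set.InjOn φ V) {f : X → 𝕜}
    (hf : SmoothCompactlySupportedOn E V f) :
    ∃ F : Y → 𝕜, (∀ x ∈ V, F (φ x) = f x) ∧ SmoothCompactlySupportedOn E (φ '' V) F := by
  obtain ⟨hf, K, hKV, hK, hfK⟩ := hf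
  obtain ⟨F, hF⟩ := exists_comp_eq hinj f
  refine ⟨F, hF, ?_, φ '' K, Set.image_mono hKV, hK.image hφ.continuous, ?_⟩
  · rintro _ ⟨x, hx, rfl⟩
    refine ContMDiffAt.contMDiffWithinAt ?_
    obtain ⟨ψ, hψ, hψφ⟩ := hφ' x
    have h1 : ContMDiffAt 𝓘(ℝ, E) 𝓘(ℝ, 𝕜) ∞ (f ∘ ψ) (φ x) := by
      refine ContMDiffAt.comp _ ?_ hψ
      rw [hψφ.self_of_nhds]
      exact hf.contMDiffAt (hV.mem_nhds hx)
    -- Near `φ x` the descended `F` agrees with `f ∘ ψ`, as `φ` maps the neighbourhood filter of `x`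
    -- onto that of `φ x`.
    refine h1.congr_of_eventuallyEq ?_
    rw [← hφ.map_nhds_eq x, Filter.EventuallyEq, eventually_map]
    filter_upwards [hψφ, hV.mem_nhds hx] with x' h h'
    rw [hF x' h', Function.comp_apply, h]
  · rintro _ ⟨x, hx, rfl⟩ hxK
    exact (hF x hx).trans (hfK x hx fun h => hxK ⟨x, h, rfl⟩)

/-- The restriction of `φ` to `V` is an open embedding, hence a homeomorphism onto `φ '' V`. -/
theorem t2Space_image {X : Type*} [TopologicalSpace X] {Y : Type*} [TopologicalSpace Y]
    {φ : X → Y} (hφ : IsLocalHomeomorph φ) {V : Set X} (hV : IsOpen V)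
    [T2Space V] (hinj : Set.InjOn φ V) : T2Space (φ '' V) := by
  have h : Topology.IsOpenEmbedding (V.domRestrict φ) :=
    Topology.IsOpenEmbedding.of_continuous_injective_isOpenMap
      (hφ.continuous.comp continuous_subtype_val) (Set.injOn_iff_injective.1 hinj)
      (hφ.isOpenMap.comp hV.isOpenMap_subtype_val)
  have e := h.toIsEmbedding.toHomeomorph
  have hr : Set.range (V.domRestrict φ) = φ '' V := Set.range_domRestrict φ V
  rw [← hr]
  exact e.t2Space

/-! ### Linearity and functoriality of the push-forward -/

section Pushforward

variable [FiniteDimensional ℝ E] [IsManifold 𝓘(ℝ, E) ∞ X]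

/-- The fibre sum is a `finsum`, additive only for finitely supported families; this inclusion is
what makes push-forward linear on `C_c^∞(X)`. -/
theorem Cc_le_fiberFinite {Y : Type*} [TopologicalSpace Y] {φ : X → Y}
    (hφ : IsLocalHomeomorph φ) : Cc 𝕜 E X ≤ fiberFinite 𝕜 φ := fun _ hu =>
  Cc_induction (isLocalProperty_injOn hφ)
    (fun _ f _ _ hinj _ => zeroExt_mem_fiberFinite hinj f) (zero_mem _)
    (fun _ _ _ _ h h' => add_mem h h') hu

theorem pushforward_mem_Cc {φ : X → Y} (hφ : IsLocalHomeomorph φ)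
    (hφ' : HasSmoothLocalInverses E φ) {u : GermSection 𝕜 X} (hu : u ∈ Cc 𝕜 E X) :
    pushforward hφ u ∈ Cc 𝕜 E Y := by
  refine Cc_induction (motive := fun u => pushforward hφ u ∈ Cc 𝕜 E Y) (isLocalProperty_injOn hφ) (fun V f hV hV2 hinj hf => ?_)
    ?_ (fun a ha b hb h h' => ?_) hu
  · obtain ⟨F, hF, hF'⟩ := exists_descent hφ hφ' hV hinj hf
    rw [pushforward_zeroExt hφ hV hinj hF]
    exact zeroExt_mem_Cc (hφ.isOpenMap _ hV) (t2Space_image hφ hV hinj) hF'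
  · rw [pushforward_zero]
    exact zero_mem _
  · rw [pushforward_add hφ (Cc_le_fiberFinite hφ ha) (Cc_le_fiberFinite hφ hb)]
    exact add_mem h h'

/-- The push-forward `C_c^∞(X) → C_c^∞(Y)`. -/
def pushCc {φ : X → Y} (hφ : IsLocalHomeomorph φ) (hφ' : HasSmoothLocalInverses E φ) :
    Cc 𝕜 E X →ₗ[𝕜] Cc 𝕜 E Y where
  toFun u := ⟨pushforward hφ (u : GermSection 𝕜 X), pushforward_mem_Cc hφ hφ' u.2⟩
  map_add' a b := Subtype.ext (pushforward_add hφ (Cc_le_fiberFinite hφ a.2)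
    (Cc_le_fiberFinite hφ b.2))
  map_smul' c a := Subtype.ext (pushforward_smul hφ c (Cc_le_fiberFinite hφ a.2))

/-- On an open set where the composite is injective, both `φ` and then `ψ` on the image are
injective too, so both sides are the same relabelled function. Every identity between composites of
structure maps of groupoids turns into an identity of push-forwards in this way. -/
theorem pushforward_comp [IsManifold 𝓘(ℝ, E) ∞ Y] {Z : Type*} [TopologicalSpace Z]
    {φ : X → Y} {ψ : Y → Z} {χ : X → Z}
    (hφ : IsLocalHomeomorph φ) (hφ' : HasSmoothLocalInverses E φ) (hψ : IsLocalHomeomorph ψ)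
    (hχ : IsLocalHomeomorph χ) (h : ∀ x, ψ (φ x) = χ x) {u : GermSection 𝕜 X}
    (hu : u ∈ Cc 𝕜 E X) : pushforward hψ (pushforward hφ u) = pushforward hχ u := by
  refine Cc_induction (motive := fun u => pushforward hψ (pushforward hφ u) = pushforward hχ u) (isLocalProperty_injOn hχ) (fun V f hV hV2 hinj hf => ?_)
    ?_ (fun a ha b hb h h' => ?_) hu
  · have hinj' : Set.InjOn φ V := fun x hx y hy hxy =>
      hinj hx hy (by rw [← h, ← h, hxy])
    obtain ⟨F, hF, hF'⟩ := exists_descent hφ hφ' hV hinj' hf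
    have hinj'' : Set.InjOn ψ (φ '' V) := by
      rintro _ ⟨x, hx, rfl⟩ _ ⟨y, hy, rfl⟩ hxy
      rw [h, h] at hxy
      rw [hinj hx hy hxy]
    obtain ⟨F', hF''⟩ := exists_comp_eq hinj f
    rw [pushforward_zeroExt hφ hV hinj' hF, pushforward_zeroExt hχ hV hinj hF'',
      pushforward_zeroExt hψ (hφ.isOpenMap _ hV) hinj'' (F := F'), Set.image_image]
    · simp only [h]
    · rintro _ ⟨x, hx, rfl⟩
      rw [h, hF'' x hx, hF x hx]
  · simp only [pushforward_zero]
  · have ma := pushforward_mem_Cc hφ hφ' ha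
    have mb := pushforward_mem_Cc hφ hφ' hb
    rw [pushforward_add hφ (Cc_le_fiberFinite hφ ha) (Cc_le_fiberFinite hφ hb),
      pushforward_add hψ (Cc_le_fiberFinite hψ ma) (Cc_le_fiberFinite hψ mb),
      pushforward_add hχ (Cc_le_fiberFinite hχ ha) (Cc_le_fiberFinite hχ hb), h, h']

theorem pushforward_id {φ : X → X} (hφ : IsLocalHomeomorph φ) (h : ∀ x, φ x = x)
    (u : GermSection 𝕜 X) (hu : u ∈ Cc 𝕜 E X) : pushforward hφ u = u := by
  obtain rfl : φ = id := funext h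
  refine Cc_induction (motive := fun u => pushforward hφ u = u) (isLocalProperty_injOn hφ) (fun V f hV hV2 hinj hf => ?_)
    ?_ (fun a ha b hb h h' => ?_) hu
  · rw [pushforward_zeroExt hφ hV hinj (f := f) (F := f) fun _ _ => rfl, Set.image_id]
  · rw [pushforward_zero]
  · rw [pushforward_add hφ (Cc_le_fiberFinite hφ ha) (Cc_le_fiberFinite hφ hb), h, h']

end Pushforward

/-! ### The Hausdorff case: global functions -/

section Hausdorff

variable [T2Space X]

/-- On a Hausdorff manifold, the elements of `C_c^∞(X)` are globally defined functions. -/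
theorem exists_eq_zeroExt_univ {u : GermSection 𝕜 X} (hu : u ∈ Cc 𝕜 E X) :
    ∃ p : X → 𝕜, SmoothCompactlySupportedOn E Set.univ p ∧ u = zeroExt Set.univ p := by
  induction hu using Submodule.span_induction with
  | zero =>
    exact ⟨0, ⟨contMDiffOn_const, ∅, Set.subset_univ _, isCompact_empty, fun _ _ _ => rfl⟩,
      (zeroExt_eq_zero isOpen_univ fun _ _ => rfl).symm⟩
  | add x y _ _ h h' =>
    obtain ⟨p, hp, rfl⟩ := h
    obtain ⟨q, hq, rfl⟩ := h'
    exact ⟨p + q, hp.add hq, (zeroExt_add _ _ _).symm⟩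
  | smul c x _ h =>
    obtain ⟨p, hp, rfl⟩ := h
    exact ⟨c • p, hp.smul c, (zeroExt_smul _ _ _).symm⟩
  | mem x hx =>
    obtain ⟨U, f, hU, hU2, ⟨hf, K, hKU, hK, hfK⟩, rfl⟩ := hx
    have h0 : ∀ x ∈ Set.univ, x ∉ K → U.indicator f x = 0 := by
      intro x _ hx
      by_cases hxU : x ∈ U
      · rw [Set.indicator_of_mem hxU, hfK x hxU hx]
      · rw [Set.indicator_of_notMem hxU]
    refine ⟨U.indicator f, ⟨?_, K, Set.subset_univ _, hK, h0⟩, ?_⟩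
    · intro x _
      refine ContMDiffAt.contMDiffWithinAt ?_
      by_cases hxU : x ∈ U
      · refine (hf.contMDiffAt (hU.mem_nhds hxU)).congr_of_eventuallyEq ?_
        filter_upwards [hU.mem_nhds hxU] with y hy using Set.indicator_of_mem hy f
      -- Here Hausdorffness enters: `K` is closed, so its complement is a neighbourhood of `x` on
      -- which the extension vanishes.
      · refine (contMDiffAt_const (c := (0 : 𝕜))).congr_of_eventuallyEq ?_
        filter_upwards [hK.isClosed.isOpen_compl.mem_nhds fun h => hxU (hKU h)] with y hy
          using h0 y trivial hy
    · rw [zeroExt_eq_of_subset isOpen_univ (Set.subset_univ U) hK hKU h0]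
      exact zeroExt_congr hU rfl fun x hx => (Set.indicator_of_mem hx f).symm

end Hausdorff

end Smooth

/-! ### Groupoid identities and convolution on bisections -/

namespace EtGrpd

variable {E : Type v} [NormedAddCommGroup E] [NormedSpace ℝ E]
  {M : Type w} [TopologicalSpace M] [ChartedSpace E M] (G : EtGrpd.{u} E M)

section Groupoid

variable {G}

/-- Serves to replace arrows inside a composable pair, where the composability proof depends on them
and obstructs rewriting. -/
theorem mul_congr {g g' h h' : G.Arrow} (hg : g = g') (hh : h = h') (e : G.src g = G.tgt h)
    (e' : G.src g' = G.tgt h') : G.mul ⟨(g, h), e⟩ = G.mul ⟨(g', h'), e'⟩ := by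
  subst hg hh
  rfl

theorem inv_mul_cancel_left (g h : G.Arrow) (e : G.src g = G.tgt h) :
    G.mul ⟨(G.inv g, G.mul ⟨(g, h), e⟩), (G.src_inv g).trans (G.tgt_mul ⟨(g, h), e⟩).symm⟩ =
      h := by
  rw [← G.mul_assoc _ _ _ (G.src_inv g) e]
  exact (mul_congr ((G.inv_mul g).trans (congrArg G.unit e)) rfl _ (G.src_unit _)).trans
    (G.unit_mul h)

theorem mul_inv_cancel_right (g h : G.Arrow) (e : G.src g = G.tgt h) :
    G.mul ⟨(G.mul ⟨(g, h), e⟩, G.inv h), (G.src_mul ⟨(g, h), e⟩).trans (G.tgt_inv h).symm⟩ =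
      g := by
  rw [G.mul_assoc _ _ _ e (G.tgt_inv h).symm]
  exact (mul_congr rfl ((G.mul_inv h).trans (congrArg G.unit e.symm)) _ (G.tgt_unit _).symm).trans
    (G.mul_unit g)

theorem mul_left_cancel {p q : G.src.Pullback G.tgt} (h : p.1.1 = q.1.1)
    (hm : G.mul p = G.mul q) : p = q := by
  obtain ⟨⟨a, b⟩, e⟩ := p
  obtain ⟨⟨a', b'⟩, e'⟩ := q
  obtain rfl : a = a' := h
  have : b = b' := by
    rw [← inv_mul_cancel_left a b e, ← inv_mul_cancel_left a b' e']
    exact mul_congr rfl hm _ _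
  subst this
  rfl

theorem mul_right_cancel {p q : G.src.Pullback G.tgt} (h : p.1.2 = q.1.2)
    (hm : G.mul p = G.mul q) : p = q := by
  obtain ⟨⟨a, b⟩, e⟩ := p
  obtain ⟨⟨a', b'⟩, e'⟩ := q
  obtain rfl : b = b' := h
  have : a = a' := by
    rw [← mul_inv_cancel_right a b e, ← mul_inv_cancel_right a' b e']
    exact mul_congr hm rfl _ _
  subst this
  rfl

theorem eq_inv_of_mul_eq_unit {g h : G.Arrow} (e : G.src g = G.tgt h)
    (hm : G.mul ⟨(g, h), e⟩ = G.unit (G.src h)) : g = G.inv h := by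
  have := mul_right_cancel (p := ⟨(g, h), e⟩) (q := ⟨(G.inv h, h), G.src_inv h⟩) rfl
    (hm.trans (G.inv_mul h).symm)
  exact congrArg (fun p => p.1.1) this

theorem inv_unit (x : M) : G.inv (G.unit x) = G.unit x := by
  refine (eq_inv_of_mul_eq_unit ((G.src_unit x).trans (G.tgt_unit x).symm) ?_).symm
  refine (mul_congr rfl (congrArg G.unit (G.src_unit x).symm) _ (G.tgt_unit _).symm).trans
    ((G.mul_unit _).trans ?_)
  rw [G.src_unit]

theorem inv_inv (g : G.Arrow) : G.inv (G.inv g) = g := by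
  refine (eq_inv_of_mul_eq_unit (G.tgt_inv g).symm ?_).symm
  rw [G.mul_inv, G.src_inv]

theorem inv_mul_rev (g h : G.Arrow) (e : G.src g = G.tgt h) :
    G.inv (G.mul ⟨(g, h), e⟩) =
      G.mul ⟨(G.inv h, G.inv g), (G.src_inv h).trans (e.symm.trans (G.tgt_inv g).symm)⟩ := by
  have e' : G.src (G.inv h) = G.tgt (G.inv g) :=
    (G.src_inv h).trans (e.symm.trans (G.tgt_inv g).symm)
  have e'' : G.src (G.inv g) = G.tgt (G.mul ⟨(g, h), e⟩) :=
    (G.src_inv g).trans (G.tgt_mul ⟨(g, h), e⟩).symm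
  refine (eq_inv_of_mul_eq_unit ((G.src_mul ⟨(G.inv h, G.inv g), e'⟩).trans e'') ?_).symm
  rw [G.mul_assoc _ _ _ e' e'', G.src_mul]
  exact (mul_congr rfl (inv_mul_cancel_left g h e) _ (G.src_inv h)).trans (G.inv_mul h)

end Groupoid

/-- The set of the products of composable elements of `U` and `V`. -/
def setMul (U V : Set G.Arrow) : Set G.Arrow :=
  G.mul '' {p | p.1.1 ∈ U ∧ p.1.2 ∈ V}

variable {G} in
theorem isOpen_setMul {U V : Set G.Arrow} (hU : IsOpen U) (hV : IsOpen V) :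
    IsOpen (G.setMul U V) :=
  G.mul_isLocalHomeomorph.isOpenMap _ (isOpen_pullback_prod _ _ hU hV)

variable {G} in
theorem mem_setMul {U V : Set G.Arrow} {g h : G.Arrow} (hg : g ∈ U) (hh : h ∈ V)
    (e : G.src g = G.tgt h) : G.mul ⟨(g, h), e⟩ ∈ G.setMul U V :=
  ⟨_, ⟨hg, hh⟩, rfl⟩

variable {G} in
-- The target of `gh` is that of `g`, so `gh` determines `g` within `U`, and then `h` by
-- cancellation.
theorem injOn_mul {U V : Set G.Arrow} (hU : Set.InjOn G.tgt U) :
    Set.InjOn G.mul {p | p.1.1 ∈ U ∧ p.1.2 ∈ V} := by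
  intro p hp q hq h
  refine mul_left_cancel (hU hp.1 hq.1 ?_) h
  rw [← G.tgt_mul, h, G.tgt_mul]

variable {G} in
theorem injOn_tgt_setMul {U V : Set G.Arrow} (hU : Set.InjOn G.tgt U) (hV : Set.InjOn G.tgt V) :
    Set.InjOn G.tgt (G.setMul U V) := by
  rintro _ ⟨⟨⟨g, h⟩, e⟩, hp, rfl⟩ _ ⟨⟨⟨g', h'⟩, e'⟩, hq, rfl⟩ H
  rw [G.tgt_mul, G.tgt_mul] at H
  obtain rfl : g = g' := hU hp.1 hq.1 H
  obtain rfl : h = h' := hV hp.2 hq.2 (e.symm.trans e')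
  rfl

variable {G} in
theorem injOn_src_setMul {U V : Set G.Arrow} (hU : Set.InjOn G.src U) (hV : Set.InjOn G.src V) :
    Set.InjOn G.src (G.setMul U V) := by
  rintro _ ⟨⟨⟨g, h⟩, e⟩, hp, rfl⟩ _ ⟨⟨⟨g', h'⟩, e'⟩, hq, rfl⟩ H
  rw [G.src_mul, G.src_mul] at H
  obtain rfl : h = h' := hV hp.2 hq.2 H
  obtain rfl : g = g' := hU hp.1 hq.1 (e.trans e'.symm)
  rfl

variable {𝕜 : Type z} [RCLike 𝕜]

/-- The convolution product of sections of germs. -/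
def conv (u v : GermSection 𝕜 G.Arrow) : GermSection 𝕜 G.Arrow :=
  pushforward G.mul_isLocalHomeomorph (extProd 𝕜 G.src G.tgt u v)

variable {G} in
-- Each arrow of `UV` factors uniquely through `U` and `V`, so the convolution sum has a single
-- term.
theorem conv_zeroExt {U V : Set G.Arrow} (hU : IsOpen U) (hV : IsOpen V)
    (hinj : Set.InjOn G.tgt U) {f g F : G.Arrow → 𝕜}
    (hF : ∀ a b e, a ∈ U → b ∈ V → F (G.mul ⟨(a, b), e⟩) = f a * g b) :
    G.conv (zeroExt U f) (zeroExt V g) = zeroExt (G.setMul U V) F := by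
  rw [conv, extProd_zeroExt, pushforward_zeroExt G.mul_isLocalHomeomorph
    (isOpen_pullback_prod _ _ hU hV) (injOn_mul hinj) (F := F), setMul]
  rintro ⟨⟨a, b⟩, e⟩ h
  exact hF a b e h.1 h.2

theorem setMul_unit (V : Set G.Arrow) : G.setMul (Set.range G.unit) V = V := by
  ext g
  constructor
  · rintro ⟨⟨⟨_, h⟩, e⟩, ⟨⟨x, rfl⟩, hh⟩, rfl⟩
    have e' : G.src (G.unit x) = G.tgt h := e
    rw [mul_congr (congrArg G.unit ((G.src_unit x).symm.trans e')) rfl e (G.src_unit _),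
      G.unit_mul]
    exact hh
  · intro hg
    exact ⟨⟨(G.unit (G.tgt g), g), G.src_unit _⟩, ⟨⟨_, rfl⟩, hg⟩, G.unit_mul g⟩

theorem unit_setMul (V : Set G.Arrow) : G.setMul V (Set.range G.unit) = V := by
  ext g
  constructor
  · rintro ⟨⟨⟨h, _⟩, e⟩, ⟨hh, ⟨x, rfl⟩⟩, rfl⟩
    have e' : G.src h = G.tgt (G.unit x) := e
    rw [mul_congr rfl (congrArg G.unit ((G.tgt_unit x).symm.trans e'.symm)) e
      (G.tgt_unit _).symm, G.mul_unit]
    exact hh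
  · intro hg
    exact ⟨⟨(g, G.unit (G.src g)), (G.tgt_unit _).symm⟩, ⟨hg, ⟨_, rfl⟩⟩, G.mul_unit g⟩

theorem setMul_assoc (U V W : Set G.Arrow) :
    G.setMul (G.setMul U V) W = G.setMul U (G.setMul V W) := by
  ext g
  constructor
  · rintro ⟨⟨⟨_, c⟩, e⟩, ⟨⟨⟨⟨a, b⟩, e'⟩, ⟨ha, hb⟩, rfl⟩, hc⟩, rfl⟩
    have e'' : G.src b = G.tgt c := (G.src_mul _).symm.trans e
    rw [G.mul_assoc a b c e' e'']
    exact mem_setMul ha (mem_setMul hb hc e'') _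
  · rintro ⟨⟨⟨a, _⟩, e⟩, ⟨ha, ⟨⟨⟨b, c⟩, e'⟩, ⟨hb, hc⟩, rfl⟩⟩, rfl⟩
    have e'' : G.src a = G.tgt b := e.trans (G.tgt_mul _)
    rw [← G.mul_assoc a b c e'' e']
    exact mem_setMul (mem_setMul ha hb e'') hc _

theorem isOpen_range_unit : IsOpen (Set.range G.unit) := by
  rw [← Set.image_univ]
  exact G.unit_isLocalHomeomorph.isOpenMap _ isOpen_univ

theorem injOn_tgt_range_unit : Set.InjOn G.tgt (Set.range G.unit) := by
  rintro _ ⟨x, rfl⟩ _ ⟨y, rfl⟩ h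
  rw [G.tgt_unit, G.tgt_unit] at h
  rw [h]

theorem injOn_src_range_unit : Set.InjOn G.src (Set.range G.unit) := by
  rintro _ ⟨x, rfl⟩ _ ⟨y, rfl⟩ h
  rw [G.src_unit, G.src_unit] at h
  rw [h]

theorem injective_unit : Function.Injective G.unit := fun x y h => by
  rw [← G.src_unit x, h, G.src_unit]

theorem pushforward_unit_zeroExt (p : M → 𝕜) :
    pushforward G.unit_isLocalHomeomorph (zeroExt Set.univ p) =
      zeroExt (Set.range G.unit) (p ∘ G.tgt) := by
  rw [pushforward_zeroExt G.unit_isLocalHomeomorph isOpen_univ G.injective_unit.injOn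
    (F := p ∘ G.tgt) fun x _ => congrArg p (G.tgt_unit x), Set.image_univ]

theorem src_unit_eq_tgt {g : G.Arrow} (hg : g ∈ Set.range G.unit) : G.src g = G.tgt g := by
  obtain ⟨x, rfl⟩ := hg
  rw [G.src_unit, G.tgt_unit]

variable {G} in
-- The only unit composable with `g` on the left sits at `t(g)`, so the left action is
-- multiplication by `p ∘ t`; on the right the unit sits at `s(g)` and the factor is `p ∘ s`.
theorem conv_unit_left {V : Set G.Arrow} (hV : IsOpen V) (p : M → 𝕜) (f : G.Arrow → 𝕜) :
    G.conv (zeroExt (Set.range G.unit) (p ∘ G.tgt)) (zeroExt V f) =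
      zeroExt V ((p ∘ G.tgt) * f) := by
  rw [conv_zeroExt (F := (p ∘ G.tgt) * f) G.isOpen_range_unit hV G.injOn_tgt_range_unit,
    setMul_unit]
  rintro a b e ⟨x, rfl⟩ -
  have e' : G.src (G.unit x) = G.tgt b := e
  rw [mul_congr (congrArg G.unit ((G.src_unit x).symm.trans e')) rfl e (G.src_unit _),
      G.unit_mul, Pi.mul_apply, Function.comp_apply, Function.comp_apply, ← e',
      G.src_unit_eq_tgt ⟨x, rfl⟩]

variable {G} in
theorem conv_unit_right {V : Set G.Arrow} (hV : IsOpen V) (hinj : Set.InjOn G.tgt V) (p : M → 𝕜)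
    (f : G.Arrow → 𝕜) :
    G.conv (zeroExt V f) (zeroExt (Set.range G.unit) (p ∘ G.tgt)) =
      zeroExt V (f * (p ∘ G.src)) := by
  rw [conv_zeroExt (F := f * (p ∘ G.src)) hV G.isOpen_range_unit hinj, unit_setMul]
  rintro a b e - ⟨x, rfl⟩
  have e' : G.src a = G.tgt (G.unit x) := e
  rw [mul_congr rfl (congrArg G.unit ((G.tgt_unit x).symm.trans e'.symm)) e
      (G.tgt_unit _).symm, G.mul_unit, Pi.mul_apply, Function.comp_apply, Function.comp_apply, e']

end EtGrpd

/-! ### Sheets and the convolution algebra -/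

namespace EtGrpd

variable {E : Type v} [NormedAddCommGroup E] [NormedSpace ℝ E] [FiniteDimensional ℝ E]
  {M : Type w} [TopologicalSpace M] [T2Space M] [ChartedSpace E M] [IsManifold 𝓘(ℝ, E) ∞ M]
  (G : EtGrpd.{u} E M) (𝕜 : Type z) [RCLike 𝕜]

/-- A smooth function with compact support on an open subset of `G` on which the source and the
target maps are injective. -/
structure Sheet where
  dom : Set G.Arrow
  fn : G.Arrow → 𝕜
  isOpen : IsOpen dom
  injOn_src : Set.InjOn G.src dom
  injOn_tgt : Set.InjOn G.tgt dom
  smooth : SmoothCompactlySupportedOn E dom fn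

variable {G 𝕜}

theorem t2Space_of_injOn_tgt {V : Set G.Arrow} (h : Set.InjOn G.tgt V) : T2Space V :=
  T2Space.of_injective_continuous (f := V.domRestrict G.tgt) (Set.injOn_iff_injective.1 h)
    (G.tgt_isLocalHomeomorph.continuous.comp continuous_subtype_val)

theorem Sheet.t2Space (a : Sheet G 𝕜) : T2Space a.dom := t2Space_of_injOn_tgt a.injOn_tgt

/-- The element of `C_c^∞(G)` defined by a function on a small open set. -/
def Sheet.toCc (a : Sheet G 𝕜) : Cc 𝕜 E G.Arrow :=
  ⟨zeroExt a.dom a.fn, zeroExt_mem_Cc a.isOpen a.t2Space a.smooth⟩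

theorem Sheet.coe_toCc (a : Sheet G 𝕜) :
    (a.toCc : GermSection 𝕜 G.Arrow) = zeroExt a.dom a.fn := rfl

theorem Sheet.toCc_congr {a b : Sheet G 𝕜} (h : a.dom = b.dom) (h' : ∀ x ∈ a.dom, a.fn x = b.fn x) :
    a.toCc = b.toCc :=
  Subtype.ext (zeroExt_congr a.isOpen h h')

theorem sheet_induction {motive : Cc 𝕜 E G.Arrow → Prop} (basic : ∀ a : Sheet G 𝕜, motive a.toCc)
    (zero : motive 0) (add : ∀ a b, motive a → motive b → motive (a + b))
    (u : Cc 𝕜 E G.Arrow) : motive u := by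
  have := Cc_induction (motive := fun u => ∃ h : u ∈ Cc 𝕜 E G.Arrow, motive ⟨u, h⟩)
    ((isLocalProperty_injOn G.src_isLocalHomeomorph).and
      (isLocalProperty_injOn G.tgt_isLocalHomeomorph))
    (fun V f hV hV2 hP hf => ⟨zeroExt_mem_Cc hV hV2 hf, basic ⟨V, f, hV, hP.1, hP.2, hf⟩⟩)
    ⟨zero_mem _, zero⟩ (fun a _ b _ ⟨ha, h⟩ ⟨hb, h'⟩ => ⟨add_mem ha hb, add _ _ h h'⟩) u.2
  exact this.2

/-- With `p` the descent of `a` along the target and `q` that of `b` along the source, the product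
is `(p ∘ t)(q ∘ s)`, because `t(xy) = t(x)` and `s(xy) = s(y)`. Smoothness is then immediate, with
no recourse to the manifold structure of the fibred product. -/
theorem exists_conv (a b : Sheet G 𝕜) : ∃ F : G.Arrow → 𝕜,
    (∀ x y e, x ∈ a.dom → y ∈ b.dom → F (G.mul ⟨(x, y), e⟩) = a.fn x * b.fn y) ∧
      SmoothCompactlySupportedOn E (G.setMul a.dom b.dom) F := by
  obtain ⟨p, hp, hp'⟩ := exists_descent G.tgt_isLocalHomeomorph
    G.tgt_isLocalDiffeomorph.hasSmoothLocalInverses a.isOpen a.injOn_tgt a.smooth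
  obtain ⟨q, hq, hq'⟩ := exists_descent G.src_isLocalHomeomorph
    G.src_isLocalDiffeomorph.hasSmoothLocalInverses b.isOpen b.injOn_src b.smooth
  obtain ⟨-, K, hK, hKc, hK0⟩ := a.smooth
  obtain ⟨-, L, hL, hLc, hL0⟩ := b.smooth
  have hF : ∀ x y e, x ∈ a.dom → y ∈ b.dom →
      ((p ∘ G.tgt) * (q ∘ G.src)) (G.mul ⟨(x, y), e⟩) = a.fn x * b.fn y := by
    intro x y e hx hy
    rw [Pi.mul_apply, Function.comp_apply, Function.comp_apply, G.tgt_mul, G.src_mul, hp x hx,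
      hq y hy]
  refine ⟨(p ∘ G.tgt) * (q ∘ G.src), hF, ?_, G.mul '' {r | r.1.1 ∈ K ∧ r.1.2 ∈ L},
    Set.image_mono fun r hr => ⟨hK hr.1, hL hr.2⟩, ?_, ?_⟩
  · refine ContMDiffOn.rclike_mul ?_ ?_
    · refine hp'.1.comp G.tgt_isLocalDiffeomorph.contMDiff.contMDiffOn ?_
      rintro _ ⟨r, hr, rfl⟩
      exact ⟨r.1.1, hr.1, (G.tgt_mul r).symm⟩
    · refine hq'.1.comp G.src_isLocalDiffeomorph.contMDiff.contMDiffOn ?_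
      rintro _ ⟨r, hr, rfl⟩
      exact ⟨r.1.2, hr.2, (G.src_mul r).symm⟩
  · refine IsCompact.image ?_ G.mul_isLocalHomeomorph.continuous
    -- As `M` is Hausdorff, the composable pairs are closed in `G × G`, so those in `K × L` form a
    -- compact set.
    have h : Topology.IsClosedEmbedding
        (Subtype.val : G.src.Pullback G.tgt → G.Arrow × G.Arrow) :=
      IsClosed.isClosedEmbedding_subtypeVal
        (isClosed_eq (G.src_isLocalHomeomorph.continuous.comp continuous_fst)
          (G.tgt_isLocalHomeomorph.continuous.comp continuous_snd))
    exact h.isCompact_preimage (hKc.prod hLc)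
  · rintro _ ⟨⟨⟨x, y⟩, e⟩, ⟨hx, hy⟩, rfl⟩ hxy
    rw [hF x y e hx hy]
    by_cases hxK : x ∈ K
    · have hyL : y ∉ L := fun h => hxy ⟨_, ⟨hxK, h⟩, rfl⟩
      rw [hL0 y hy hyL, mul_zero]
    · rw [hK0 x hx hxK, zero_mul]

/-- The convolution product of functions with small supports. -/
def Sheet.mul (a b : Sheet G 𝕜) : Sheet G 𝕜 where
  dom := G.setMul a.dom b.dom
  fn := (exists_conv a b).choose
  isOpen := isOpen_setMul a.isOpen b.isOpen
  injOn_src := injOn_src_setMul a.injOn_src b.injOn_src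
  injOn_tgt := injOn_tgt_setMul a.injOn_tgt b.injOn_tgt
  smooth := (exists_conv a b).choose_spec.2

theorem Sheet.mul_fn (a b : Sheet G 𝕜) {x y : G.Arrow} (e : G.src x = G.tgt y) (hx : x ∈ a.dom)
    (hy : y ∈ b.dom) : (a.mul b).fn (G.mul ⟨(x, y), e⟩) = a.fn x * b.fn y :=
  (exists_conv a b).choose_spec.1 x y e hx hy

theorem conv_toCc (a b : Sheet G 𝕜) :
    G.conv (a.toCc : GermSection 𝕜 G.Arrow) b.toCc = (a.mul b).toCc :=
  conv_zeroExt a.isOpen b.isOpen a.injOn_tgt fun _ _ e hx hy => a.mul_fn b e hx hy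

theorem extProd_mem_fiberFinite (u v : Cc 𝕜 E G.Arrow) :
    extProd 𝕜 G.src G.tgt (u : GermSection 𝕜 G.Arrow) v ∈ fiberFinite 𝕜 G.mul := by
  refine sheet_induction (motive := fun u => extProd 𝕜 G.src G.tgt (u : GermSection 𝕜 G.Arrow)
    (v : GermSection 𝕜 G.Arrow) ∈ fiberFinite 𝕜 G.mul) (fun a => ?_) ?_ (fun a b ha hb => ?_) u
  · refine sheet_induction (motive := fun v => extProd 𝕜 G.src G.tgt
      (a.toCc : GermSection 𝕜 G.Arrow) (v : GermSection 𝕜 G.Arrow) ∈ fiberFinite 𝕜 G.mul)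
      (fun b => ?_) ?_ (fun b c hb hc => ?_) v
    · rw [Sheet.coe_toCc, Sheet.coe_toCc, extProd_zeroExt]
      exact zeroExt_mem_fiberFinite (injOn_mul a.injOn_tgt) _
    · rw [Submodule.coe_zero, map_zero]
      exact zero_mem _
    · rw [Submodule.coe_add, map_add]
      exact add_mem hb hc
  · rw [Submodule.coe_zero, map_zero]
    exact zero_mem _
  · rw [Submodule.coe_add, map_add]
    exact add_mem ha hb

theorem conv_add_left (u u' v : Cc 𝕜 E G.Arrow) :
    G.conv ((u + u' : Cc 𝕜 E G.Arrow) : GermSection 𝕜 G.Arrow) v = G.conv u v + G.conv u' v := by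
  rw [conv, Submodule.coe_add, map_add, LinearMap.add_apply,
    pushforward_add _ (extProd_mem_fiberFinite u v) (extProd_mem_fiberFinite u' v)]
  rfl

theorem conv_add_right (u v v' : Cc 𝕜 E G.Arrow) :
    G.conv (u : GermSection 𝕜 G.Arrow) ((v + v' : Cc 𝕜 E G.Arrow) : GermSection 𝕜 G.Arrow) =
      G.conv u v + G.conv u v' := by
  rw [conv, Submodule.coe_add, map_add,
    pushforward_add _ (extProd_mem_fiberFinite u v) (extProd_mem_fiberFinite u v')]
  rfl

theorem conv_smul_left (c : 𝕜) (u v : Cc 𝕜 E G.Arrow) :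
    G.conv ((c • u : Cc 𝕜 E G.Arrow) : GermSection 𝕜 G.Arrow) v = c • G.conv u v := by
  rw [conv, Submodule.coe_smul, map_smul, LinearMap.smul_apply,
    pushforward_smul _ _ (extProd_mem_fiberFinite u v)]
  rfl

theorem conv_smul_right (c : 𝕜) (u v : Cc 𝕜 E G.Arrow) :
    G.conv (u : GermSection 𝕜 G.Arrow) ((c • v : Cc 𝕜 E G.Arrow) : GermSection 𝕜 G.Arrow) =
      c • G.conv u v := by
  rw [conv, Submodule.coe_smul, map_smul, pushforward_smul _ _ (extProd_mem_fiberFinite u v)]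
  rfl

theorem conv_zero_left (v : GermSection 𝕜 G.Arrow) : G.conv 0 v = 0 := by
  rw [conv, map_zero, LinearMap.zero_apply, pushforward_zero]

theorem conv_zero_right (u : GermSection 𝕜 G.Arrow) : G.conv u 0 = 0 := by
  rw [conv, map_zero, pushforward_zero]

theorem conv_mem_Cc (u v : Cc 𝕜 E G.Arrow) :
    G.conv (u : GermSection 𝕜 G.Arrow) v ∈ Cc 𝕜 E G.Arrow := by
  induction u using sheet_induction with
  | zero => exact (conv_zero_left (v : GermSection 𝕜 G.Arrow)).symm ▸ zero_mem _
  | add u u' h h' => exact (conv_add_left u u' v).symm ▸ add_mem h h'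
  | basic a =>
    induction v using sheet_induction with
    | zero => exact (conv_zero_right (a.toCc : GermSection 𝕜 G.Arrow)).symm ▸ zero_mem _
    | add v v' h h' => exact (conv_add_right a.toCc v v').symm ▸ add_mem h h'
    | basic b => exact (conv_toCc a b).symm ▸ (a.mul b).toCc.2

variable (G 𝕜) in
/-- The convolution product on `C_c^∞(G)`. -/
def convCc : Cc 𝕜 E G.Arrow →ₗ[𝕜] Cc 𝕜 E G.Arrow →ₗ[𝕜] Cc 𝕜 E G.Arrow :=
  LinearMap.mk₂ 𝕜 (fun u v => ⟨G.conv (u : GermSection 𝕜 G.Arrow) v, conv_mem_Cc u v⟩)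
    (fun u u' v => Subtype.ext (conv_add_left u u' v))
    (fun c u v => Subtype.ext (conv_smul_left c u v))
    (fun u v v' => Subtype.ext (conv_add_right u v v'))
    (fun c u v => Subtype.ext (conv_smul_right c u v))

theorem coe_convCc (u v : Cc 𝕜 E G.Arrow) :
    (convCc G 𝕜 u v : GermSection 𝕜 G.Arrow) = G.conv (u : GermSection 𝕜 G.Arrow) v := rfl

theorem convCc_toCc (a b : Sheet G 𝕜) : convCc G 𝕜 a.toCc b.toCc = (a.mul b).toCc :=
  Subtype.ext (conv_toCc a b)

theorem Sheet.mul_assoc (a b c : Sheet G 𝕜) :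
    ((a.mul b).mul c).toCc = (a.mul (b.mul c)).toCc := by
  refine Sheet.toCc_congr (G.setMul_assoc _ _ _) ?_
  rintro _ ⟨⟨⟨_, z⟩, e⟩, ⟨⟨⟨⟨x, y⟩, e'⟩, ⟨hx, hy⟩, rfl⟩, hz⟩, rfl⟩
  have e'' : G.src y = G.tgt z := (G.src_mul _).symm.trans e
  have e₃ : G.src x = G.tgt (G.mul ⟨(y, z), e''⟩) :=
    e'.trans (G.tgt_mul ⟨(y, z), e''⟩).symm
  rw [Sheet.mul_fn _ _ e (mem_setMul hx hy e') hz, Sheet.mul_fn _ _ e' hx hy]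
  have h := G.mul_assoc x y z e' e''
  have h' := Sheet.mul_fn a (b.mul c) e₃ hx (mem_setMul hy hz e'')
  rw [Sheet.mul_fn _ _ e'' hy hz] at h'
  rw [h, h', _root_.mul_assoc]

theorem convCc_assoc (u v w : Cc 𝕜 E G.Arrow) :
    convCc G 𝕜 (convCc G 𝕜 u v) w = convCc G 𝕜 u (convCc G 𝕜 v w) := by
  induction u using sheet_induction with
  | zero => simp
  | add u u' h h' => simp only [map_add, LinearMap.add_apply, h, h']
  | basic a =>
    induction v using sheet_induction with
    | zero => simp
    | add u u' h h' => simp only [map_add, LinearMap.add_apply, h, h']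
    | basic b =>
      induction w using sheet_induction with
      | zero => simp
      | add u u' h h' => simp only [map_add, h, h']
      | basic c => simp only [convCc_toCc, Sheet.mul_assoc]

variable (G 𝕜) in
/-- The embedding of `C_c^∞(M)` into `C_c^∞(G)`. -/
def inclCc : CcAlg 𝕜 E M →ₗ[𝕜] Cc 𝕜 E G.Arrow :=
  pushCc G.unit_isLocalHomeomorph G.unit_isLocalDiffeomorph.hasSmoothLocalInverses ∘ₗ
    (LinearMap.id : Cc 𝕜 E M →ₗ[𝕜] Cc 𝕜 E M)

theorem coe_inclCc (r : CcAlg 𝕜 E M) : (inclCc G 𝕜 r : GermSection 𝕜 G.Arrow) =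
    pushforward G.unit_isLocalHomeomorph (r : GermSection 𝕜 M) := rfl

/-- The element of the algebra `C_c^∞(M)` defined by a function on `M`. -/
def ofFun (p : M → 𝕜) (hp : SmoothCompactlySupportedOn E Set.univ p) : CcAlg 𝕜 E M :=
  ⟨zeroExt Set.univ p, zeroExt_mem_Cc isOpen_univ inferInstance hp⟩

theorem exists_ofFun (r : CcAlg 𝕜 E M) :
    ∃ (p : M → 𝕜) (hp : SmoothCompactlySupportedOn E Set.univ p), r = ofFun p hp := by
  obtain ⟨p, hp, h⟩ := exists_eq_zeroExt_univ r.2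
  exact ⟨p, hp, Subtype.ext h⟩

theorem coe_inclCc_ofFun (p : M → 𝕜) (hp : SmoothCompactlySupportedOn E Set.univ p) :
    (inclCc G 𝕜 (ofFun p hp) : GermSection 𝕜 G.Arrow) =
      zeroExt (Set.range G.unit) (p ∘ G.tgt) :=
  G.pushforward_unit_zeroExt p

theorem ofFun_mul (p q : M → 𝕜) (hp : SmoothCompactlySupportedOn E Set.univ p)
    (hq : SmoothCompactlySupportedOn E Set.univ q) :
    ofFun p hp * ofFun q hq = ofFun (p * q) (hq.mul_left hp.1) := by
  refine Subtype.ext ((zeroExt_mul_zeroExt _ _ _ _).trans ?_)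
  rw [Set.univ_inter]
  rfl

/-- The product of a function with small support by a function on `M` (on the left). -/
def Sheet.lact (p : M → 𝕜) (hp : ContMDiffOn 𝓘(ℝ, E) 𝓘(ℝ, 𝕜) ∞ p Set.univ)
    (a : Sheet G 𝕜) : Sheet G 𝕜 :=
  { a with
    fn := (p ∘ G.tgt) * a.fn
    smooth := a.smooth.mul_left
      (hp.comp G.tgt_isLocalDiffeomorph.contMDiff.contMDiffOn fun _ _ => trivial) }

/-- The product of a function with small support by a function on `M` (on the right). -/
def Sheet.ract (p : M → 𝕜) (hp : ContMDiffOn 𝓘(ℝ, E) 𝓘(ℝ, 𝕜) ∞ p Set.univ)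
    (a : Sheet G 𝕜) : Sheet G 𝕜 :=
  { a with
    fn := (p ∘ G.src) * a.fn
    smooth := a.smooth.mul_left
      (hp.comp G.src_isLocalDiffeomorph.contMDiff.contMDiffOn fun _ _ => trivial) }

theorem incl_mul_toCc (p : M → 𝕜) (hp : SmoothCompactlySupportedOn E Set.univ p)
    (a : Sheet G 𝕜) : convCc G 𝕜 (inclCc G 𝕜 (ofFun p hp)) a.toCc = (a.lact p hp.1).toCc := by
  refine Subtype.ext ?_
  rw [coe_convCc, coe_inclCc_ofFun, Sheet.coe_toCc, conv_unit_left a.isOpen]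
  rfl

theorem toCc_mul_incl (p : M → 𝕜) (hp : SmoothCompactlySupportedOn E Set.univ p)
    (a : Sheet G 𝕜) : convCc G 𝕜 a.toCc (inclCc G 𝕜 (ofFun p hp)) = (a.ract p hp.1).toCc := by
  refine Subtype.ext ?_
  rw [coe_convCc, coe_inclCc_ofFun, Sheet.coe_toCc, conv_unit_right a.isOpen a.injOn_tgt, mul_comm]
  rfl

theorem inclCc_mul (r s : CcAlg 𝕜 E M) :
    inclCc G 𝕜 (r * s) = convCc G 𝕜 (inclCc G 𝕜 r) (inclCc G 𝕜 s) := by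
  obtain ⟨p, hp, rfl⟩ := exists_ofFun r
  obtain ⟨q, hq, rfl⟩ := exists_ofFun s
  refine Subtype.ext ?_
  rw [ofFun_mul, coe_convCc, coe_inclCc_ofFun, coe_inclCc_ofFun, coe_inclCc_ofFun,
    conv_unit_left G.isOpen_range_unit]
  rfl

variable (G 𝕜) in
/-- The counit `t_+`. -/
def counitCc : Cc 𝕜 E G.Arrow →ₗ[𝕜] CcAlg 𝕜 E M :=
  (LinearMap.id : Cc 𝕜 E M →ₗ[𝕜] Cc 𝕜 E M) ∘ₗ
    pushCc G.tgt_isLocalHomeomorph G.tgt_isLocalDiffeomorph.hasSmoothLocalInverses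

theorem coe_counitCc (u : Cc 𝕜 E G.Arrow) : (counitCc G 𝕜 u : GermSection 𝕜 M) =
    pushforward G.tgt_isLocalHomeomorph (u : GermSection 𝕜 G.Arrow) := rfl

/-- Functoriality applied to `t ∘ uni = id`. It also supplies the injectivity of the inclusion. -/
theorem counitCc_inclCc (r : CcAlg 𝕜 E M) : counitCc G 𝕜 (inclCc G 𝕜 r) = r := by
  refine Subtype.ext ?_
  have hid : IsLocalHomeomorph (id : M → M) := (Homeomorph.refl M).isLocalHomeomorph
  rw [coe_counitCc, coe_inclCc, pushforward_comp _
    G.unit_isLocalDiffeomorph.hasSmoothLocalInverses _ hid G.tgt_unit r.2]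
  exact pushforward_id hid (fun _ => rfl) _ r.2

/-- Asking that every `p` equal to `1` on `C` be an identity makes the condition stable under
enlarging `C`, so sums and finite families only require unions of compact sets. -/
theorem exists_isCompact_local_identity (u : Cc 𝕜 E G.Arrow) :
    ∃ C : Set M, IsCompact C ∧ ∀ (p : M → 𝕜) (hp : SmoothCompactlySupportedOn E Set.univ p),
      (∀ y ∈ C, p y = 1) → convCc G 𝕜 u (inclCc G 𝕜 (ofFun p hp)) = u ∧
        convCc G 𝕜 (inclCc G 𝕜 (ofFun p hp)) u = u := by
  induction u using sheet_induction with
  | zero => exact ⟨∅, isCompact_empty, fun p hp _ => by simp⟩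
  | add u u' h h' =>
    obtain ⟨C, hC, h⟩ := h
    obtain ⟨C', hC', h'⟩ := h'
    refine ⟨C ∪ C', hC.union hC', fun p hp hpC => ?_⟩
    have h1 := h p hp fun y hy => hpC y (Or.inl hy)
    have h2 := h' p hp fun y hy => hpC y (Or.inr hy)
    simp only [map_add, LinearMap.add_apply, h1.1, h1.2, h2.1, h2.2, and_self]
  | basic a =>
    obtain ⟨-, K, hKa, hK, h0⟩ := a.smooth
    refine ⟨G.src '' K ∪ G.tgt '' K, (hK.image G.src_isLocalHomeomorph.continuous).union
      (hK.image G.tgt_isLocalHomeomorph.continuous), fun p hp hpC => ?_⟩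
    rw [incl_mul_toCc, toCc_mul_incl]
    constructor
    · refine Sheet.toCc_congr rfl fun x hx => ?_
      change p (G.src x) * a.fn x = a.fn x
      by_cases hxK : x ∈ K
      · rw [hpC _ (Or.inl ⟨x, hxK, rfl⟩), one_mul]
      · rw [h0 x hx hxK, mul_zero]
    · refine Sheet.toCc_congr rfl fun x hx => ?_
      change p (G.tgt x) * a.fn x = a.fn x
      by_cases hxK : x ∈ K
      · rw [hpC _ (Or.inr ⟨x, hxK, rfl⟩), one_mul]
      · rw [h0 x hx hxK, mul_zero]

theorem exists_isCompact_local_identity_finset (s : Finset (Cc 𝕜 E G.Arrow)) :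
    ∃ C : Set M, IsCompact C ∧ ∀ (p : M → 𝕜) (hp : SmoothCompactlySupportedOn E Set.univ p),
      (∀ y ∈ C, p y = 1) → ∀ u ∈ s, convCc G 𝕜 u (inclCc G 𝕜 (ofFun p hp)) = u ∧
        convCc G 𝕜 (inclCc G 𝕜 (ofFun p hp)) u = u := by
  choose C hC h using exists_isCompact_local_identity (G := G) (𝕜 := 𝕜)
  exact ⟨⋃ u ∈ s, C u, s.isCompact_biUnion fun u _ => hC u, fun p hp hpC u hu =>
    h u p hp fun y hy => hpC y (Set.mem_biUnion hu hy)⟩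

variable (G 𝕜) in
/-- The convolution algebra of smooth functions with compact support on `G`. -/
def convAlgebra : AlgebraOver 𝕜 (CcAlg 𝕜 E M) (Cc 𝕜 E G.Arrow) where
  mul := convCc G 𝕜
  mul_assoc := convCc_assoc
  incl := inclCc G 𝕜
  incl_mul := inclCc_mul
  incl_injective := Function.LeftInverse.injective counitCc_inclCc
  local_identities s := by
    obtain ⟨C, hC, h⟩ := exists_isCompact_local_identity_finset s
    obtain ⟨p, hp, W, -, -, hCW, hW⟩ := exists_smooth_eq_one_of_isCompact (E := E) 𝕜 isOpen_univ
      inferInstance hC (Set.subset_univ C)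
    exact ⟨ofFun p hp, h p hp fun y hy => hW y (hCW hy)⟩

theorem lact_toCc (p : M → 𝕜) (hp : SmoothCompactlySupportedOn E Set.univ p)
    (a : Sheet G 𝕜) : (convAlgebra G 𝕜).lact (ofFun p hp) a.toCc = (a.lact p hp.1).toCc :=
  incl_mul_toCc p hp a

theorem ract_toCc (p : M → 𝕜) (hp : SmoothCompactlySupportedOn E Set.univ p)
    (a : Sheet G 𝕜) : (convAlgebra G 𝕜).ract (ofFun p hp) a.toCc = (a.ract p hp.1).toCc :=
  toCc_mul_incl p hp a

end EtGrpd

/-! ### The left action on the balanced tensor product -/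

namespace AlgebraOver

variable {𝕜 : Type*} [Field 𝕜] {R : Type*} [NonUnitalCommRing R] [Module 𝕜 R]
  [IsScalarTower 𝕜 R R] [SMulCommClass 𝕜 R R] {A : Type*} [AddCommGroup A] [Module 𝕜 A]
  (X : AlgebraOver 𝕜 R A)

theorem lactLL_mk (r : R) (a b : A) :
    X.lactLL r (X.mkLL (a ⊗ₜ[𝕜] b)) = X.mkLL (X.lact r a ⊗ₜ[𝕜] b) := by
  simp [lactLL]

theorem lactLL_mul (r s : R) (x : X.LL) : X.lactLL (r * s) x = X.lactLL r (X.lactLL s x) := by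
  have h : X.lactLL (r * s) = X.lactLL r ∘ₗ X.lactLL s :=
    hom_ext_LL fun a b => by simp [lactLL_mk, lact_mul]
  exact LinearMap.congr_fun h x

theorem lactLL_add (r s : R) (x : X.LL) : X.lactLL (r + s) x = X.lactLL r x + X.lactLL s x := by
  have h : X.lactLL (r + s) = X.lactLL r + X.lactLL s :=
    hom_ext_LL fun a b => by simp [lactLL_mk, TensorProduct.add_tmul]
  exact LinearMap.congr_fun h x

theorem lactLL_sub (r s : R) (x : X.LL) : X.lactLL (r - s) x = X.lactLL r x - X.lactLL s x := by
  have h : X.lactLL (r - s) = X.lactLL r - X.lactLL s :=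
    hom_ext_LL fun a b => by simp [lactLL_mk, TensorProduct.sub_tmul]
  exact LinearMap.congr_fun h x

theorem lactLL_zero (x : X.LL) : X.lactLL 0 x = 0 := by
  rw [← sub_self (0 : R), lactLL_sub, sub_self]

/-- Lets a product of two cut-offs be distributed, one to each tensor factor. -/
theorem lactLL_mul_mk (r s : R) (a b : A) :
    X.lactLL (r * s) (X.mkLL (a ⊗ₜ[𝕜] b)) = X.mkLL (X.lact r a ⊗ₜ[𝕜] X.lact s b) := by
  rw [lactLL_mul, lactLL_mk, mkLL_lact, lactLL_mk]

theorem mkLL_lact_mul_tmul (r s : R) (a b : A) :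
    X.mkLL (X.lact (r * s) a ⊗ₜ[𝕜] b) = X.mkLL (X.lact r a ⊗ₜ[𝕜] X.lact s b) := by
  rw [← lactLL_mul_mk, lactLL_mk]

theorem induction_LL {motive : X.LL → Prop} (zero : motive 0)
    (tmul : ∀ a b, motive (X.mkLL (a ⊗ₜ[𝕜] b)))
    (add : ∀ x y, motive x → motive y → motive (x + y)) (x : X.LL) : motive x := by
  obtain ⟨x, rfl⟩ := X.relLL.mkQ_surjective x
  induction x using TensorProduct.induction_on with
  | zero => rwa [map_zero]
  | tmul a b => exact tmul a b
  | add x y hx hy => rw [map_add]; exact add _ _ hx hy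

end AlgebraOver

section Germs

variable {𝕜 : Type z} [RCLike 𝕜] {X : Type u} [TopologicalSpace X]

theorem zeroExt_eq_of_eventually {U V : Set X} (hVU : V ⊆ U) {f : X → 𝕜}
    (hf : ∀ x ∈ U, x ∉ V → ∀ᶠ y in 𝓝 x, f y = 0) : zeroExt U f = zeroExt V f := by
  funext x
  by_cases hV : x ∈ V
  · rw [zeroExt_of_mem hV, zeroExt_of_mem (hVU hV)]
  · rw [zeroExt_of_notMem hV]
    by_cases hx : x ∈ U
    · rw [zeroExt_of_mem hx, ← Germ.coe_zero, Germ.coe_eq]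
      exact hf x hx hV
    · rw [zeroExt_of_notMem hx]

theorem eventually_of_coe_germ_eq {x : X} {f g : X → 𝕜}
    (h : (f : Germ (𝓝 x) 𝕜) = (g : Germ (𝓝 x) 𝕜)) : ∀ᶠ y in 𝓝 x, f y = g y :=
  Germ.coe_eq.1 h

end Germs

/-! ### Injectivity of `Ω_{t,t}` by localisation over `M` -/

namespace EtGrpd

variable {E : Type v} [NormedAddCommGroup E] [NormedSpace ℝ E] [FiniteDimensional ℝ E]
  {M : Type w} [TopologicalSpace M] [T2Space M] [ChartedSpace E M] [IsManifold 𝓘(ℝ, E) ∞ M]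
  {G : EtGrpd.{u} E M} {𝕜 : Type z} [RCLike 𝕜]

section Omega

theorem sheet_induction₂ {motive : Cc 𝕜 E G.Arrow → Cc 𝕜 E G.Arrow → Prop}
    (basic : ∀ a b : Sheet G 𝕜, motive a.toCc b.toCc)
    (zero_left : ∀ b, motive 0 b) (zero_right : ∀ a, motive a 0)
    (add_left : ∀ a a' b, motive a b → motive a' b → motive (a + a') b)
    (add_right : ∀ a b b', motive a b → motive a b' → motive a (b + b'))
    (u v : Cc 𝕜 E G.Arrow) : motive u v := by
  induction u using sheet_induction with
  | zero => exact zero_left v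
  | add u u' h h' => exact add_left _ _ _ h h'
  | basic a =>
    induction v using sheet_induction with
    | zero => exact zero_right _
    | add u u' h h' => exact add_right _ _ _ h h'
    | basic b => exact basic a b

/-- On the fibred product `t(x) = t(y)`, so the factor `p ∘ t` may sit on either side. -/
theorem extProd_lact (r : CcAlg 𝕜 E M) (u v : Cc 𝕜 E G.Arrow) :
    extProd 𝕜 G.tgt G.tgt ((convAlgebra G 𝕜).lact r u : GermSection 𝕜 G.Arrow) v =
      extProd 𝕜 G.tgt G.tgt (u : GermSection 𝕜 G.Arrow) ((convAlgebra G 𝕜).lact r v) := by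
  obtain ⟨p, hp, rfl⟩ := exists_ofFun r
  induction u, v using sheet_induction₂ with
  | zero_left b => simp
  | zero_right b => simp
  | add_left a a' b h h' => simp only [map_add, Submodule.coe_add, LinearMap.add_apply, h, h']
  | add_right a b b' h h' => simp only [map_add, Submodule.coe_add, h, h']
  | basic a b =>
    rw [lact_toCc, lact_toCc]
    simp only [Sheet.coe_toCc, extProd_zeroExt]
    refine zeroExt_congr (isOpen_pullback_prod _ _ a.isOpen b.isOpen) rfl fun q _ => ?_
    change p (G.tgt q.1.1) * a.fn q.1.1 * b.fn q.1.2 = a.fn q.1.1 * (p (G.tgt q.1.2) * b.fn q.1.2)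
    rw [q.2]
    ring

variable (G 𝕜) in
/-- The map `Ω_{t,t}` on the tensor product over `C_c^∞(M)`. -/
def omega : (convAlgebra G 𝕜).LL →ₗ[𝕜] GermSection 𝕜 (G.tgt.Pullback G.tgt) :=
  (convAlgebra G 𝕜).liftLL ((extProd 𝕜 G.tgt G.tgt).domRestrict₁₂ (Cc 𝕜 E G.Arrow)
    (Cc 𝕜 E G.Arrow)) extProd_lact

theorem omega_tmul (u v : Cc 𝕜 E G.Arrow) : omega G 𝕜 ((convAlgebra G 𝕜).mkLL (u ⊗ₜ[𝕜] v)) =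
    extProd 𝕜 G.tgt G.tgt (u : GermSection 𝕜 G.Arrow) v := by
  exact AlgebraOver.liftLL_mk _ _ _ u v

theorem omega_mkLL (x : Cc 𝕜 E G.Arrow ⊗[𝕜] Cc 𝕜 E G.Arrow) :
    omega G 𝕜 ((convAlgebra G 𝕜).mkLL x) = extProdTensor 𝕜 E G.tgt G.tgt x := by
  have h : omega G 𝕜 ∘ₗ (convAlgebra G 𝕜).mkLL = extProdTensor 𝕜 E G.tgt G.tgt :=
    TensorProduct.ext' fun u v => (omega_tmul u v).trans rfl
  exact LinearMap.congr_fun h x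

theorem omega_toCc (a b : Sheet G 𝕜) :
    omega G 𝕜 ((convAlgebra G 𝕜).mkLL (a.toCc ⊗ₜ[𝕜] b.toCc)) =
      zeroExt {q : G.tgt.Pullback G.tgt | q.1.1 ∈ a.dom ∧ q.1.2 ∈ b.dom}
        (fun q => a.fn q.1.1 * b.fn q.1.2) := by
  rw [omega_tmul]
  exact extProd_zeroExt _ _ _ _ _ _

theorem LL_sheet_induction {motive : (convAlgebra G 𝕜).LL → Prop} (zero : motive 0)
    (basic : ∀ a b : Sheet G 𝕜, motive ((convAlgebra G 𝕜).mkLL (a.toCc ⊗ₜ[𝕜] b.toCc)))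
    (add : ∀ x y, motive x → motive y → motive (x + y)) (x : (convAlgebra G 𝕜).LL) :
    motive x := by
  induction x using AlgebraOver.induction_LL with
  | zero => exact zero
  | add x y hx hy => exact add x y hx hy
  | tmul u v =>
    induction u, v using sheet_induction₂ with
    | zero_left b => rwa [TensorProduct.zero_tmul, map_zero]
    | zero_right b => rwa [TensorProduct.tmul_zero, map_zero]
    | add_left a a' b h h' => rw [TensorProduct.add_tmul, map_add]; exact add _ _ h h'
    | add_right a b b' h h' => rw [TensorProduct.tmul_add, map_add]; exact add _ _ h h'
    | basic a b => exact basic a b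

theorem omega_lactLL (p : M → 𝕜) (hp : SmoothCompactlySupportedOn E Set.univ p)
    (x : (convAlgebra G 𝕜).LL) (q : G.tgt.Pullback G.tgt)
    (h : ∀ᶠ y in 𝓝 (G.tgt q.1.1), p y = 1) :
    omega G 𝕜 ((convAlgebra G 𝕜).lactLL (ofFun p hp) x) q = omega G 𝕜 x q := by
  induction x using LL_sheet_induction with
  | zero => simp
  | add x y hx hy => simp only [map_add, Pi.add_apply, hx, hy]
  | basic a b =>
    rw [AlgebraOver.lactLL_mk, lact_toCc, omega_toCc, omega_toCc]
    by_cases hq : q.1.1 ∈ a.dom ∧ q.1.2 ∈ b.dom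
    · rw [zeroExt_of_mem (by exact hq), zeroExt_of_mem (by exact hq), Germ.coe_eq]
      have hc : Tendsto (fun q' : G.tgt.Pullback G.tgt => G.tgt q'.1.1) (𝓝 q)
          (𝓝 (G.tgt q.1.1)) :=
        (G.tgt_isLocalHomeomorph.continuous.comp
          (continuous_fst.comp continuous_subtype_val)).tendsto q
      filter_upwards [hc.eventually h] with q' hq'
      change p (G.tgt q'.1.1) * a.fn q'.1.1 * b.fn q'.1.2 = _
      rw [hq', one_mul]
    · rw [zeroExt_of_notMem (by exact hq), zeroExt_of_notMem (by exact hq)]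

variable (E 𝕜) in
-- The last clause, vanishing near every point outside `W`, expresses that the support lies in `W`.
theorem exists_bump_univ {W : Set M} (hW : IsOpen W) {y : M} (hy : y ∈ W) :
    ∃ p : M → 𝕜, SmoothCompactlySupportedOn E Set.univ p ∧ (∀ᶠ z in 𝓝 y, p z = 1) ∧
      ∀ z ∉ W, ∀ᶠ z' in 𝓝 z, p z' = 0 := by
  obtain ⟨p, hp, ⟨K, hKW, hK, h0⟩, V, -, hV, hyV, h1⟩ :=
    exists_bump (E := E) 𝕜 isOpen_univ inferInstance hW (Set.subset_univ W) hy
  refine ⟨p, ⟨hp, K, Set.subset_univ K, hK, h0⟩, ?_, fun z hz => ?_⟩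
  · filter_upwards [hV.mem_nhds hyV] with z hz using h1 z hz
  · filter_upwards [hK.isClosed.isOpen_compl.mem_nhds fun h => hz (hKW h)] with z' hz'
      using h0 z' trivial hz'

/-- The elements of `A ⊗_R A` whose germ at `y` vanishes. -/
def germKer (y : M) : Submodule 𝕜 (convAlgebra G 𝕜).LL where
  carrier := {x | ∃ (p : M → 𝕜) (hp : SmoothCompactlySupportedOn E Set.univ p),
    (∀ᶠ z in 𝓝 y, p z = 1) ∧ (convAlgebra G 𝕜).lactLL (ofFun p hp) x = 0}
  zero_mem' := by
    obtain ⟨p, hp, h, -⟩ := exists_bump_univ E 𝕜 isOpen_univ (Set.mem_univ y)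
    exact ⟨p, hp, h, map_zero _⟩
  add_mem' := by
    rintro x x' ⟨p, hp, h1, h⟩ ⟨p', hp', h1', h'⟩
    refine ⟨p * p', hp'.mul_left hp.1, ?_, ?_⟩
    · filter_upwards [h1, h1'] with z hz hz'
      rw [Pi.mul_apply, hz, hz', one_mul]
    · rw [← ofFun_mul p p' hp hp', map_add, AlgebraOver.lactLL_mul, AlgebraOver.lactLL_mul, h',
        map_zero, add_zero, ← AlgebraOver.lactLL_mul, mul_comm, AlgebraOver.lactLL_mul, h, map_zero]
  smul_mem' := by
    rintro c x ⟨p, hp, h1, h⟩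
    exact ⟨p, hp, h1, by rw [map_smul, h, smul_zero]⟩

theorem omega_eq_zero_of_mem_germKer {y : M} {x : (convAlgebra G 𝕜).LL} (hx : x ∈ germKer y)
    (q : G.tgt.Pullback G.tgt) (hq : G.tgt q.1.1 = y) : omega G 𝕜 x q = 0 := by
  obtain ⟨p, hp, h1, h⟩ := hx
  rw [← omega_lactLL p hp x q (hq ▸ h1), h, map_zero, Pi.zero_apply]

theorem exists_isCompact_lactLL (x : (convAlgebra G 𝕜).LL) :
    ∃ C : Set M, IsCompact C ∧ ∀ (p : M → 𝕜) (hp : SmoothCompactlySupportedOn E Set.univ p),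
      (∀ y ∈ C, p y = 1) → (convAlgebra G 𝕜).lactLL (ofFun p hp) x = x := by
  induction x using AlgebraOver.induction_LL with
  | zero => exact ⟨∅, isCompact_empty, fun _ _ _ => map_zero _⟩
  | add x y hx hy =>
    obtain ⟨C, hC, h⟩ := hx
    obtain ⟨C', hC', h'⟩ := hy
    refine ⟨C ∪ C', hC.union hC', fun p hp hpC => ?_⟩
    rw [map_add, h p hp fun y hy => hpC y (Or.inl hy), h' p hp fun y hy => hpC y (Or.inr hy)]
  | tmul a b =>
    obtain ⟨C, hC, h⟩ := exists_isCompact_local_identity a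
    refine ⟨C, hC, fun p hp hpC => ?_⟩
    rw [AlgebraOver.lactLL_mk]
    exact congrArg (fun a => (convAlgebra G 𝕜).mkLL (a ⊗ₜ[𝕜] b)) (h p hp hpC).2

/-- Some compact `C` is such that any `p` equal to `1` on `C` fixes `x`. The local annihilating
functions are glued over `C` by `p + p' - pp'`, which still annihilates `x` and is `1` on the union;
the resulting `p` both fixes and kills `x`. -/
theorem eq_zero_of_forall_mem_germKer {x : (convAlgebra G 𝕜).LL} (hx : ∀ y, x ∈ germKer y) :
    x = 0 := by
  obtain ⟨C, hC, h⟩ := exists_isCompact_lactLL x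
  obtain ⟨p, hp, h1, h0⟩ : ∃ (p : M → 𝕜) (hp : SmoothCompactlySupportedOn E Set.univ p),
      (∀ y ∈ C, p y = 1) ∧ (convAlgebra G 𝕜).lactLL (ofFun p hp) x = 0 := by
    refine hC.induction_on (p := fun s => ∃ (p : M → 𝕜)
      (hp : SmoothCompactlySupportedOn E Set.univ p),
      (∀ y ∈ s, p y = 1) ∧ (convAlgebra G 𝕜).lactLL (ofFun p hp) x = 0) ?_ ?_ ?_ ?_
    · refine ⟨0, ⟨contMDiffOn_const, ∅, Set.empty_subset _, isCompact_empty, fun _ _ _ => rfl⟩,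
        fun _ h => h.elim, ?_⟩
      have : ofFun (E := E) (0 : M → 𝕜) ⟨contMDiffOn_const, ∅, Set.empty_subset _,
          isCompact_empty, fun _ _ _ => rfl⟩ = 0 :=
        Subtype.ext (zeroExt_eq_zero isOpen_univ fun _ _ => rfl)
      rw [this, AlgebraOver.lactLL_zero]
    · rintro s t hst ⟨p, hp, h1, h⟩
      exact ⟨p, hp, fun y hy => h1 y (hst hy), h⟩
    · rintro s t ⟨p, hp, h1, h⟩ ⟨p', hp', h1', h'⟩
      refine ⟨p + p' - p * p', (hp.add hp').sub (hp'.mul_left hp.1), ?_, ?_⟩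
      · rintro y (hy | hy)
        · simp [h1 y hy]
        · simp [h1' y hy]
      · have : ofFun (p + p' - p * p') ((hp.add hp').sub (hp'.mul_left hp.1)) =
            ofFun p hp + ofFun p' hp' - ofFun p hp * ofFun p' hp' := by
          rw [ofFun_mul]
          refine Subtype.ext ((zeroExt_sub _ _ _).trans ?_)
          rw [zeroExt_add]
          rfl
        rw [this, AlgebraOver.lactLL_sub, AlgebraOver.lactLL_add, AlgebraOver.lactLL_mul, h', h,
          map_zero, add_zero, sub_zero]
    · intro y _
      obtain ⟨p, hp, h1, h⟩ := hx y
      exact ⟨{z | p z = 1}, mem_nhdsWithin_of_mem_nhds h1, p, hp, fun _ h => h, h⟩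
  rw [← h p hp h1, h0]

variable (𝕜) in
theorem exists_sheet_eq_one (g : G.Arrow) :
    ∃ e : Sheet G 𝕜, g ∈ e.dom ∧ ∀ᶠ x in 𝓝 g, e.fn x = 1 := by
  obtain ⟨V, hV, hg, hV1, hV2⟩ := ((isLocalProperty_injOn G.src_isLocalHomeomorph).and
      (isLocalProperty_injOn G.tgt_isLocalHomeomorph)).exists_isOpen g
  obtain ⟨f, hf, ⟨K, hKV, hK, h0⟩, W, -, hW, hgW, h1⟩ :=
    exists_bump (E := E) 𝕜 hV (t2Space_of_injOn_tgt hV2) hV subset_rfl hg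
  refine ⟨⟨V, f, hV, hV1, hV2, hf, K, hKV, hK, h0⟩, hg, ?_⟩
  filter_upwards [hW.mem_nhds hgW] with x hx using h1 x hx

variable (𝕜) in
/-- A function with small support which is `1` near a given arrow. -/
def bumpSheet (g : G.Arrow) : Sheet G 𝕜 := (exists_sheet_eq_one 𝕜 g).choose

theorem mem_bumpSheet (g : G.Arrow) : g ∈ (bumpSheet 𝕜 g).dom :=
  (exists_sheet_eq_one 𝕜 g).choose_spec.1

theorem bumpSheet_eq_one (g : G.Arrow) : ∀ᶠ x in 𝓝 g, (bumpSheet 𝕜 g).fn x = 1 :=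
  (exists_sheet_eq_one 𝕜 g).choose_spec.2

/-- A function with small support is the pull-back of a function on `M`. -/
theorem Sheet.exists_global_descent (a : Sheet G 𝕜) :
    ∃ p : M → 𝕜, SmoothCompactlySupportedOn E Set.univ p ∧ (∀ x ∈ a.dom, p (G.tgt x) = a.fn x) ∧
      ∀ y ∉ G.tgt '' a.dom, ∀ᶠ z in 𝓝 y, p z = 0 := by
  obtain ⟨P, hP, hP'⟩ := exists_descent G.tgt_isLocalHomeomorph
    G.tgt_isLocalDiffeomorph.hasSmoothLocalInverses a.isOpen a.injOn_tgt a.smooth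
  obtain ⟨p, hp, h⟩ := exists_eq_zeroExt_univ (zeroExt_mem_Cc
    (G.tgt_isLocalHomeomorph.isOpenMap _ a.isOpen) inferInstance hP')
  refine ⟨p, hp, fun x hx => ?_, fun y hy => ?_⟩
  · have := congrFun h (G.tgt x)
    rw [zeroExt_of_mem (Set.mem_image_of_mem _ hx), zeroExt_of_mem (Set.mem_univ _)] at this
    rw [← hP x hx]
    exact (eventually_of_coe_germ_eq this).self_of_nhds.symm
  · have := congrFun h y
    rw [zeroExt_of_notMem hy, zeroExt_of_mem (Set.mem_univ _), ← Germ.coe_zero] at this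
    exact eventually_of_coe_germ_eq this.symm

/-- Near a point of `M`, a function with small support is either zero or a multiple of a fixed
function with small support. -/
theorem Sheet.exists_local_form (a : Sheet G 𝕜) (y : M) :
    (∃ W, IsOpen W ∧ y ∈ W ∧ ∀ (r : M → 𝕜) (hr : SmoothCompactlySupportedOn E Set.univ r),
      (∀ z ∉ W, ∀ᶠ z' in 𝓝 z, r z' = 0) → (convAlgebra G 𝕜).lact (ofFun r hr) a.toCc = 0) ∨
    ∃ (g : {g // G.tgt g = y}) (s : CcAlg 𝕜 E M), ∃ W, IsOpen W ∧ y ∈ W ∧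
      ∀ (r : M → 𝕜) (hr : SmoothCompactlySupportedOn E Set.univ r),
      (∀ z ∉ W, ∀ᶠ z' in 𝓝 z, r z' = 0) → (convAlgebra G 𝕜).lact (ofFun r hr) a.toCc =
        (convAlgebra G 𝕜).lact (ofFun r hr)
          ((convAlgebra G 𝕜).lact s (bumpSheet 𝕜 g.1).toCc) := by
  obtain ⟨p, hp, h1, h0⟩ := a.exists_global_descent
  by_cases hy : y ∈ G.tgt '' a.dom
  · right
    obtain ⟨g, hg, rfl⟩ := hy
    -- On `D` both sheets are defined and the bump equals `1`, so there `a` is the bump times the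
    -- descent of `a`.
    obtain ⟨D, hD, hDo, hgD⟩ := mem_nhds_iff.1 ((a.isOpen.mem_nhds hg |> inter_mem
      ((bumpSheet 𝕜 g).isOpen.mem_nhds (mem_bumpSheet g))) |> inter_mem (bumpSheet_eq_one (𝕜 := 𝕜) g))
    refine ⟨⟨g, rfl⟩, ofFun p hp, G.tgt '' D, G.tgt_isLocalHomeomorph.isOpenMap _ hDo,
      ⟨g, hgD, rfl⟩, fun r hr hrW => ?_⟩
    -- A point of the sheet outside `D` has target outside `t(D)`, by injectivity of `t`, and near
    -- it `r ∘ t` vanishes.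
    have key : ∀ (b : Sheet G 𝕜), D ⊆ b.dom → zeroExt b.dom ((r ∘ G.tgt) * b.fn) =
        zeroExt D ((r ∘ G.tgt) * b.fn) := by
      intro b hDb
      refine zeroExt_eq_of_eventually hDb fun x hx hxD => ?_
      have hxW : G.tgt x ∉ G.tgt '' D := by
        rintro ⟨x', hx', h⟩
        exact hxD (b.injOn_tgt (hDb hx') hx h ▸ hx')
      filter_upwards [(G.tgt_isLocalHomeomorph.continuous.tendsto x).eventually (hrW _ hxW)]
        with x' hx'
      rw [Pi.mul_apply, Function.comp_apply, hx', zero_mul]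
    rw [lact_toCc, lact_toCc, lact_toCc]
    refine Subtype.ext ((key a fun x hx => (hD hx).2.2).trans (Eq.trans ?_
      (key ((bumpSheet 𝕜 g).lact p hp.1) fun x hx => (hD hx).2.1).symm))
    refine zeroExt_congr hDo rfl fun x hx => ?_
    change r (G.tgt x) * a.fn x = r (G.tgt x) * (p (G.tgt x) * (bumpSheet 𝕜 g).fn x)
    have h2 : (bumpSheet 𝕜 g).fn x = 1 := (hD hx).1
    rw [h1 x (hD hx).2.2, h2, mul_one]
  · left
    obtain ⟨W, hW, hWo, hyW⟩ := mem_nhds_iff.1 (h0 y hy)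
    refine ⟨W, hWo, hyW, fun r hr hrW => ?_⟩
    rw [lact_toCc]
    refine Subtype.ext (zeroExt_eq_zero a.isOpen fun x hx => ?_)
    change r (G.tgt x) * a.fn x = 0
    rw [← h1 x hx]
    by_cases hxW : G.tgt x ∈ W
    · have h2 : p (G.tgt x) = 0 := hW hxW
      rw [h2, mul_zero]
    · rw [(hrW _ hxW).self_of_nhds, zero_mul]

variable (G 𝕜) in
/-- The element of `A ⊗_R A` with the germ `s` at `(g, h)`. -/
def germTensor (y : M) (i : {g // G.tgt g = y} × {g // G.tgt g = y}) (s : CcAlg 𝕜 E M) :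
    (convAlgebra G 𝕜).LL :=
  (convAlgebra G 𝕜).mkLL ((convAlgebra G 𝕜).lact s (bumpSheet 𝕜 i.1.1).toCc ⊗ₜ[𝕜]
    (bumpSheet 𝕜 i.2.1).toCc)

theorem germTensor_add (y : M) (i : {g // G.tgt g = y} × {g // G.tgt g = y})
    (s s' : CcAlg 𝕜 E M) :
    germTensor G 𝕜 y i (s + s') = germTensor G 𝕜 y i s + germTensor G 𝕜 y i s' := by
  simp [germTensor, TensorProduct.add_tmul]

theorem germTensor_zero (y : M) (i : {g // G.tgt g = y} × {g // G.tgt g = y}) :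
    germTensor G 𝕜 y i 0 = 0 := by
  simp [germTensor]

theorem exists_germ_expansion (y : M) (x : (convAlgebra G 𝕜).LL) :
    ∃ c : ({g // G.tgt g = y} × {g // G.tgt g = y}) →₀ CcAlg 𝕜 E M,
      x - c.sum (germTensor G 𝕜 y) ∈ germKer y := by
  classical
  induction x using LL_sheet_induction with
  | zero => exact ⟨0, by simp⟩
  | add x x' hx hx' =>
    obtain ⟨c, h⟩ := hx
    obtain ⟨c', h'⟩ := hx'
    refine ⟨c + c', ?_⟩
    rw [Finsupp.sum_add_index' (germTensor_zero y) (germTensor_add y), add_sub_add_comm]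
    exact add_mem h h'
  | basic a b =>
    rcases a.exists_local_form y with ⟨W, hW, hyW, ha⟩ | ⟨g, s, W, hW, hyW, ha⟩
    · obtain ⟨r, hr, hr1, hr0⟩ := exists_bump_univ E 𝕜 hW hyW
      refine ⟨0, r, hr, hr1, ?_⟩
      rw [Finsupp.sum_zero_index, sub_zero, AlgebraOver.lactLL_mk, ha r hr hr0,
        TensorProduct.zero_tmul, map_zero]
    rcases b.exists_local_form y with ⟨W', hW', hyW', hb⟩ | ⟨h, s', W', hW', hyW', hb⟩
    · obtain ⟨r, hr, hr1, hr0⟩ := exists_bump_univ E 𝕜 hW' hyW'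
      refine ⟨0, r, hr, hr1, ?_⟩
      rw [Finsupp.sum_zero_index, sub_zero, AlgebraOver.lactLL_mk, AlgebraOver.mkLL_lact,
        hb r hr hr0, TensorProduct.tmul_zero, map_zero]
    obtain ⟨r, hr, hr1, hr0⟩ := exists_bump_univ E 𝕜 (hW.inter hW') ⟨hyW, hyW'⟩
    -- The cut-off is squared so that each tensor factor receives its own copy of `r`; likewise `s *
    -- s'` splits into one coefficient per factor.
    refine ⟨Finsupp.single (g, h) (s * s'), r * r, hr.mul_left hr.1, ?_, ?_⟩
    · filter_upwards [hr1] with z hz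
      rw [Pi.mul_apply, hz, one_mul]
    · have h1 : (Finsupp.single (g, h) (s * s')).sum (germTensor G 𝕜 y) =
          germTensor G 𝕜 y (g, h) (s * s') := Finsupp.sum_single_index (germTensor_zero y _)
      rw [h1, map_sub, sub_eq_zero, ← ofFun_mul r r hr hr, germTensor,
        AlgebraOver.mkLL_lact_mul_tmul, AlgebraOver.lactLL_mul_mk, AlgebraOver.lactLL_mul_mk,
        ha r hr fun z hz => hr0 z fun h => hz h.1, hb r hr fun z hz => hr0 z fun h => hz h.2]

/-- The domain of a bump meets the target fibre of `y` only in the arrow at which the bump is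
centred. -/
theorem omega_germTensor_of_ne {y : M} {i j : {g // G.tgt g = y} × {g // G.tgt g = y}}
    (hij : i ≠ j) (s : CcAlg 𝕜 E M) :
    omega G 𝕜 (germTensor G 𝕜 y i s) ⟨(j.1.1, j.2.1), j.1.2.trans j.2.2.symm⟩ = 0 := by
  obtain ⟨p, hp, rfl⟩ := exists_ofFun s
  rw [germTensor, lact_toCc, omega_toCc]
  refine zeroExt_of_notMem ?_ _
  rintro ⟨h1, h2⟩
  exact hij (Prod.ext
    (Subtype.ext ((bumpSheet 𝕜 i.1.1).injOn_tgt (mem_bumpSheet _) h1 (i.1.2.trans j.1.2.symm)))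
    (Subtype.ext ((bumpSheet 𝕜 i.2.1).injOn_tgt (mem_bumpSheet _) h2 (i.2.2.trans j.2.2.symm))))

theorem germTensor_mem_germKer {y : M} {i : {g // G.tgt g = y} × {g // G.tgt g = y}}
    {s : CcAlg 𝕜 E M}
    (h : omega G 𝕜 (germTensor G 𝕜 y i s) ⟨(i.1.1, i.2.1), i.1.2.trans i.2.2.symm⟩ = 0) :
    germTensor G 𝕜 y i s ∈ germKer y := by
  obtain ⟨p, hp, rfl⟩ := exists_ofFun s
  obtain ⟨⟨g, hg⟩, ⟨g', hg'⟩⟩ := i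
  subst hg
  have hp0 : ∀ᶠ z in 𝓝 (G.tgt g), p z = 0 := by
    rw [germTensor, lact_toCc, omega_toCc,
      zeroExt_of_mem (by exact ⟨mem_bumpSheet _, mem_bumpSheet _⟩), ← Germ.coe_zero] at h
    have h2 := eventually_of_coe_germ_eq h
    have hφ : IsLocalHomeomorph (fun q : G.tgt.Pullback G.tgt => G.tgt q.1.1) :=
      G.tgt_isLocalHomeomorph.comp (isLocalHomeomorph_pullback_fst
        G.tgt_isLocalHomeomorph.continuous G.tgt_isLocalHomeomorph)
    let q : G.tgt.Pullback G.tgt := ⟨(g, g'), hg'.symm⟩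
    -- Projection to `M` is a local homeomorphism, so the vanishing of `p ∘ t` near `(g, g')`, where
    -- both bumps are `1`, descends to the vanishing of `p` near `y`.
    have h3 := hφ.map_nhds_eq q
    change ∀ᶠ z in 𝓝 (G.tgt q.1.1), p z = 0
    rw [← h3, eventually_map]
    filter_upwards [h2, (tendsto_pullback_fst q).eventually (bumpSheet_eq_one (𝕜 := 𝕜) g),
      (tendsto_pullback_snd q).eventually (bumpSheet_eq_one (𝕜 := 𝕜) g')] with q' e1 e2 e3
    change p (G.tgt q'.1.1) * (bumpSheet 𝕜 g).fn q'.1.1 * (bumpSheet 𝕜 g').fn q'.1.2 = 0 at e1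
    rwa [e2, e3, mul_one, mul_one] at e1
  obtain ⟨W, hW, hWo, hyW⟩ := mem_nhds_iff.1 hp0
  obtain ⟨r, hr, hr1, hr0⟩ := exists_bump_univ E 𝕜 hWo hyW
  refine ⟨r, hr, hr1, ?_⟩
  have : ofFun r hr * ofFun p hp = 0 := by
    rw [ofFun_mul]
    refine Subtype.ext (zeroExt_eq_zero isOpen_univ fun z _ => ?_)
    by_cases hz : z ∈ W
    · have h2 : p z = 0 := hW hz
      rw [Pi.mul_apply, h2, mul_zero]
    · rw [Pi.mul_apply, (hr0 z hz).self_of_nhds, zero_mul]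
  rw [germTensor, AlgebraOver.lactLL_mk, ← AlgebraOver.lact_mul, this, map_zero,
    LinearMap.zero_apply, TensorProduct.zero_tmul, map_zero]

/-- Fix `y` and expand an element of the kernel in tensors of bumps, modulo `germKer y`. Evaluating
at the pair `i` isolates the `i`-th summand, whose germ must therefore vanish, so the summand lies
in `germKer y`. Hence the whole element does, for every `y`. -/
theorem omega_injective : Function.Injective (omega G 𝕜) := by
  rw [injective_iff_map_eq_zero]
  intro x hx
  refine eq_zero_of_forall_mem_germKer fun y => ?_
  obtain ⟨c, hc⟩ := exists_germ_expansion y x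
  have hsum : c.sum (germTensor G 𝕜 y) ∈ germKer y := by
    refine Submodule.sum_mem _ fun i hi => germTensor_mem_germKer ?_
    have h := omega_eq_zero_of_mem_germKer hc ⟨(i.1.1, i.2.1), i.1.2.trans i.2.2.symm⟩ i.1.2
    rw [map_sub, hx, zero_sub, Pi.neg_apply, neg_eq_zero, Finsupp.sum, map_sum,
      Finset.sum_apply, Finset.sum_eq_single i (fun j _ hji => omega_germTensor_of_ne hji _)
        fun h => (h hi).elim] at h
    exact h
  simpa using add_mem hc hsum

end Omega

end EtGrpd

/-! ### Pure tensors and products of representatives -/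

namespace AlgebraOver

variable {𝕜 : Type*} [Field 𝕜] {R : Type*} [NonUnitalCommRing R] [Module 𝕜 R]
  [IsScalarTower 𝕜 R R] [SMulCommClass 𝕜 R R] {A : Type*} [AddCommGroup A] [Module 𝕜 A]
  (X : AlgebraOver 𝕜 R A)

theorem ractFst_mk (r : R) (a b : A) :
    X.ractFst r (X.mkLL (a ⊗ₜ[𝕜] b)) = X.mkLL (X.ract r a ⊗ₜ[𝕜] b) := by
  simp [ractFst]

theorem ractSnd_mk (r : R) (a b : A) :
    X.ractSnd r (X.mkLL (a ⊗ₜ[𝕜] b)) = X.mkLL (a ⊗ₜ[𝕜] X.ract r b) := by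
  simp [ractSnd]

theorem flipLL_mk (a b : A) : X.flipLL (X.mkLL (a ⊗ₜ[𝕜] b)) = X.mkLL (b ⊗ₜ[𝕜] a) :=
  X.liftLL_mk _ _ a b

theorem idCounit_mk (ε : A →ₗ[𝕜] R) (hε : ∀ r a, ε (X.lact r a) = r * ε a) (a b : A) :
    X.idCounit ε hε (X.mkLL (a ⊗ₜ[𝕜] b)) = X.lact (ε b) a :=
  X.liftLL_mk _ _ a b

theorem counitId_mk (ε : A →ₗ[𝕜] R) (hε : ∀ r a, ε (X.lact r a) = r * ε a) (a b : A) :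
    X.counitId ε hε (X.mkLL (a ⊗ₜ[𝕜] b)) = X.lact (ε a) b := by
  simp [counitId]

theorem mulRL_antipodeId_mk (S : A →ₗ[𝕜] A) (hS : ∀ r a, S (X.lact r a) = X.ract r (S a))
    (a b : A) : X.mulRL (X.antipodeId S hS (X.mkLL (a ⊗ₜ[𝕜] b))) = X.mul (S a) b := by
  simp [antipodeId, mulRL, liftRL, mkRL]

theorem comulId_mk (Δ : A →ₗ[𝕜] X.LL) (hΔ : ∀ r a, Δ (X.lact r a) = X.lactLL r (Δ a))
    (a b : A) : X.comulId Δ hΔ (X.mkLL (a ⊗ₜ[𝕜] b)) = X.tmulRight (Δ a) b := by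
  simp [comulId]

theorem idComul_mk (Δ : A →ₗ[𝕜] X.LL) (hΔ : ∀ r a, Δ (X.lact r a) = X.lactLL r (Δ a))
    (a b : A) : X.idComul Δ hΔ (X.mkLL (a ⊗ₜ[𝕜] b)) = X.tmulLeft a (Δ b) := by
  simp [idComul]

theorem tmulRight_mk (a b c : A) : X.tmulRight (X.mkLL (a ⊗ₜ[𝕜] b)) c = X.mk₃ a b c := by
  simp [tmulRight]

theorem tmulLeft_mk (a b c : A) : X.tmulLeft a (X.mkLL (b ⊗ₜ[𝕜] c)) = X.mk₃ a b c := by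
  simp [tmulLeft]

/-- Choosing suitable representatives makes both iterated coproducts equal to `a ⊗ e ⊗ e'`. -/
theorem comulId_eq_idComul (Δ : A →ₗ[𝕜] X.LL) (hΔ : ∀ r a, Δ (X.lact r a) = X.lactLL r (Δ a))
    {a e e' : A} (h : Δ a = X.mkLL (a ⊗ₜ[𝕜] e)) (h' : Δ a = X.mkLL (a ⊗ₜ[𝕜] e'))
    (he : Δ e = X.mkLL (e ⊗ₜ[𝕜] e')) : X.comulId Δ hΔ (Δ a) = X.idComul Δ hΔ (Δ a) := by
  have h1 : X.comulId Δ hΔ (Δ a) = X.mk₃ a e e' := by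
    rw [h', comulId_mk, h, tmulRight_mk]
  have h2 : X.idComul Δ hΔ (Δ a) = X.mk₃ a e e' := by
    rw [h, idComul_mk, he, tmulLeft_mk]
  rw [h1, h2]

/-- The right multiplication `a ⊗ b ↦ ac ⊗ bd` on `A ⊗_R^{ll} A`. -/
def rmulLL (c d : A) : X.LL →ₗ[𝕜] X.LL :=
  X.mapLL X (X.mul.flip c) (X.mul.flip d) (fun r a => X.mul_assoc (X.incl r) a c)
    (fun r a => X.mul_assoc (X.incl r) a d)

theorem rmulLL_mk (a b c d : A) :
    X.rmulLL c d (X.mkLL (a ⊗ₜ[𝕜] b)) = X.mkLL (X.mul a c ⊗ₜ[𝕜] X.mul b d) :=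
  X.mapLL_mk X _ _ _ _ a b

theorem mkLL_mulTensor_tmul (x : A ⊗[𝕜] A) (c d : A) :
    X.mkLL (X.mulTensor x (c ⊗ₜ[𝕜] d)) = X.rmulLL c d (X.mkLL x) := by
  have h : X.mkLL ∘ₗ X.mulTensor.flip (c ⊗ₜ[𝕜] d) = X.rmulLL c d ∘ₗ X.mkLL :=
    TensorProduct.ext' fun a b => by
      rw [LinearMap.comp_apply, LinearMap.comp_apply, rmulLL_mk]
      rfl
  exact LinearMap.congr_fun h x

theorem rmulLL_lact_left (r : R) (c d : A) (x : X.LL) :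
    X.rmulLL (X.lact r c) d x = X.rmulLL c d (X.ractFst r x) := by
  have h : X.rmulLL (X.lact r c) d = X.rmulLL c d ∘ₗ X.ractFst r :=
    hom_ext_LL fun a b => by simp [rmulLL_mk, ractFst_mk, lact_apply, ract_apply, X.mul_assoc]
  exact LinearMap.congr_fun h x

theorem rmulLL_lact_right (r : R) (c d : A) (x : X.LL) :
    X.rmulLL c (X.lact r d) x = X.rmulLL c d (X.ractSnd r x) := by
  have h : X.rmulLL c (X.lact r d) = X.rmulLL c d ∘ₗ X.ractSnd r :=
    hom_ext_LL fun a b => by simp [rmulLL_mk, ractSnd_mk, lact_apply, ract_apply, X.mul_assoc]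
  exact LinearMap.congr_fun h x

/-- The class of the componentwise product of `x` and `y` only depends on the classes of `x` and
`y` in `A ⊗_R^{ll} A`, if the two right actions of `R` coincide on the class of `x`. -/
theorem mkLL_mulTensor_congr {x x' y y' : A ⊗[𝕜] A} (hx : X.mkLL x = X.mkLL x')
    (hy : X.mkLL y = X.mkLL y') (h : ∀ r, X.ractFst r (X.mkLL x) = X.ractSnd r (X.mkLL x)) :
    X.mkLL (X.mulTensor x y) = X.mkLL (X.mulTensor x' y') := by
  have h1 : X.mkLL ∘ₗ X.mulTensor x = X.mkLL ∘ₗ X.mulTensor x' :=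
    TensorProduct.ext' fun c d => by
      simp only [LinearMap.comp_apply, mkLL_mulTensor_tmul, hx]
  -- Moving `r` between the factors of the second tensor amounts to applying one or the other right
  -- action to `x`, and these agree by `h`.
  have h2 : X.relLL ≤ LinearMap.ker (X.mkLL ∘ₗ X.mulTensor x) := by
    refine Submodule.span_le.2 ?_
    rintro _ ⟨r, c, d, rfl⟩
    rw [SetLike.mem_coe, LinearMap.mem_ker, map_sub, sub_eq_zero, LinearMap.comp_apply,
      LinearMap.comp_apply, mkLL_mulTensor_tmul, mkLL_mulTensor_tmul, rmulLL_lact_left,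
      rmulLL_lact_right, h]
  have h3 : y - y' ∈ X.relLL := (Submodule.Quotient.eq _).1 hy
  have h4 := h2 h3
  rw [LinearMap.mem_ker, map_sub, sub_eq_zero] at h4
  exact h4.trans (LinearMap.congr_fun h1 y')

section IsMulCompatible

/-- `Δ(ab) = Δ(a)Δ(b)`, where the product on the right is computed on representatives. -/
def IsMulCompatible (Δ : A →ₗ[𝕜] X.LL) (a b : A) : Prop :=
  ∀ x y : A ⊗[𝕜] A, X.mkLL x = Δ a → X.mkLL y = Δ b → Δ (X.mul a b) = X.mkLL (X.mulTensor x y)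

variable {X} {Δ : A →ₗ[𝕜] X.LL}

/-- One pair of representatives suffices, once the right actions agree on the image of `Δ`; this is
what makes multiplicativity an additive condition in each argument. -/
theorem isMulCompatible_of_eq
    (hΔ : ∀ r a, X.ractFst r (Δ a) = X.ractSnd r (Δ a)) {a b : A} {x y : A ⊗[𝕜] A} (hx : X.mkLL x = Δ a)
    (hy : X.mkLL y = Δ b) (h : Δ (X.mul a b) = X.mkLL (X.mulTensor x y)) :
    X.IsMulCompatible Δ a b := fun x' y' hx' hy' =>
  h.trans (X.mkLL_mulTensor_congr (hx.trans hx'.symm) (hy.trans hy'.symm) fun r => by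
    rw [hx, hΔ])

theorem isMulCompatible_zero_left
    (hΔ : ∀ r a, X.ractFst r (Δ a) = X.ractSnd r (Δ a)) (b : A) : X.IsMulCompatible Δ 0 b := by
  obtain ⟨y, hy⟩ := X.relLL.mkQ_surjective (Δ b)
  exact isMulCompatible_of_eq hΔ (x := 0) (by rw [map_zero, map_zero]) hy (by
    simp only [map_zero, LinearMap.zero_apply])

theorem isMulCompatible_zero_right
    (hΔ : ∀ r a, X.ractFst r (Δ a) = X.ractSnd r (Δ a)) (a : A) : X.IsMulCompatible Δ a 0 := by
  obtain ⟨x, hx⟩ := X.relLL.mkQ_surjective (Δ a)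
  exact isMulCompatible_of_eq hΔ (y := 0) hx (by rw [map_zero, map_zero]) (by
    simp only [map_zero])

theorem isMulCompatible_add_left
    (hΔ : ∀ r a, X.ractFst r (Δ a) = X.ractSnd r (Δ a)) {a a' b : A} (h : X.IsMulCompatible Δ a b)
    (h' : X.IsMulCompatible Δ a' b) : X.IsMulCompatible Δ (a + a') b := by
  obtain ⟨x, hx⟩ := X.relLL.mkQ_surjective (Δ a)
  obtain ⟨x', hx'⟩ := X.relLL.mkQ_surjective (Δ a')
  obtain ⟨y, hy⟩ := X.relLL.mkQ_surjective (Δ b)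
  refine isMulCompatible_of_eq hΔ (x := x + x') (y := y) ?_ hy ?_
  · rw [map_add, map_add]
    exact congrArg₂ _ hx hx'
  · rw [map_add, LinearMap.add_apply, map_add, h x y hx hy, h' x' y hx' hy, map_add,
      LinearMap.add_apply, map_add]

theorem isMulCompatible_add_right
    (hΔ : ∀ r a, X.ractFst r (Δ a) = X.ractSnd r (Δ a)) {a b b' : A} (h : X.IsMulCompatible Δ a b)
    (h' : X.IsMulCompatible Δ a b') : X.IsMulCompatible Δ a (b + b') := by
  obtain ⟨x, hx⟩ := X.relLL.mkQ_surjective (Δ a)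
  obtain ⟨y, hy⟩ := X.relLL.mkQ_surjective (Δ b)
  obtain ⟨y', hy'⟩ := X.relLL.mkQ_surjective (Δ b')
  refine isMulCompatible_of_eq hΔ (x := x) (y := y + y') hx ?_ ?_
  · rw [map_add, map_add]
    exact congrArg₂ _ hy hy'
  · rw [map_add, map_add, h x y hx hy, h' x y' hx hy', map_add, map_add]

end IsMulCompatible

end AlgebraOver

/-! ### Comultiplication, counit and antipode -/

namespace EtGrpd

variable {E : Type v} [NormedAddCommGroup E] [NormedSpace ℝ E] [FiniteDimensional ℝ E]
  {M : Type w} [TopologicalSpace M] [T2Space M] [ChartedSpace E M] [IsManifold 𝓘(ℝ, E) ∞ M]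
  {G : EtGrpd.{u} E M} {𝕜 : Type z} [RCLike 𝕜]

theorem Sheet.exists_unit (a : Sheet G 𝕜) :
    ∃ e : Sheet G 𝕜, e.dom = a.dom ∧ ∀ x ∈ a.dom, a.fn x * e.fn x = a.fn x := by
  obtain ⟨-, K, hKa, hK, h0⟩ := a.smooth
  obtain ⟨χ, hχ, W, -, -, hKW, h1⟩ :=
    exists_smooth_eq_one_of_isCompact (E := E) 𝕜 a.isOpen a.t2Space hK hKa
  refine ⟨{ a with fn := χ, smooth := hχ }, rfl, fun x hx => ?_⟩
  by_cases hxK : x ∈ K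
  · exact (congrArg _ (h1 x (hKW hxK))).trans (mul_one _)
  · rw [h0 x hx hxK, zero_mul]

/-- A function with small support which is `1` on the support of `a`. -/
def Sheet.one (a : Sheet G 𝕜) : Sheet G 𝕜 := a.exists_unit.choose

theorem Sheet.one_dom (a : Sheet G 𝕜) : a.one.dom = a.dom := a.exists_unit.choose_spec.1

theorem Sheet.fn_mul_one (a : Sheet G 𝕜) {x : G.Arrow} (hx : x ∈ a.dom) :
    a.fn x * a.one.fn x = a.fn x := a.exists_unit.choose_spec.2 x hx

/-- The diagonal is injective, so its fibres have at most one point. -/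
theorem mem_fiberFinite_diag (u : GermSection 𝕜 G.Arrow) :
    u ∈ fiberFinite 𝕜 (fun y => (⟨(y, y), rfl⟩ : G.tgt.Pullback G.tgt)) := by
  intro q
  refine Set.Subsingleton.finite ?_
  rintro ⟨x, hx⟩ - ⟨x', hx'⟩ -
  exact Subtype.ext (congrArg (fun p => p.1.1) (hx.trans hx'.symm))

variable (G 𝕜) in
/-- The push-forward along the diagonal. -/
def diagCc : Cc 𝕜 E G.Arrow →ₗ[𝕜] GermSection 𝕜 (G.tgt.Pullback G.tgt) where
  toFun u := pushforward (isLocalHomeomorph_diag G.tgt_isLocalHomeomorph)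
    (u : GermSection 𝕜 G.Arrow)
  map_add' _ _ := pushforward_add _ (mem_fiberFinite_diag _) (mem_fiberFinite_diag _)
  map_smul' c _ := pushforward_smul _ c (mem_fiberFinite_diag _)

/-- Two arrows of one bisection with the same target coincide, so the domain of `Ω(b ⊗ c)` is the
diagonal of that bisection, and the value there is `bc = a`. -/
theorem omega_eq_diagCc {a b c : Sheet G 𝕜} (hb : b.dom = a.dom) (hc : c.dom = a.dom)
    (h : ∀ x ∈ a.dom, b.fn x * c.fn x = a.fn x) :
    omega G 𝕜 ((convAlgebra G 𝕜).mkLL (b.toCc ⊗ₜ[𝕜] c.toCc)) = diagCc G 𝕜 a.toCc := by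
  refine (omega_toCc b c).trans (Eq.trans ?_ (pushforward_zeroExt
    (isLocalHomeomorph_diag G.tgt_isLocalHomeomorph) a.isOpen (fun x _ y _ hxy =>
      congrArg (fun p => p.1.1) hxy) (F := fun q => b.fn q.1.1 * c.fn q.1.2) h).symm)
  refine zeroExt_congr (isOpen_pullback_prod _ _ b.isOpen c.isOpen) ?_ fun _ _ => rfl
  ext ⟨⟨x, y⟩, e⟩
  rw [hb, hc]
  constructor
  · rintro ⟨hx, hy⟩
    have hxy : x = y := a.injOn_tgt hx hy e
    subst hxy
    exact ⟨x, hx, rfl⟩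
  · rintro ⟨z, hz, h⟩
    have h1 : z = x := congrArg (fun p => p.1.1) h
    have h2 : z = y := congrArg (fun p => p.1.2) h
    exact ⟨h1 ▸ hz, h2 ▸ hz⟩

theorem diagCc_mem_range_omega (u : Cc 𝕜 E G.Arrow) :
    diagCc G 𝕜 u ∈ LinearMap.range (omega G 𝕜) := by
  induction u using sheet_induction with
  | zero => rw [map_zero]; exact zero_mem _
  | add u u' h h' => rw [map_add]; exact add_mem h h'
  | basic a => exact ⟨_, omega_eq_diagCc rfl a.one_dom fun x hx => a.fn_mul_one hx⟩

variable (G 𝕜) in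
/-- The comultiplication `Ω_{t,t}⁻¹ ∘ diag_+`. -/
def comulCc : Cc 𝕜 E G.Arrow →ₗ[𝕜] (convAlgebra G 𝕜).LL :=
  (LinearEquiv.ofInjective (omega G 𝕜) omega_injective).symm.toLinearMap ∘ₗ
    (diagCc G 𝕜).codRestrict (LinearMap.range (omega G 𝕜)) diagCc_mem_range_omega

theorem omega_comulCc (u : Cc 𝕜 E G.Arrow) : omega G 𝕜 (comulCc G 𝕜 u) = diagCc G 𝕜 u :=
  congrArg Subtype.val (LinearEquiv.apply_symm_apply
    (LinearEquiv.ofInjective (omega G 𝕜) omega_injective) _)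

/-- The freedom in the factorisation is the main tool below: two tensors are equal as soon as they
factor the same sheet. -/
theorem comulCc_toCc {a b c : Sheet G 𝕜} (hb : b.dom = a.dom) (hc : c.dom = a.dom)
    (h : ∀ x ∈ a.dom, b.fn x * c.fn x = a.fn x) :
    comulCc G 𝕜 a.toCc = (convAlgebra G 𝕜).mkLL (b.toCc ⊗ₜ[𝕜] c.toCc) :=
  omega_injective ((omega_comulCc _).trans (omega_eq_diagCc hb hc h).symm)

theorem comulCc_toCc_one (a : Sheet G 𝕜) :
    comulCc G 𝕜 a.toCc = (convAlgebra G 𝕜).mkLL (a.toCc ⊗ₜ[𝕜] a.one.toCc) :=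
  comulCc_toCc rfl a.one_dom fun _ hx => a.fn_mul_one hx

theorem comulCc_lact (r : CcAlg 𝕜 E M) (u : Cc 𝕜 E G.Arrow) :
    comulCc G 𝕜 ((convAlgebra G 𝕜).lact r u) =
      (convAlgebra G 𝕜).lactLL r (comulCc G 𝕜 u) := by
  obtain ⟨p, hp, rfl⟩ := exists_ofFun r
  induction u using sheet_induction with
  | zero => simp only [map_zero]
  | add u u' h h' => simp only [map_add, h, h']
  | basic a =>
    rw [comulCc_toCc_one, AlgebraOver.lactLL_mk, lact_toCc]
    refine comulCc_toCc rfl a.one_dom fun x hx => ?_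
    change p (G.tgt x) * a.fn x * _ = p (G.tgt x) * a.fn x
    rw [_root_.mul_assoc, a.fn_mul_one hx]

/-- Both sides are factorisations of the sheet `(p ∘ s)a`, with `p ∘ s` attached to one factor or
the other. -/
theorem ract_comulCc (r : CcAlg 𝕜 E M) (u : Cc 𝕜 E G.Arrow) :
    (convAlgebra G 𝕜).ractFst r (comulCc G 𝕜 u) =
      (convAlgebra G 𝕜).ractSnd r (comulCc G 𝕜 u) := by
  obtain ⟨p, hp, rfl⟩ := exists_ofFun r
  induction u using sheet_induction with
  | zero => simp only [map_zero]
  | add u u' h h' => simp only [map_add, h, h']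
  | basic a =>
    rw [comulCc_toCc_one, AlgebraOver.ractFst_mk, AlgebraOver.ractSnd_mk, ract_toCc, ract_toCc]
    refine (comulCc_toCc (a := a.ract p hp.1) rfl a.one_dom fun x hx => ?_).symm.trans
      (comulCc_toCc rfl a.one_dom fun x hx => ?_)
    · change p (G.src x) * a.fn x * _ = p (G.src x) * a.fn x
      rw [_root_.mul_assoc, a.fn_mul_one hx]
    · change a.fn x * (p (G.src x) * a.one.fn x) = p (G.src x) * a.fn x
      rw [mul_left_comm, a.fn_mul_one hx]

/-- On the targets of the common domain `ε(a)` is the descent of `a`; pulled back by `t` it is `a`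
again. Both counit axioms follow with `{a, b}` a sheet and its local unit. -/
theorem counitCc_toCc_lact (a b : Sheet G 𝕜) (hab : a.dom = b.dom) {c : Sheet G 𝕜}
    (hc : c.dom = b.dom) (h : ∀ x ∈ b.dom, a.fn x * b.fn x = c.fn x) :
    (convAlgebra G 𝕜).lact (counitCc G 𝕜 a.toCc) b.toCc = c.toCc := by
  obtain ⟨p, hp, hp'⟩ := exists_ofFun (counitCc G 𝕜 a.toCc)
  rw [hp', lact_toCc]
  refine Sheet.toCc_congr hc.symm fun x hx => ?_
  obtain ⟨F, hF⟩ := exists_comp_eq a.injOn_tgt a.fn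
  have h1 : zeroExt (G.tgt '' a.dom) F = zeroExt Set.univ p :=
    (pushforward_zeroExt G.tgt_isLocalHomeomorph a.isOpen a.injOn_tgt hF).symm.trans
      (congrArg Subtype.val hp')
  have hxa : x ∈ a.dom := hab ▸ hx
  have h2 := congrFun h1 (G.tgt x)
  rw [zeroExt_of_mem (Set.mem_image_of_mem _ hxa), zeroExt_of_mem (Set.mem_univ _)] at h2
  have h3 := (eventually_of_coe_germ_eq h2).self_of_nhds
  change p (G.tgt x) * b.fn x = c.fn x
  rw [← h3, hF x hxa, h x hx]

theorem counitCc_lact (r : CcAlg 𝕜 E M) (u : Cc 𝕜 E G.Arrow) :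
    counitCc G 𝕜 ((convAlgebra G 𝕜).lact r u) = r * counitCc G 𝕜 u := by
  obtain ⟨p, hp, rfl⟩ := exists_ofFun r
  induction u using sheet_induction with
  | zero => simp only [map_zero, mul_zero]
  | add u u' h h' => simp only [map_add, h, h', mul_add]
  | basic a =>
    rw [lact_toCc]
    obtain ⟨F, hF⟩ := exists_comp_eq a.injOn_tgt a.fn
    refine Subtype.ext ?_
    have h1 : pushforward G.tgt_isLocalHomeomorph (zeroExt a.dom ((p ∘ G.tgt) * a.fn)) =
        zeroExt (G.tgt '' a.dom) (p * F) :=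
      pushforward_zeroExt _ a.isOpen a.injOn_tgt fun x hx => by
        rw [Pi.mul_apply, hF x hx]; rfl
    have h2 : pushforward G.tgt_isLocalHomeomorph (zeroExt a.dom a.fn) =
        zeroExt (G.tgt '' a.dom) F := pushforward_zeroExt _ a.isOpen a.injOn_tgt hF
    have h3 : zeroExt Set.univ p * zeroExt (G.tgt '' a.dom) F =
        zeroExt (G.tgt '' a.dom) (p * F) := by
      rw [zeroExt_mul_zeroExt, Set.univ_inter]
    exact h1.trans (h3.symm.trans (congrArg _ h2.symm))

theorem idCounit_comulCc (u : Cc 𝕜 E G.Arrow) :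
    (convAlgebra G 𝕜).idCounit (counitCc G 𝕜) counitCc_lact (comulCc G 𝕜 u) = u := by
  induction u using sheet_induction with
  | zero => simp only [map_zero]
  | add u u' h h' => simp only [map_add, h, h']
  | basic a =>
    rw [comulCc_toCc_one, AlgebraOver.idCounit_mk]
    exact counitCc_toCc_lact a.one a a.one_dom rfl fun x hx =>
      (mul_comm _ _).trans (a.fn_mul_one hx)

theorem counitId_comulCc (u : Cc 𝕜 E G.Arrow) :
    (convAlgebra G 𝕜).counitId (counitCc G 𝕜) counitCc_lact (comulCc G 𝕜 u) = u := by
  induction u using sheet_induction with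
  | zero => simp only [map_zero]
  | add u u' h h' => simp only [map_add, h, h']
  | basic a =>
    rw [comulCc_toCc_one, AlgebraOver.counitId_mk]
    exact counitCc_toCc_lact a a.one a.one_dom.symm a.one_dom.symm fun x hx =>
      a.fn_mul_one (a.one_dom ▸ hx)

/-- The function with small support on `G` defined by a function on `M`. -/
def unitSheet (p : M → 𝕜) (hp : SmoothCompactlySupportedOn E Set.univ p) : Sheet G 𝕜 where
  dom := Set.range G.unit
  fn := p ∘ G.tgt
  isOpen := G.isOpen_range_unit
  injOn_src := G.injOn_src_range_unit
  injOn_tgt := G.injOn_tgt_range_unit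
  smooth := by
    obtain ⟨hp, K, -, hK, h0⟩ := hp
    refine ⟨hp.comp G.tgt_isLocalDiffeomorph.contMDiff.contMDiffOn fun _ _ => trivial,
      G.unit '' K, Set.image_subset_range _ _, hK.image G.unit_isLocalHomeomorph.continuous, ?_⟩
    rintro _ ⟨x, rfl⟩ hx
    rw [Function.comp_apply, G.tgt_unit]
    exact h0 x trivial fun h => hx ⟨x, h, rfl⟩

theorem inclCc_ofFun (p : M → 𝕜) (hp : SmoothCompactlySupportedOn E Set.univ p) :
    inclCc G 𝕜 (ofFun p hp) = (unitSheet p hp).toCc :=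
  Subtype.ext (coe_inclCc_ofFun p hp)

theorem comulCc_inclCc (r s : CcAlg 𝕜 E M) : comulCc G 𝕜 (inclCc G 𝕜 (r * s)) =
    (convAlgebra G 𝕜).mkLL (inclCc G 𝕜 r ⊗ₜ[𝕜] inclCc G 𝕜 s) := by
  obtain ⟨p, hp, rfl⟩ := exists_ofFun r
  obtain ⟨q, hq, rfl⟩ := exists_ofFun s
  rw [ofFun_mul, inclCc_ofFun, inclCc_ofFun, inclCc_ofFun]
  exact comulCc_toCc rfl rfl fun _ _ => rfl

/-- The convolution of the local units of `a` and `b` is a local unit for their convolution: at `xy`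
the values multiply to `a(x)e(x)b(y)e'(y) = a(x)b(y)`. -/
theorem comulCc_mul_toCc (a b : Sheet G 𝕜) : comulCc G 𝕜 (convCc G 𝕜 a.toCc b.toCc) =
    (convAlgebra G 𝕜).mkLL ((convAlgebra G 𝕜).mulTensor (a.toCc ⊗ₜ[𝕜] a.one.toCc)
      (b.toCc ⊗ₜ[𝕜] b.one.toCc)) := by
  have h : (convAlgebra G 𝕜).mulTensor (a.toCc ⊗ₜ[𝕜] a.one.toCc) (b.toCc ⊗ₜ[𝕜] b.one.toCc) =
      convCc G 𝕜 a.toCc b.toCc ⊗ₜ[𝕜] convCc G 𝕜 a.one.toCc b.one.toCc := rfl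
  rw [h, convCc_toCc, convCc_toCc]
  refine comulCc_toCc rfl ?_ ?_
  · change G.setMul a.one.dom b.one.dom = G.setMul a.dom b.dom
    rw [a.one_dom, b.one_dom]
  · rintro _ ⟨⟨⟨x, y⟩, e⟩, ⟨hx, hy⟩, rfl⟩
    rw [Sheet.mul_fn _ _ e hx hy, Sheet.mul_fn _ _ e (a.one_dom.symm ▸ hx) (b.one_dom.symm ▸ hy),
      mul_mul_mul_comm, a.fn_mul_one hx, b.fn_mul_one hy]

theorem isMulCompatible_comulCc (u v : Cc 𝕜 E G.Arrow) :
    (convAlgebra G 𝕜).IsMulCompatible (comulCc G 𝕜) u v := by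
  induction u, v using sheet_induction₂ with
  | zero_left b => exact AlgebraOver.isMulCompatible_zero_left ract_comulCc b
  | zero_right b => exact AlgebraOver.isMulCompatible_zero_right ract_comulCc b
  | add_left a a' b h h' => exact AlgebraOver.isMulCompatible_add_left ract_comulCc h h'
  | add_right a b b' h h' => exact AlgebraOver.isMulCompatible_add_right ract_comulCc h h'
  | basic a b =>
    exact AlgebraOver.isMulCompatible_of_eq ract_comulCc (comulCc_toCc_one a).symm
      (comulCc_toCc_one b).symm (comulCc_mul_toCc a b)

variable (G 𝕜) in
/-- The antipode `inv_+`. -/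
def antipodeCc : Cc 𝕜 E G.Arrow →ₗ[𝕜] Cc 𝕜 E G.Arrow :=
  pushCc G.inv_isLocalHomeomorph G.inv_isLocalDiffeomorph.hasSmoothLocalInverses

theorem inv_injective : Function.Injective G.inv := fun g h e => by
  rw [← inv_inv g, e, inv_inv]

/-- The image of a function with small support under the inverse map. -/
def Sheet.inv (a : Sheet G 𝕜) : Sheet G 𝕜 where
  dom := G.inv '' a.dom
  fn := a.fn ∘ G.inv
  isOpen := G.inv_isLocalHomeomorph.isOpenMap _ a.isOpen
  injOn_src := by
    rintro _ ⟨x, hx, rfl⟩ _ ⟨y, hy, rfl⟩ h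
    rw [G.src_inv, G.src_inv] at h
    rw [a.injOn_tgt hx hy h]
  injOn_tgt := by
    rintro _ ⟨x, hx, rfl⟩ _ ⟨y, hy, rfl⟩ h
    rw [G.tgt_inv, G.tgt_inv] at h
    rw [a.injOn_src hx hy h]
  smooth := by
    obtain ⟨ha, K, hK, hKc, h0⟩ := a.smooth
    refine ⟨ha.comp G.inv_isLocalDiffeomorph.contMDiff.contMDiffOn ?_, G.inv '' K,
      Set.image_mono hK, hKc.image G.inv_isLocalHomeomorph.continuous, ?_⟩
    · rintro _ ⟨x, hx, rfl⟩
      rwa [Set.mem_preimage, inv_inv]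
    · rintro _ ⟨x, hx, rfl⟩ h
      rw [Function.comp_apply, inv_inv]
      exact h0 x hx fun hxK => h ⟨x, hxK, rfl⟩

theorem Sheet.inv_fn (a : Sheet G 𝕜) (x : G.Arrow) : a.inv.fn (G.inv x) = a.fn x :=
  congrArg a.fn (inv_inv x)

theorem antipodeCc_toCc (a : Sheet G 𝕜) : antipodeCc G 𝕜 a.toCc = a.inv.toCc :=
  Subtype.ext (pushforward_zeroExt G.inv_isLocalHomeomorph a.isOpen inv_injective.injOn
    fun x _ => a.inv_fn x)

theorem antipodeCc_inclCc (r : CcAlg 𝕜 E M) :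
    antipodeCc G 𝕜 (inclCc G 𝕜 r) = inclCc G 𝕜 r :=
  Subtype.ext (pushforward_comp _ G.unit_isLocalDiffeomorph.hasSmoothLocalInverses _ _
    inv_unit r.2)

theorem antipodeCc_antipodeCc (u : Cc 𝕜 E G.Arrow) :
    antipodeCc G 𝕜 (antipodeCc G 𝕜 u) = u := by
  have hid : IsLocalHomeomorph (id : G.Arrow → G.Arrow) :=
    (Homeomorph.refl G.Arrow).isLocalHomeomorph
  exact Subtype.ext ((pushforward_comp _ G.inv_isLocalDiffeomorph.hasSmoothLocalInverses _ hid
    inv_inv u.2).trans (pushforward_id hid (fun _ => rfl) _ u.2))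

theorem antipodeCc_convCc (u v : Cc 𝕜 E G.Arrow) :
    antipodeCc G 𝕜 (convCc G 𝕜 u v) = convCc G 𝕜 (antipodeCc G 𝕜 v) (antipodeCc G 𝕜 u) := by
  induction u, v using sheet_induction₂ with
  | zero_left b => simp
  | zero_right b => simp
  | add_left a a' b h h' => simp only [map_add, LinearMap.add_apply, h, h']
  | add_right a b b' h h' => simp only [map_add, LinearMap.add_apply, h, h']
  | basic a b =>
    rw [convCc_toCc, antipodeCc_toCc, antipodeCc_toCc, antipodeCc_toCc, convCc_toCc]
    refine Sheet.toCc_congr ?_ ?_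
    · ext g
      constructor
      · rintro ⟨_, ⟨⟨⟨x, y⟩, e⟩, ⟨hx, hy⟩, rfl⟩, rfl⟩
        rw [inv_mul_rev]
        exact mem_setMul (Set.mem_image_of_mem _ hy) (Set.mem_image_of_mem _ hx) _
      · rintro ⟨⟨⟨_, _⟩, e⟩, ⟨⟨y, hy, rfl⟩, ⟨x, hx, rfl⟩⟩, rfl⟩
        have e' : G.src x = G.tgt y := by
          rw [← G.tgt_inv, ← G.src_inv y]
          exact e.symm
        rw [← inv_mul_rev _ _ e']
        exact ⟨_, mem_setMul hx hy e', rfl⟩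
    · rintro _ ⟨_, ⟨⟨⟨x, y⟩, e⟩, ⟨hx, hy⟩, rfl⟩, rfl⟩
      rw [Sheet.inv_fn, Sheet.mul_fn _ _ e hx hy, inv_mul_rev,
        Sheet.mul_fn _ _ _ (Set.mem_image_of_mem _ hy) (Set.mem_image_of_mem _ hx), Sheet.inv_fn,
        Sheet.inv_fn, mul_comm]

theorem antipodeCc_lact (r : CcAlg 𝕜 E M) (u : Cc 𝕜 E G.Arrow) :
    antipodeCc G 𝕜 ((convAlgebra G 𝕜).lact r u) =
      (convAlgebra G 𝕜).ract r (antipodeCc G 𝕜 u) := by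
  rw [AlgebraOver.lact_apply, AlgebraOver.ract_apply]
  exact (antipodeCc_convCc _ _).trans (congrArg _ (antipodeCc_inclCc r))

/-- For a sheet, `S(a)e` is supported on the products `x⁻¹y` with `x, y` in one bisection and `t(x)
= t(y)`. Then `x = y`, and the product is the unit at `s(x)`, with value `a(x)`. -/
theorem mul_antipodeCc (u : Cc 𝕜 E G.Arrow) :
    (convAlgebra G 𝕜).mulRL ((convAlgebra G 𝕜).antipodeId (antipodeCc G 𝕜) antipodeCc_lact
      (comulCc G 𝕜 u)) = inclCc G 𝕜 (counitCc G 𝕜 (antipodeCc G 𝕜 u)) := by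
  induction u using sheet_induction with
  | zero => simp only [map_zero]
  | add u u' h h' => simp only [map_add, h, h']
  | basic a =>
    have h1 : (convAlgebra G 𝕜).mulRL ((convAlgebra G 𝕜).antipodeId (antipodeCc G 𝕜)
        antipodeCc_lact (comulCc G 𝕜 a.toCc)) =
          convCc G 𝕜 (antipodeCc G 𝕜 a.toCc) a.one.toCc := by
      rw [comulCc_toCc_one, AlgebraOver.mulRL_antipodeId_mk]
      rfl
    obtain ⟨F, hF⟩ := exists_comp_eq a.inv.injOn_tgt a.inv.fn
    have h2 : pushforward G.unit_isLocalHomeomorph (pushforward G.tgt_isLocalHomeomorph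
        (zeroExt a.inv.dom a.inv.fn)) =
          zeroExt (G.unit '' (G.tgt '' a.inv.dom)) (F ∘ G.tgt) := by
      rw [pushforward_zeroExt G.tgt_isLocalHomeomorph a.inv.isOpen a.inv.injOn_tgt hF,
        pushforward_zeroExt G.unit_isLocalHomeomorph
          (G.tgt_isLocalHomeomorph.isOpenMap _ a.inv.isOpen) G.injective_unit.injOn]
      intro x _
      rw [Function.comp_apply, G.tgt_unit]
    rw [h1, antipodeCc_toCc, convCc_toCc]
    refine Subtype.ext (Eq.trans ?_ h2.symm)
    rw [Sheet.coe_toCc]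
    refine zeroExt_congr (Sheet.isOpen _) ?_ ?_
    · ext g
      constructor
      · rintro ⟨⟨⟨_, y⟩, e⟩, ⟨⟨x, hx, rfl⟩, hy⟩, rfl⟩
        have hy' : y ∈ a.dom := a.one_dom ▸ hy
        obtain rfl : x = y := a.injOn_tgt hx hy' ((G.src_inv x).symm.trans e)
        rw [G.inv_mul]
        exact ⟨_, ⟨G.inv x, ⟨x, hx, rfl⟩, G.tgt_inv x⟩, rfl⟩
      · rintro ⟨_, ⟨_, ⟨x, hx, rfl⟩, rfl⟩, rfl⟩
        rw [G.tgt_inv, ← G.inv_mul]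
        exact mem_setMul (Set.mem_image_of_mem _ hx) (a.one_dom.symm ▸ hx) _
    · rintro _ ⟨⟨⟨_, y⟩, e⟩, ⟨⟨x, hx, rfl⟩, hy⟩, rfl⟩
      have hy' : y ∈ a.dom := a.one_dom ▸ hy
      obtain rfl : x = y := a.injOn_tgt hx hy' ((G.src_inv x).symm.trans e)
      rw [Sheet.mul_fn _ _ e (Set.mem_image_of_mem _ hx) hy, Sheet.inv_fn, a.fn_mul_one hx, Function.comp_apply,
        G.tgt_mul]
      exact ((hF _ ⟨x, hx, rfl⟩).trans (a.inv_fn x)).symm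

end EtGrpd

/-! ### The Hopf algebroid of a groupoid and its functoriality -/

namespace EtGrpd

variable {E : Type v} [NormedAddCommGroup E] [NormedSpace ℝ E] [FiniteDimensional ℝ E]
  {M : Type w} [TopologicalSpace M] [T2Space M] [ChartedSpace E M] [IsManifold 𝓘(ℝ, E) ∞ M]
  {G H : EtGrpd.{u} E M} {𝕜 : Type z} [RCLike 𝕜]

variable (G 𝕜) in
/-- The Hopf algebroid of smooth functions with compact support on an étale Lie groupoid. -/
def hopfAlgebroid : HopfAlgebroidStr 𝕜 (CcAlg 𝕜 E M) (Cc 𝕜 E G.Arrow) where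
  toAlgebraOver := convAlgebra G 𝕜
  comul := comulCc G 𝕜
  counit := counitCc G 𝕜
  antipode := antipodeCc G 𝕜
  comul_lact := comulCc_lact
  counit_lact := counitCc_lact
  id_counit := idCounit_comulCc
  counit_id := counitId_comulCc
  counit_incl := counitCc_inclCc
  comul_incl := comulCc_inclCc
  ract_comul := ract_comulCc
  comul_mul := isMulCompatible_comulCc
  antipode_incl := antipodeCc_inclCc
  antipode_antipode := antipodeCc_antipodeCc
  antipode_mul := antipodeCc_convCc
  mul_antipode_id := mul_antipodeCc

theorem isGroupoidHopfAlgebroid_hopfAlgebroid :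
    IsGroupoidHopfAlgebroid G (hopfAlgebroid G 𝕜) where
  mul_eq _ _ := rfl
  incl_eq _ := rfl
  comul_eq u x := by
    rw [← omega_mkLL]
    refine ⟨fun h => (congrArg (omega G 𝕜) h.symm).trans (omega_comulCc u), fun h => ?_⟩
    exact omega_injective ((omega_comulCc u).trans h.symm)
  counit_eq _ := rfl
  antipode_eq _ := rfl

theorem flipLL_comulCc (u : Cc 𝕜 E G.Arrow) :
    (convAlgebra G 𝕜).flipLL (comulCc G 𝕜 u) = comulCc G 𝕜 u := by
  induction u using sheet_induction with
  | zero => simp only [map_zero]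
  | add u u' h h' => simp only [map_add, h, h']
  | basic a =>
    have h : comulCc G 𝕜 a.toCc = (convAlgebra G 𝕜).mkLL (a.one.toCc ⊗ₜ[𝕜] a.toCc) :=
      comulCc_toCc a.one_dom rfl fun x hx => (mul_comm _ _).trans (a.fn_mul_one hx)
    rw [comulCc_toCc_one, AlgebraOver.flipLL_mk, ← comulCc_toCc_one, h]

theorem comulId_comulCc (u : Cc 𝕜 E G.Arrow) :
    (convAlgebra G 𝕜).comulId (comulCc G 𝕜) comulCc_lact (comulCc G 𝕜 u) =
      (convAlgebra G 𝕜).idComul (comulCc G 𝕜) comulCc_lact (comulCc G 𝕜 u) := by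
  induction u using sheet_induction with
  | zero => simp only [map_zero]
  | add u u' h h' => simp only [map_add, h, h']
  | basic a =>
    -- With `e` the local unit of `a` and `e'` that of `e`, one has `a e' = a e e' = a e = a`.
    have h : comulCc G 𝕜 a.toCc = (convAlgebra G 𝕜).mkLL (a.toCc ⊗ₜ[𝕜] a.one.one.toCc) := by
      refine comulCc_toCc rfl (a.one.one_dom.trans a.one_dom) fun x hx => ?_
      have h1 := a.one.fn_mul_one (x := x) (a.one_dom.symm ▸ hx)
      rw [← a.fn_mul_one hx, _root_.mul_assoc, h1]
    exact AlgebraOver.comulId_eq_idComul _ _ comulCc_lact (comulCc_toCc_one a) h (comulCc_toCc_one a.one)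

/-- Since `t ∘ φ = t`, a local inverse of `φ` is the target of `H` followed by a local inverse of
the target of `G`. -/
theorem Hom.hasSmoothLocalInverses (φ : G ⟶ H) :
    HasSmoothLocalInverses E (Hom.toFun φ) := by
  intro x
  have hx := G.tgt_isLocalDiffeomorph x
  refine ⟨hx.localInverse ∘ H.tgt, ?_, ?_⟩
  · refine ContMDiffAt.comp _ ?_ H.tgt_isLocalDiffeomorph.contMDiff.contMDiffAt
    rw [Hom.tgt_map φ]
    exact hx.localInverse_contMDiffAt
  · filter_upwards [hx.localInverse_eventuallyEq_left] with y hy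
    rw [Function.comp_apply, Hom.tgt_map φ]
    exact hy

theorem Hom.map_inv (φ : G ⟶ H) (g : G.Arrow) :
    Hom.toFun φ (G.inv g) = H.inv (Hom.toFun φ g) := by
  refine eq_inv_of_mul_eq_unit
    (by rw [Hom.src_map φ, Hom.tgt_map φ, G.src_inv]) ?_
  have h := Hom.map_mul φ ⟨(G.inv g, g), G.src_inv g⟩
  rw [G.inv_mul, Hom.map_unit φ] at h
  exact h.symm.trans (congrArg H.unit (Hom.src_map φ g).symm)

variable (𝕜) in
/-- The push-forward `φ_+` along a morphism of étale Lie groupoids. -/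
def mapCc (φ : G ⟶ H) : Cc 𝕜 E G.Arrow →ₗ[𝕜] Cc 𝕜 E H.Arrow :=
  pushCc (Hom.isLocalHomeomorph φ) (Hom.hasSmoothLocalInverses φ)

theorem Sheet.injOn_map (φ : G ⟶ H) (a : Sheet G 𝕜) : Set.InjOn (Hom.toFun φ) a.dom :=
  fun x hx y hy h => a.injOn_tgt hx hy (by rw [← Hom.tgt_map φ, h, Hom.tgt_map φ])

theorem Sheet.exists_map (φ : G ⟶ H) (a : Sheet G 𝕜) :
    ∃ b : Sheet H 𝕜, b.dom = Hom.toFun φ '' a.dom ∧ ∀ x ∈ a.dom, b.fn (Hom.toFun φ x) = a.fn x := by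
  obtain ⟨F, hF, hF'⟩ := exists_descent (Hom.isLocalHomeomorph φ) (Hom.hasSmoothLocalInverses φ)
    a.isOpen (a.injOn_map φ) a.smooth
  refine ⟨⟨_, F, (Hom.isLocalHomeomorph φ).isOpenMap _ a.isOpen, ?_, ?_, hF'⟩, rfl, hF⟩
  · rintro _ ⟨x, hx, rfl⟩ _ ⟨y, hy, rfl⟩ h
    rw [Hom.src_map φ, Hom.src_map φ] at h
    rw [a.injOn_src hx hy h]
  · rintro _ ⟨x, hx, rfl⟩ _ ⟨y, hy, rfl⟩ h
    rw [Hom.tgt_map φ, Hom.tgt_map φ] at h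
    rw [a.injOn_tgt hx hy h]

theorem mapCc_toCc (φ : G ⟶ H) {a : Sheet G 𝕜} {b : Sheet H 𝕜}
    (hb : b.dom = Hom.toFun φ '' a.dom) (h : ∀ x ∈ a.dom, b.fn (Hom.toFun φ x) = a.fn x) :
    mapCc 𝕜 φ a.toCc = b.toCc :=
  Subtype.ext ((pushforward_zeroExt (Hom.isLocalHomeomorph φ) a.isOpen (a.injOn_map φ) h).trans
    (by rw [← hb]; rfl))

/-- A morphism preserves source and target, so `φ(x)` and `φ(y)` are composable exactly when `x` and
`y` are; hence `φ(U)φ(V) = φ(UV)`. -/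
theorem mapCc_convCc (φ : G ⟶ H) (u v : Cc 𝕜 E G.Arrow) :
    mapCc 𝕜 φ (convCc G 𝕜 u v) = convCc H 𝕜 (mapCc 𝕜 φ u) (mapCc 𝕜 φ v) := by
  induction u, v using sheet_induction₂ with
  | zero_left b => simp
  | zero_right b => simp
  | add_left a a' b h h' => simp only [map_add, LinearMap.add_apply, h, h']
  | add_right a b b' h h' => simp only [map_add, h, h']
  | basic a b =>
    obtain ⟨a', ha, ha'⟩ := a.exists_map φ
    obtain ⟨b', hb, hb'⟩ := b.exists_map φ
    rw [convCc_toCc, mapCc_toCc φ ha ha', mapCc_toCc φ hb hb', convCc_toCc]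
    refine mapCc_toCc φ ?_ ?_
    · change H.setMul a'.dom b'.dom = Hom.toFun φ '' G.setMul a.dom b.dom
      rw [ha, hb]
      ext g
      constructor
      · rintro ⟨⟨⟨_, _⟩, e⟩, ⟨⟨x, hx, rfl⟩, ⟨y, hy, rfl⟩⟩, rfl⟩
        have e' : G.src x = G.tgt y := by
          rw [← Hom.src_map φ, ← Hom.tgt_map φ]
          exact e
        exact ⟨_, mem_setMul hx hy e', Hom.map_mul φ _⟩
      · rintro ⟨_, ⟨⟨⟨x, y⟩, e⟩, ⟨hx, hy⟩, rfl⟩, rfl⟩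
        rw [Hom.map_mul φ]
        exact mem_setMul (Set.mem_image_of_mem _ hx) (Set.mem_image_of_mem _ hy) _
    · rintro _ ⟨⟨⟨x, y⟩, e⟩, ⟨hx, hy⟩, rfl⟩
      rw [Hom.map_mul φ, Sheet.mul_fn _ _ _ (ha ▸ Set.mem_image_of_mem _ hx)
        (hb ▸ Set.mem_image_of_mem _ hy), Sheet.mul_fn _ _ e hx hy]
      exact congrArg₂ _ (ha' x hx) (hb' y hy)

theorem mapCc_inclCc (φ : G ⟶ H) (r : CcAlg 𝕜 E M) :
    mapCc 𝕜 φ (inclCc G 𝕜 r) = inclCc H 𝕜 r :=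
  Subtype.ext (pushforward_comp _ G.unit_isLocalDiffeomorph.hasSmoothLocalInverses _ _
    (Hom.map_unit φ) r.2)

theorem counitCc_mapCc (φ : G ⟶ H) (u : Cc 𝕜 E G.Arrow) :
    counitCc H 𝕜 (mapCc 𝕜 φ u) = counitCc G 𝕜 u :=
  Subtype.ext (pushforward_comp _ (Hom.hasSmoothLocalInverses φ) _ _ (Hom.tgt_map φ) u.2)

theorem antipodeCc_mapCc (φ : G ⟶ H) (u : Cc 𝕜 E G.Arrow) :
    antipodeCc H 𝕜 (mapCc 𝕜 φ u) = mapCc 𝕜 φ (antipodeCc G 𝕜 u) := by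
  have hc : IsLocalHomeomorph (H.inv ∘ Hom.toFun φ) :=
    H.inv_isLocalHomeomorph.comp (Hom.isLocalHomeomorph φ)
  exact Subtype.ext ((pushforward_comp _ (Hom.hasSmoothLocalInverses φ) _ hc
    (fun _ => rfl) u.2).trans (pushforward_comp _
      G.inv_isLocalDiffeomorph.hasSmoothLocalInverses _ hc (Hom.map_inv φ) u.2).symm)

theorem mapCc_lact (φ : G ⟶ H) (r : CcAlg 𝕜 E M) (u : Cc 𝕜 E G.Arrow) :
    mapCc 𝕜 φ ((convAlgebra G 𝕜).lact r u) = (convAlgebra H 𝕜).lact r (mapCc 𝕜 φ u) :=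
  (mapCc_convCc φ (inclCc G 𝕜 r) u).trans (by rw [mapCc_inclCc]; rfl)

/-- The factorisation `a = ae` is carried to a factorisation of the image sheet on `φ(U)`. -/
theorem mapLL_comulCc (φ : G ⟶ H) (u : Cc 𝕜 E G.Arrow) :
    (convAlgebra G 𝕜).mapLL (convAlgebra H 𝕜) (mapCc 𝕜 φ) (mapCc 𝕜 φ) (mapCc_lact φ)
      (mapCc_lact φ) (comulCc G 𝕜 u) = comulCc H 𝕜 (mapCc 𝕜 φ u) := by
  induction u using sheet_induction with
  | zero => simp only [map_zero]
  | add u u' h h' => simp only [map_add, h, h']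
  | basic a =>
    obtain ⟨b, hb, hb'⟩ := a.exists_map φ
    obtain ⟨c, hc, hc'⟩ := a.one.exists_map φ
    rw [comulCc_toCc_one, AlgebraOver.mapLL_mk, mapCc_toCc φ hb hb', mapCc_toCc φ hc hc']
    refine (comulCc_toCc rfl (by rw [hb, hc, a.one_dom]) fun y hy => ?_).symm
    rw [hb] at hy
    obtain ⟨x, hx, rfl⟩ := hy
    rw [hb' x hx, hc' x (a.one_dom.symm ▸ hx), a.fn_mul_one hx]

theorem mapCc_id (u : Cc 𝕜 E G.Arrow) : mapCc 𝕜 (𝟙 G) u = u :=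
  Subtype.ext (pushforward_id _ (fun _ => rfl) _ u.2)

theorem mapCc_comp {K : EtGrpd.{u} E M} (φ : G ⟶ H) (ψ : H ⟶ K) (u : Cc 𝕜 E G.Arrow) :
    mapCc 𝕜 (φ ≫ ψ) u = mapCc 𝕜 ψ (mapCc 𝕜 φ u) :=
  Subtype.ext (pushforward_comp _ (Hom.hasSmoothLocalInverses φ) _ _ (fun _ => rfl) u.2).symm

variable (E M 𝕜) in
/-- The functor `G ↦ C_c^∞(G)`, `φ ↦ φ_+`. -/
def hopfFunctor : EtGrpd.{u} E M ⥤ HoAlgd 𝕜 (CcAlg 𝕜 E M) where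
  obj G := ⟨Cc 𝕜 E G.Arrow, hopfAlgebroid G 𝕜⟩
  map φ :=
    { toLin := mapCc 𝕜 φ
      map_mul := mapCc_convCc φ
      map_incl := mapCc_inclCc φ
      map_counit := counitCc_mapCc φ
      map_comul := mapLL_comulCc φ
      map_antipode := antipodeCc_mapCc φ }
  map_id _ := HoAlgd.Hom.ext (LinearMap.ext mapCc_id)
  map_comp φ ψ := HoAlgd.Hom.ext (LinearMap.ext (mapCc_comp φ ψ))

end EtGrpd

end GroupoidHopf

end

open GroupoidHopf in
theorem proposition18 (𝕜 : Type z) [RCLike 𝕜]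
    (E : Type v) [NormedAddCommGroup E] [NormedSpace ℝ E] [FiniteDimensional ℝ E]
    (M : Type w) [TopologicalSpace M] [T2Space M] [ChartedSpace E M]
    [IsManifold 𝓘(ℝ, E) ∞ M] :
    ∃ H : ∀ G : EtGrpd.{u} E M, HopfAlgebroidStr 𝕜 (CcAlg 𝕜 E M) (Cc 𝕜 E G.Arrow),
      (∀ G, IsGroupoidHopfAlgebroid G (H G) ∧ (H G).IsCocommutative ∧ (H G).IsCoassociative) ∧
      ∃ (F : EtGrpd.{u} E M ⥤ HoAlgd 𝕜 (CcAlg 𝕜 E M))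
        (hF : ∀ G, F.obj G = ⟨Cc 𝕜 E G.Arrow, H G⟩),
        ∀ (G G' : EtGrpd.{u} E M) (φ : G ⟶ G') (a : Cc 𝕜 E G.Arrow),
          ((HoAlgd.Hom.toLin (eqToHom (hF G).symm ≫ F.map φ ≫ eqToHom (hF G')) a :
              Cc 𝕜 E G'.Arrow) : GermSection 𝕜 G'.Arrow) =
            pushforward (EtGrpd.Hom.isLocalHomeomorph φ) (a : GermSection 𝕜 G.Arrow) := by
  refine ⟨fun G => EtGrpd.hopfAlgebroid G 𝕜, fun G =>
    ⟨EtGrpd.isGroupoidHopfAlgebroid_hopfAlgebroid, EtGrpd.flipLL_comulCc, EtGrpd.comulId_comulCc⟩,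
    EtGrpd.hopfFunctor E M 𝕜, fun _ => rfl, fun G G' φ a => ?_⟩
  -- The object equalities are reflexivities, so both `eqToHom` factors reduce to identities.
  rfl
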